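/- For integers $n\ge 2k\ge 2$ define $\varphi(n,k)$ by $$\frac{\prod_{j=0}^{k-1}(n/2-j)}{\prod_{j=0}^{k-1}(n-j)}=\frac{\varphi(n,k)}{2^{k}},$$ and let $H_k(n,m)$ be a uniformly random $k$-uniform hypergraph with vertex set $\{0,\dots,n-1\}$ and exactly $m$ distinct edges. Given a hypergraph $H$ and a red/blue coloring of its vertices, call a vertex $v$ *safe* if there is no edge $e\ni v$ of $H$ such that all vertices of $e\setminus\{v\}$ have the color opposite to that of $v$. A *greedy recoloring step* may be made when there is a monochromatic edge; it switches the colors of a safe red vertex $u$ and a safe blue vertex $v$, where $u$ lies in a red monochromatic edge if there is one, and $v$ lies in a blue monochromatic edge if there is one. Fix $\alpha<1/2$. Let $n=n(k)$ be a sequence of even integers that is superlinear ($k=o(n)$) and polynomially bounded ($n=O(k^{d})$ for some $d$) as $k\to\infty$, and let $m=m(k)$ satisfy, for all sufficiently large $k$, $$m\le 2\alpha\,\frac{n\ln k}{k}\,\varphi(n,k)^{-1}\,2^{k-1}.$$ Then there is an efficient algorithm (a program of a random access machine that halts on every $k$-uniform hypergraph, for all $k$, $n$ and numbers $M$ of edges,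 after a number of steps polynomial in the input size $n+kM$) and, for each even $N$, a fixed partition of $\{0,\dots,N-1\}$ into $N/2$ red and $N/2$ blue vertices, such that asymptotically almost surely (with probability tending to $1$ as $k\to\infty$), on input $H_k(n,m)$, in whatever order the edges and their vertices are listed, the algorithm returns a proper two-coloring (one without monochromatic edges) that is obtained from the fixed partition by a finite sequence of greedy recoloring steps. -/

import Mathlib

open Filter Asymptotics Topology

namespace HypergraphColoring

/-! ### Random `k`-graphs -/

/-- The number `φ(n,k)` with `(n/2)(n/2-1)⋯(n/2-k+1) / (n(n-1)⋯(n-k+1)) = φ(n,k) / 2^k`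
(meaningful for `n ≥ 2k`). -/
noncomputable def phi (n k : ℕ) : ℝ :=
  2 ^ k * ((∏ j ∈ Finset.range k, ((n : ℝ) / 2 - j)) / ∏ j ∈ Finset.range k, ((n : ℝ) - j))

/-- A hypergraph on the vertex set `Fin n`, given by its set of edges. -/
abbrev Hypergraph (n : ℕ) := Finset (Finset (Fin n))

/-- All `k`-graphs on `n` vertices with exactly `m` (distinct) edges. -/
def kGraphs (n k m : ℕ) : Finset (Hypergraph n) :=
  (Finset.univ.powersetCard k).powersetCard m

open Classical in
/-- The probability of the event `E` for `H_k(n,m)`, a uniformly random element of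
`kGraphs n k m`. -/
noncomputable def prob (n k m : ℕ) (E : Hypergraph n → Prop) : ℝ :=
  (((kGraphs n k m).filter E).card : ℝ) / ((kGraphs n k m).card : ℝ)

/-! ### Two-colorings and greedy recoloring -/

/-- A two-coloring; `true` is red and `false` is blue. -/
abbrev Coloring (n : ℕ) := Fin n → Bool

/-- All vertices of the edge `e` have color `b`. -/
def MonoIn {n : ℕ} (c : Coloring n) (b : Bool) (e : Finset (Fin n)) : Prop :=
  ∀ v ∈ e, c v = b

/-- No edge is monochromatic. -/
def Proper {n : ℕ} (H : Hypergraph n) (c : Coloring n) : Prop :=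
  ∀ e ∈ H, ∀ b, ¬ MonoIn c b e

/-- Both color classes have the same number of vertices. -/
def Equitable {n : ℕ} (c : Coloring n) : Prop :=
  (Finset.univ.filter fun v => c v = true).card = (Finset.univ.filter fun v => c v = false).card

/-- `v` is the head of `e`: all the other vertices of `e` have the color that `v` does not have. -/
def IsHead {n : ℕ} (c : Coloring n) (v : Fin n) (e : Finset (Fin n)) : Prop :=
  v ∈ e ∧ ∀ w ∈ e, w ≠ v → c w = !(c v)

/-- A vertex is safe if it is not the head of any edge. -/
def Safe {n : ℕ} (H : Hypergraph n) (c : Coloring n) (v : Fin n) : Prop :=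
  ∀ e ∈ H, ¬ IsHead c v e

/-- `v` is a safe vertex of color `b`, taken from a monochromatic edge of color `b` if there is
one. -/
def Candidate {n : ℕ} (H : Hypergraph n) (c : Coloring n) (b : Bool) (v : Fin n) : Prop :=
  c v = b ∧ Safe H c v ∧ ((∃ e ∈ H, MonoIn c b e) → ∃ e ∈ H, MonoIn c b e ∧ v ∈ e)

/-- One step of greedy recoloring: there still is a monochromatic edge, and the colors of a red
and of a blue candidate are switched. -/
def SwapStep {n : ℕ} (H : Hypergraph n) (c c' : Coloring n) : Prop :=
  ¬ Proper H c ∧ ∃ u v, Candidate H c true u ∧ Candidate H c false v ∧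
    c' = Function.update (Function.update c u false) v true

/-- `c` is obtained from `c₀` by finitely many greedy recoloring steps. -/
def GreedyReaches {n : ℕ} (H : Hypergraph n) (c₀ c : Coloring n) : Prop :=
  Relation.ReflTransGen (SwapStep H) c₀ c

/-! ### Programs of a random access machine, with step count

The memory consists of arrays of natural numbers, indexed by natural numbers (a program names only
finitely many of them); scalars are cells of arrays.  The arithmetic operations are addition and
truncated subtraction, with comparisons; there is no multiplication, so that the uniform cost
measure is polynomially related to Turing machine time. -/

/-- Memory contents: `s a i` is cell `i` of array `a`. -/
abbrev Memory := ℕ → ℕ → ℕ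

/-- Expressions. -/
inductive Expr : Type
  | lit (c : ℕ)
  | read (a : ℕ) (i : Expr)
  | add (e f : Expr)
  | sub (e f : Expr)
  | lt (e f : Expr)
  | eq (e f : Expr)

/-- Value of an expression; comparisons return `1` or `0`. -/
def Expr.eval (s : Memory) : Expr → ℕ
  | .lit c => c
  | .read a i => s a (i.eval s)
  | .add e f => e.eval s + f.eval s
  | .sub e f => e.eval s - f.eval s
  | .lt e f => if e.eval s < f.eval s then 1 else 0
  | .eq e f => if e.eval s = f.eval s then 1 else 0

/-- The number of elementary operations for evaluating an expression. -/
def Expr.size : Expr → ℕ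
  | .lit _ => 1
  | .read _ i => i.size + 1
  | .add e f => e.size + f.size + 1
  | .sub e f => e.size + f.size + 1
  | .lt e f => e.size + f.size + 1
  | .eq e f => e.size + f.size + 1

/-- Programs; `write a i e` stores the value of `e` in cell `i` of array `a`. -/
inductive Program : Type
  | skip
  | write (a : ℕ) (i e : Expr)
  | seq (p q : Program)
  | ite (e : Expr) (p q : Program)
  | loop (e : Expr) (p : Program)

/-- Storing `x` in cell `i` of array `a`. -/
def Memory.set (s : Memory) (a i x : ℕ) : Memory :=
  Function.update s a (Function.update (s a) i x)

/-- `Exec p s t s'`: the program `p`, started with memory `s`, halts after exactly `t` steps with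
memory `s'`. A test succeeds if its value is nonzero. -/
inductive Exec : Program → Memory → ℕ → Memory → Prop
  | skip (s : Memory) : Exec .skip s 1 s
  | write (a : ℕ) (i e : Expr) (s : Memory) :
      Exec (.write a i e) s (i.size + e.size + 1) (s.set a (i.eval s) (e.eval s))
  | seq {p q : Program} {s s₁ s₂ : Memory} {t₁ t₂ : ℕ} :
      Exec p s t₁ s₁ → Exec q s₁ t₂ s₂ → Exec (.seq p q) s (t₁ + t₂) s₂
  | ite_true {e : Expr} {p q : Program} {s s₁ : Memory} {t : ℕ} :
      e.eval s ≠ 0 → Exec p s t s₁ → Exec (.ite e p q) s (e.size + 1 + t) s₁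
  | ite_false {e : Expr} {p q : Program} {s s₁ : Memory} {t : ℕ} :
      e.eval s = 0 → Exec q s t s₁ → Exec (.ite e p q) s (e.size + 1 + t) s₁
  | loop_true {e : Expr} {p : Program} {s s₁ s₂ : Memory} {t₁ t₂ : ℕ} :
      e.eval s ≠ 0 → Exec p s t₁ s₁ → Exec (.loop e p) s₁ t₂ s₂ →
      Exec (.loop e p) s (e.size + 1 + t₁ + t₂) s₂
  | loop_false {e : Expr} {p : Program} {s : Memory} :
      e.eval s = 0 → Exec (.loop e p) s (e.size + 1) s

/-- Programs are deterministic: the running time and the final memory are determined by the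
initial memory. -/
theorem Exec.deterministic {p : Program} {s s₁ s₂ : Memory} {t₁ t₂ : ℕ}
    (h₁ : Exec p s t₁ s₁) (h₂ : Exec p s t₂ s₂) : t₁ = t₂ ∧ s₁ = s₂ := by
  induction h₁ generalizing t₂ s₂ with
  | skip s => cases h₂; exact ⟨rfl, rfl⟩
  | write a i e s => cases h₂; exact ⟨rfl, rfl⟩
  | seq _ _ ih₁ ih₂ =>
    cases h₂ with
    | seq a b =>
      obtain ⟨rfl, rfl⟩ := ih₁ a
      obtain ⟨rfl, rfl⟩ := ih₂ b
      exact ⟨rfl, rfl⟩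
  | ite_true he _ ih =>
    cases h₂ with
    | ite_true _ a => obtain ⟨rfl, rfl⟩ := ih a; exact ⟨rfl, rfl⟩
    | ite_false he' _ => exact absurd he' he
  | ite_false he _ ih =>
    cases h₂ with
    | ite_true he' _ => exact absurd he he'
    | ite_false _ a => obtain ⟨rfl, rfl⟩ := ih a; exact ⟨rfl, rfl⟩
  | loop_true he _ _ ih₁ ih₂ =>
    cases h₂ with
    | loop_true _ a b =>
      obtain ⟨rfl, rfl⟩ := ih₁ a
      obtain ⟨rfl, rfl⟩ := ih₂ b
      exact ⟨rfl, rfl⟩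
    | loop_false he' => exact absurd he' he
  | loop_false he =>
    cases h₂ with
    | loop_true he' _ _ => exact absurd he he'
    | loop_false _ => exact ⟨rfl, rfl⟩

/-! ### Hypergraphs as inputs, colorings as outputs -/

/-- `L` lists the edges of `H`, each exactly once, and each as a list of its vertices without
repetition; the orders are arbitrary. -/
def IsListing {n : ℕ} (H : Hypergraph n) (L : List (List (Fin n))) : Prop :=
  (∀ l ∈ L, l.Nodup) ∧ (L.map List.toFinset).Nodup ∧ (L.map List.toFinset).toFinset = H

/-- The initial memory for a list `L` of edges of size `k` on `n` vertices: array `0` holds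
`n`, `k` and the number of edges, array `1` holds the edges one after another (the `j`-th vertex of
the `i`-th edge is in cell `i * k + j`), and everything else is `0`. -/
def inputMemory (n k : ℕ) (L : List (List (Fin n))) : Memory := fun a i =>
  if a = 0 then [n, k, L.length].getD i 0
  else if a = 1 then (L.flatten.map Fin.val).getD i 0
  else 0

/-- The coloring that is read off the memory: `v` is red if cell `v` of array `2` is nonzero. -/
def outputColoring (n : ℕ) (s : Memory) : Coloring n := fun v => decide (s 2 v ≠ 0)

/-- On every `k`-graph (with any `n`, `k` and number of edges, listed in any way) the program halts,
within a number of steps that is polynomial in the size `n + k * (number of edges)`. -/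
def PolyTime (P : Program) : Prop :=
  ∃ C d : ℕ, ∀ (n k : ℕ) (H : Hypergraph n), (∀ e ∈ H, e.card = k) →
    ∀ L, IsListing H L → ∃ t s, Exec P (inputMemory n k L) t s ∧ t ≤ C * (n + k * H.card + 1) ^ d

/-- On the `k`-graph `H`, however it is listed, the program `P` returns a proper coloring that is
obtained from the coloring `c₀` by greedy recoloring. -/
def FindsProperColoring (P : Program) {n : ℕ} (k : ℕ) (c₀ : Coloring n) (H : Hypergraph n) : Prop :=
  ∀ L, IsListing H L → ∃ t s, Exec P (inputMemory n k L) t s ∧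
    Proper H (outputColoring n s) ∧ GreedyReaches H c₀ (outputColoring n s)

end HypergraphColoring

namespace HypergraphColoring

/-! ### The scanning procedure -/

/-! Greedy recoloring is made deterministic by a scan that starts from the parity coloring. Each
color class has two reserved stretches of positions `y`: below `n/16` only vertices lying in
monochromatic edges are chosen, and between `n/16` and `n/8` vertices are chosen only once their
color has no monochromatic edge left, to serve as partners for the other color. One pointer runs
through each class, so no vertex is tested twice while searching its color. Switching two safe
vertices creates no monochromatic edge (`monoIn_of_swap`), and every switch destroys at least one.
Hence all that ever matters about monochromatic edges is settled at the start, and the number of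
switches is at most the number of edges that are monochromatic initially.

The probabilistic core is the principle of deferred decisions. A safety test only asks whether some
edge has a given vertex as head. If every edge has at least three vertices outside the reserved
stretches, the sets asked about are disjoint from all sets asked about before
(`disjoint_query_known`), while the earlier answers determine the course of the scan
(`run_eq_of_known`). Given the past, the rest of the hypergraph is therefore uniform on the
unexamined sets, of which nearly all remain. A vertex expects about `m * C(n/2, k-1) / C(n, k)`,
that is, at most about `2α ln k` edges with itself as head, so a test succeeds with conditional
probability at least `γ = k^(-θ)` for any `θ > 2α` and large `k` (`gamma_mul_choose_le`). By
`card_all_fail_le`, the probability that `r` prescribed vertices are all tested and rejected is at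
most `(1 - γ)^r`.

A failing run leaves a witness (`exists_allRejected`): either a monochromatic edge all of whose
vertices in the first stretch were rejected, or a color for which all vertices of the second stretch
were rejected, apart from the recolored ones. Since `2α < 1`, there is room for `2α < θ < τ < 1`.
Typically every monochromatic edge has at least `k^τ` vertices in the first stretch, and there are
at most `n / k^τ` monochromatic edges, their expected number being `O(n ln k / k)`. Witnesses of the
first kind then have probability at most a polynomial times `exp(-k^(τ-θ))`. For the second kind,
the roughly `(n+1)^(n/k^τ)` choices of recolored vertices are outweighed by `(1 - γ)^(n/32)`. The
union bound is `card_failure_le`.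

The program performs `n` steps of this scan, rereading the whole edge list in each step, so its
running time is quadratic in the input size (`exec_scanProgram`). -/

/-- The state of the scanning procedure: the current colors, the color class in which a candidate is
searched for, and the position reached in each of the two classes. -/
@[ext] structure State where
  color : ℕ → Bool
  turn : Bool
  ptr : Bool → ℕ

/-- The `y`-th vertex of color `b` in the parity coloring. -/
def vert (b : Bool) (y : ℕ) : ℕ := if b then 2 * y else 2 * y + 1

/-- The parity coloring: even vertices are red. -/
def parity (v : ℕ) : Bool := decide (v % 2 = 0)

@[simp] theorem vert_div_two (b : Bool) (y : ℕ) : vert b y / 2 = y := by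
  cases b <;> simp [vert]; omega

@[simp] theorem parity_vert (b : Bool) (y : ℕ) : parity (vert b y) = b := by
  cases b <;> simp [vert, parity]

theorem vert_parity (v : ℕ) : vert (parity v) (v / 2) = v := by
  by_cases h : v % 2 = 0 <;> simp [vert, parity, h] <;> omega

theorem vert_inj {b b' : Bool} {y y' : ℕ} : vert b y = vert b' y' ↔ b = b' ∧ y = y' := by
  constructor
  · intro h
    refine ⟨?_, ?_⟩
    · have := congrArg parity h; simpa using this
    · have := congrArg (· / 2) h; simpa using this
  · rintro ⟨rfl, rfl⟩; rfl

theorem vert_lt {n : ℕ} (hn : Even n) {b : Bool} {y : ℕ} (h : 8 * y < n) : vert b y < n := by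
  obtain ⟨N, rfl⟩ := hn
  cases b <;> simp [vert] <;> omega

namespace State

/-- The vertex under inspection. -/
def vertex (S : State) : ℕ := vert S.turn (S.ptr S.turn)

/-- The colors of the vertices of a hypergraph on `Fin n`. -/
def coloring (S : State) (n : ℕ) : Coloring n := fun v => S.color v

theorem coloring_eq (S : State) (n : ℕ) : S.coloring n = fun v : Fin n => S.color v := rfl

/-- The initial state. -/
def init : State := ⟨parity, true, fun _ => 0⟩

/-- The same state, with the search for a vertex of color `b`. -/
def withTurn (S : State) (b : Bool) : State := ⟨S.color, b, S.ptr⟩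

/-- Switching the colors of the two vertices that have been found. -/
def swap (S : State) : State :=
  ⟨Function.update (Function.update S.color (vert true (S.ptr true)) false)
    (vert false (S.ptr false)) true, true, fun b => S.ptr b + 1⟩

/-- Passing over the vertex under inspection. -/
def advance (S : State) : State :=
  ⟨S.color, S.turn, Function.update S.ptr S.turn (S.ptr S.turn + 1)⟩

end State

/-- The safety of the vertex under inspection has to be tested. -/
def Searched {n : ℕ} (H : Hypergraph n) (S : State) : Prop :=
  8 * S.ptr S.turn < n ∧ ¬ Proper H (S.coloring n) ∧
    (16 * S.ptr S.turn < n → ∃ e ∈ H, MonoIn (S.coloring n) S.turn e ∧ ∃ v ∈ e, (v : ℕ) = S.vertex) ∧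
    (n ≤ 16 * S.ptr S.turn → ∀ e ∈ H, ¬ MonoIn (S.coloring n) S.turn e)

/-- The vertex under inspection is the head of `e`. -/
def Heads {n : ℕ} (S : State) (e : Finset (Fin n)) : Prop :=
  ∃ v ∈ e, (v : ℕ) = S.vertex ∧ ∀ w ∈ e, w ≠ v → S.color w = !S.turn

/-- The vertex under inspection is chosen. -/
def Accepts {n : ℕ} (H : Hypergraph n) (S : State) : Prop :=
  Searched H S ∧ ∀ e ∈ H, ¬ Heads S e

/-- The pointer of the class that is not being searched plays no role. This is why a chosen red
vertex stays acceptable while the blue pointer moves. -/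
theorem accepts_congr {n : ℕ} {H : Hypergraph n} {S S' : State} (hc : S.color = S'.color)
    (ht : S.turn = S'.turn) (hp : S.ptr S.turn = S'.ptr S'.turn) : Accepts H S ↔ Accepts H S' := by
  have : S.coloring n = S'.coloring n := by simp only [State.coloring_eq, hc]
  rw [ht] at hp
  simp only [Accepts, Searched, Heads, State.vertex, this, hp, hc, ht]

open Classical in
/-- One step of the scanning procedure. -/
noncomputable def next {n : ℕ} (H : Hypergraph n) (S : State) : State :=
  if Accepts H S then (if S.turn = true then S.withTurn false else S.swap) else S.advance

/-- The state after a number of steps. -/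
noncomputable def run {n : ℕ} (H : Hypergraph n) : ℕ → State
  | 0 => State.init
  | s + 1 => next H (run H s)

/-- A property of states holds throughout if it holds initially and is preserved by the three kinds
of steps. -/
theorem run_induction {n : ℕ} {H : Hypergraph n} {p : ℕ → State → Prop} (h0 : p 0 State.init)
    (hred : ∀ s S, p s S → S = run H s → Accepts H S → S.turn = true → p (s + 1) (S.withTurn false))
    (hblue : ∀ s S, p s S → S = run H s → Accepts H S → S.turn = false → p (s + 1) S.swap)
    (hadv : ∀ s S, p s S → S = run H s → ¬ Accepts H S → p (s + 1) S.advance) (s : ℕ) :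
    p s (run H s) := by
  induction s with
  | zero => exact h0
  | succ s ih =>
    by_cases ha : Accepts H (run H s)
    · cases ht : (run H s).turn
      · simpa [run, next, ha, ht] using hblue s _ ih rfl ha ht
      · simpa [run, next, ha, ht] using hred s _ ih rfl ha ht
    · simpa [run, next, ha] using hadv s _ ih rfl ha

/-! ### Invariants of the scan -/

/-- A switch only touches the two current positions and then moves both pointers past them, so
positions not yet passed still have their initial color. -/
theorem color_of_ptr_le {n : ℕ} (H : Hypergraph n) (s : ℕ) {b : Bool} {y : ℕ}
    (h : (run H s).ptr b ≤ y) : (run H s).color (vert b y) = b := by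
  refine run_induction (H := H) (p := fun _ S => ∀ b y, S.ptr b ≤ y → S.color (vert b y) = b)
    ?_ ?_ ?_ ?_ s b y h
  · intro b y _; simp [State.init]
  · intro _ S h _ _ _ b y hy; exact h b y hy
  · intro _ S h _ _ _ b y hy
    have hy' : S.ptr b < y := hy
    simp only [State.swap]
    rw [Function.update_of_ne, Function.update_of_ne]
    · exact h b y hy'.le
    · rw [Ne, vert_inj]; rintro ⟨rfl, rfl⟩; omega
    · rw [Ne, vert_inj]; rintro ⟨rfl, rfl⟩; omega
  · intro _ S h _ _ b y hy
    refine h b y ?_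
    by_cases hb : b = S.turn
    · subst hb; simp [State.advance] at hy; omega
    · simpa [State.advance, hb] using hy

theorem color_vertex {n : ℕ} (H : Hypergraph n) (s : ℕ) :
    (run H s).color (run H s).vertex = (run H s).turn := color_of_ptr_le H s le_rfl

/-- While a blue vertex is being searched for, a red one has been found. -/
theorem accepts_red {n : ℕ} (H : Hypergraph n) (s : ℕ) :
    (run H s).turn = false → Accepts H ((run H s).withTurn true) := by
  refine run_induction (H := H) (p := fun _ S => S.turn = false → Accepts H (S.withTurn true))
    ?_ ?_ ?_ ?_ s
  · intro h; simp [State.init] at h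
  · intro _ S _ _ ha ht _
    have : (S.withTurn false).withTurn true = S := by
      ext <;> simp [State.withTurn, ht]
    rwa [this]
  · intro _ S _ _ _ _ h; simp [State.swap] at h
  · intro _ S h _ _ ht
    have ht' : S.turn = false := ht
    refine (accepts_congr ?_ ?_ ?_).1 (h ht')
    · rfl
    · rfl
    · simp [State.withTurn, State.advance, ht']

/-- Vertices outside the range in which vertices are switched keep their initial colors. -/
theorem color_eq_parity {n : ℕ} (H : Hypergraph n) (s : ℕ) {v : ℕ} (h : n ≤ 8 * (v / 2)) :
    (run H s).color v = parity v := by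
  refine run_induction (H := H) (p := fun _ S => ∀ v, n ≤ 8 * (v / 2) → S.color v = parity v)
    ?_ ?_ ?_ ?_ s v h
  · intro v _; rfl
  · intro _ S h _ _ _; exact h
  · intro s S h hS ha ht v hv
    have h1 := ha.1.1
    have h2 := (accepts_red H s (hS ▸ ht)).1.1
    rw [← hS] at h2
    simp only [State.withTurn, ht] at h1 h2
    simp only [State.swap]
    rw [Function.update_of_ne, Function.update_of_ne]
    · exact h v hv
    · rintro rfl; simp at hv; omega
    · rintro rfl; simp at hv; omega
  · intro _ S h _ _; exact h

/-- Both switched vertices still carry their initial colors, so a vertex that was recolored once is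
never recolored again. -/
theorem swap_color_of_ne {n : ℕ} {H : Hypergraph n} {s v : ℕ}
    (h : (run H s).color v ≠ parity v) : (run H s).swap.color v = (run H s).color v := by
  simp only [State.swap]
  rw [Function.update_of_ne, Function.update_of_ne]
  · rintro rfl; exact h (by rw [color_of_ptr_le H s le_rfl]; simp)
  · rintro rfl; exact h (by rw [color_of_ptr_le H s le_rfl]; simp)

/-- If an edge that is monochromatic after the switch contained the former red vertex `u`, it would
be blue; it would then avoid the new red vertex, so its other vertices would have been blue before
and `u` would have been its head, contrary to safety. The blue vertex is treated symmetrically. So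
such an edge avoids both vertices and was monochromatic already. -/
theorem monoIn_of_swap {n : ℕ} {H : Hypergraph n} {s : ℕ} (ha : Accepts H (run H s))
    (ht : (run H s).turn = false) {e : Finset (Fin n)} (he : e ∈ H) {b : Bool}
    (hm : MonoIn ((run H s).swap.coloring n) b e) :
    MonoIn ((run H s).coloring n) b e ∧ ∀ v ∈ e, ∀ b', (v : ℕ) ≠ vert b' ((run H s).ptr b') := by
  have ha' := accepts_red H s ht
  set S := run H s with hS
  have hu : ∀ v ∈ e, (v : ℕ) ≠ vert true (S.ptr true) := by
    intro v hv hvu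
    have hb : b = false := by
      rw [← hm v hv]
      simp [State.coloring, State.swap, hvu, vert_inj]
    subst hb
    refine ha'.2 e he ⟨v, hv, hvu, fun w hw hwv => ?_⟩
    have := hm w hw
    simp only [State.coloring, State.swap, Function.update_apply] at this
    split_ifs at this with h1 h2
    · exact absurd (Fin.ext (h2.trans hvu.symm)) hwv
    · simpa [State.withTurn] using this
  have hv : ∀ v ∈ e, (v : ℕ) ≠ vert false (S.ptr false) := by
    intro v hv hvu
    have hb : b = true := by
      rw [← hm v hv]
      simp [State.coloring, State.swap, hvu]
    subst hb
    refine ha.2 e he ⟨v, hv, by rw [hvu, State.vertex, ht], fun w hw hwv => ?_⟩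
    have := hm w hw
    simp only [State.coloring, State.swap, Function.update_apply] at this
    split_ifs at this with h1
    · exact absurd (Fin.ext (h1.trans hvu.symm)) hwv
    · simpa [ht] using this
  refine ⟨fun w hw => ?_, fun v hve b' => by cases b'; exacts [hv v hve, hu v hve]⟩
  have := hm w hw
  simpa [State.coloring, State.swap, Function.update_of_ne (hu w hw),
    Function.update_of_ne (hv w hw)] using this

/-- No monochromatic edges are created. -/
theorem monoIn_mono {n : ℕ} (H : Hypergraph n) {r s : ℕ} (hrs : r ≤ s) {e : Finset (Fin n)}
    (he : e ∈ H) {b : Bool} (hm : MonoIn ((run H s).coloring n) b e) :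
    MonoIn ((run H r).coloring n) b e := by
  induction s, hrs using Nat.le_induction with
  | base => exact hm
  | succ s hs ih =>
    apply ih
    by_cases ha : Accepts H (run H s)
    · cases ht : (run H s).turn
      · simp only [run, next, ha, ht] at hm
        exact (monoIn_of_swap ha ht he hm).1
      · simp only [run, next, ha, ht] at hm
        exact hm
    · simp only [run, next, ha] at hm
      exact hm

theorem ptr_mono {n : ℕ} (H : Hypergraph n) {r s : ℕ} (hrs : r ≤ s) (b : Bool) :
    (run H r).ptr b ≤ (run H s).ptr b := by
  induction s, hrs using Nat.le_induction with
  | base => exact le_rfl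
  | succ s hs ih =>
    refine ih.trans ?_
    simp only [run, next]
    split_ifs
    · exact le_rfl
    · simp [State.swap]
    · simp only [State.advance, Function.update_apply]; split_ifs with h
      · subst h; omega
      · exact le_rfl

/-- No vertex is inspected twice. -/
theorem ptr_lt {n : ℕ} (H : Hypergraph n) {r s : ℕ} (hrs : r < s)
    (ht : (run H s).turn = (run H r).turn) :
    (run H r).ptr (run H r).turn < (run H s).ptr (run H r).turn := by
  -- The second alternative covers a red vertex that has been accepted and awaits its blue partner:
  -- its pointer moves only at the switch.
  have key := run_induction (H := H) (p := fun s S => ∀ r < s,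
    (run H r).ptr (run H r).turn < S.ptr (run H r).turn ∨
      ((run H r).turn = true ∧ S.turn = false)) ?_ ?_ ?_ ?_ s r hrs
  · rcases key with h | ⟨h1, h2⟩
    · exact h
    · rw [h1, h2] at ht; cases ht
  · intro r h; omega
  · intro s S ih hS _ ht r hr
    rcases (Nat.lt_succ_iff_lt_or_eq.1 hr) with h | rfl
    · rcases ih r h with h | ⟨_, h⟩
      · exact Or.inl h
      · rw [ht] at h; cases h
    · right; rw [← hS]; exact ⟨ht, rfl⟩
  · intro s S ih hS _ _ r hr
    left
    rw [State.swap]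
    rcases (Nat.lt_succ_iff_lt_or_eq.1 hr) with h | rfl
    · exact Nat.lt_succ_of_le (hS ▸ ptr_mono H h.le _)
    · rw [← hS]; exact Nat.lt_succ_self _
  · intro s S ih hS _ r hr
    rcases (Nat.lt_succ_iff_lt_or_eq.1 hr) with h | rfl
    · rcases ih r h with h | h
      · left
        refine h.trans_le ?_
        simp only [State.advance, Function.update_apply]; split_ifs with h
        · rw [h]; omega
        · exact le_rfl
      · exact Or.inr h
    · left; rw [← hS]; simp [State.advance]

/-! ### The scan as greedy recoloring -/

theorem swap_coloring {n : ℕ} {S : State} {u v : Fin n} (hu : (u : ℕ) = vert true (S.ptr true))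
    (hv : (v : ℕ) = vert false (S.ptr false)) :
    S.swap.coloring n = Function.update (Function.update (S.coloring n) u false) v true := by
  funext w
  simp [State.coloring, State.swap, Function.update_apply, Fin.ext_iff, hu, hv]

/-- The two stretches in `Searched` match the last clause of `Candidate`: in the first the vertex
lies in a monochromatic edge of its color, in the second that color has no such edge. -/
theorem candidate_of_accepts {n : ℕ} {H : Hypergraph n} {S : State} (h : Accepts H S)
    (hc : S.color S.vertex = S.turn) {v : Fin n} (hv : (v : ℕ) = S.vertex) :
    Candidate H (S.coloring n) S.turn v := by
  have hcv : S.coloring n v = S.turn := by rw [State.coloring, hv, hc]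
  refine ⟨hcv, fun e he hh => h.2 e he ⟨v, hh.1, hv, fun w hw hwv => ?_⟩, fun ⟨e, he, hm⟩ => ?_⟩
  · have := hh.2 w hw hwv
    rwa [hcv] at this
  · rcases lt_or_ge (16 * S.ptr S.turn) n with hlt | hge
    · obtain ⟨f, hf, hfm, w, hw, hwv⟩ := h.1.2.2.1 hlt
      exact ⟨f, hf, hfm, by rwa [Fin.ext (hv.trans hwv.symm)]⟩
    · exact absurd hm (h.1.2.2.2 hge e he)

theorem swapStep_of_accepts {n : ℕ} (hn : Even n) {H : Hypergraph n} {s : ℕ}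
    (ha : Accepts H (run H s)) (ht : (run H s).turn = false) :
    ∃ u v : Fin n, (u : ℕ) = vert true ((run H s).ptr true) ∧
      (v : ℕ) = vert false ((run H s).ptr false) ∧
      ¬ Proper H ((run H s).coloring n) ∧
      Candidate H ((run H s).coloring n) true u ∧ Candidate H ((run H s).coloring n) false v := by
  have hr := accepts_red H s ht
  have h1 : 8 * (run H s).ptr true < n := hr.1.1
  have h2 : 8 * (run H s).ptr false < n := by have := ha.1.1; rwa [ht] at this
  refine ⟨⟨vert true ((run H s).ptr true), vert_lt hn h1⟩,
    ⟨vert false ((run H s).ptr false), vert_lt hn h2⟩, rfl, rfl, hr.1.2.1, ?_, ?_⟩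
  · exact candidate_of_accepts hr (color_of_ptr_le H s le_rfl) rfl
  · have := candidate_of_accepts (v := ⟨_, vert_lt hn h2⟩) ha (color_vertex H s)
      (by rw [State.vertex, ht])
    rwa [ht] at this

/-- The scanning procedure is a case of greedy recoloring. -/
theorem greedyReaches_run {n : ℕ} (hn : Even n) (H : Hypergraph n) (s : ℕ) :
    GreedyReaches H (fun v => parity v) ((run H s).coloring n) := by
  refine run_induction (H := H) (p := fun _ S => GreedyReaches H (fun v => parity v) (S.coloring n))
    ?_ ?_ ?_ ?_ s
  · exact Relation.ReflTransGen.refl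
  · intro _ S h _ _ _; exact h
  · intro s S h hS ha ht
    subst hS
    obtain ⟨u, v, hu, hv, hp, hcu, hcv⟩ := swapStep_of_accepts hn ha ht
    exact h.tail ⟨hp, u, v, hcu, hcv, swap_coloring hu hv⟩
  · intro _ S h _ _; exact h

/-! ### Balance of the colorings and number of recolored vertices -/

theorem equitable_parity {n : ℕ} (hn : Even n) : Equitable (fun v : Fin n => parity v) := by
  obtain ⟨N, rfl⟩ := hn
  -- Even vertices are matched with their successors. The residue is taken only to have an element
  -- of `Fin`; it never changes `v + 1` here, because `n` is even.
  refine Finset.card_bij' (fun v _ => ⟨(v + 1) % (N + N), Nat.mod_lt _ (by have := v.2; omega)⟩)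
    (fun v _ => ⟨v - 1, by have := v.2; omega⟩) ?_ ?_ ?_ ?_
  · intro v hv
    have := v.2
    simp only [Finset.mem_filter, Finset.mem_univ, true_and, parity, decide_eq_true_eq,
      decide_eq_false_iff_not] at hv ⊢
    rw [Nat.mod_eq_of_lt (a := (v : ℕ) + 1) (by omega)]; omega
  · intro v hv
    simp only [Finset.mem_filter, Finset.mem_univ, true_and, parity, decide_eq_true_eq,
      decide_eq_false_iff_not] at hv ⊢
    omega
  · intro v hv
    have := v.2
    simp only [Finset.mem_filter, Finset.mem_univ, true_and, parity, decide_eq_true_eq] at hv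
    ext
    simp only
    rw [Nat.mod_eq_of_lt (by omega)]; try omega
  · intro v hv
    have := v.2
    simp only [Finset.mem_filter, Finset.mem_univ, true_and, parity,
      decide_eq_false_iff_not] at hv
    ext
    simp only
    rw [Nat.mod_eq_of_lt (by omega)]; try omega

theorem Equitable.swap {n : ℕ} {c : Coloring n} (hc : Equitable c) {u v : Fin n} (hu : c u = true)
    (hv : c v = false) : Equitable (Function.update (Function.update c u false) v true) := by
  have huv : u ≠ v := by rintro rfl; rw [hu] at hv; cases hv
  have h1 : (Finset.univ.filter fun w =>
      Function.update (Function.update c u false) v true w = true) =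
      insert v ((Finset.univ.filter fun w => c w = true).erase u) := by
    ext w
    simp only [Function.update_apply, Finset.mem_filter, Finset.mem_univ, true_and,
      Finset.mem_insert, Finset.mem_erase]
    split_ifs <;> simp_all
  have h2 : (Finset.univ.filter fun w =>
      Function.update (Function.update c u false) v true w = false) =
      insert u ((Finset.univ.filter fun w => c w = false).erase v) := by
    ext w
    simp only [Function.update_apply, Finset.mem_filter, Finset.mem_univ, true_and,
      Finset.mem_insert, Finset.mem_erase]
    by_cases hwv : w = v
    · subst hwv; simp [Ne.symm huv]
    · by_cases hwu : w = u
      · subst hwu; simp [hwv]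
      · simp [hwv, hwu]
  unfold Equitable at *
  rw [h1, h2, Finset.card_insert_of_notMem, Finset.card_insert_of_notMem,
    Finset.card_erase_of_mem, Finset.card_erase_of_mem, hc] <;> simp [hu, hv]

theorem GreedyReaches.equitable {n : ℕ} {H : Hypergraph n} {c c' : Coloring n}
    (h : GreedyReaches H c c') (hc : Equitable c) : Equitable c' := by
  induction h with
  | refl => exact hc
  | tail _ h ih =>
    obtain ⟨_, u, v, hu, hv, rfl⟩ := h
    exact ih.swap hu.1 hv.1

theorem Equitable.card_color {n : ℕ} {c : Coloring n} (hc : Equitable c) (b : Bool) :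
    (Finset.univ.filter fun v => c v = b).card = n / 2 := by
  have h := Finset.card_filter_add_card_filter_not (s := (Finset.univ : Finset (Fin n))) (fun v => c v = true)
  simp only [Bool.not_eq_true, Finset.card_univ, Fintype.card_fin] at h
  unfold Equitable at hc
  cases b <;> omega

open Classical in
/-- The monochromatic edges. -/
noncomputable def monoEdges {n : ℕ} (H : Hypergraph n) (c : Coloring n) : Hypergraph n :=
  H.filter fun e => ∃ b, MonoIn c b e

/-- The number of recolored vertices is bounded by the number of edges that are no longer
monochromatic. -/
theorem card_recolored_add_le {n : ℕ} (hn : Even n) (H : Hypergraph n) (b : Bool) (s : ℕ) :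
    (Finset.univ.filter fun v : Fin n => parity v = b ∧ (run H s).color v ≠ b).card +
      (monoEdges H ((run H s).coloring n)).card ≤ (monoEdges H (fun v => parity v)).card := by
  classical
  refine run_induction (H := H) (p := fun _ S =>
    (Finset.univ.filter fun v : Fin n => parity v = b ∧ S.color v ≠ b).card +
      (monoEdges H (S.coloring n)).card ≤ (monoEdges H (fun v => parity v)).card) ?_ ?_ ?_ ?_ s
  · have : (Finset.univ.filter fun v : Fin n => parity v = b ∧ State.init.color v ≠ b) = ∅ := by
      refine Finset.filter_eq_empty_iff.2 fun v _ h => h.2 h.1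
    rw [this, Finset.card_empty, zero_add]; exact le_rfl
  · intro _ S h _ _ _; exact h
  · intro s S h hS ha ht
    subst hS
    obtain ⟨u, v, hu, hv, hp, hcu, hcv⟩ := swapStep_of_accepts hn ha ht
    set S := run H s with hS
    -- A switch adds at most one recolored vertex to each class. It is paid for by the strict
    -- decrease in `h2` of the set of monochromatic edges.
    have h1 : (Finset.univ.filter fun w : Fin n => parity w = b ∧ S.swap.color w ≠ b) ⊆
        insert (if b then u else v)
          (Finset.univ.filter fun w : Fin n => parity w = b ∧ S.color w ≠ b) := by
      intro w hw
      simp only [Finset.mem_filter, Finset.mem_univ, true_and, Finset.mem_insert] at hw ⊢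
      by_contra hcon
      push Not at hcon
      have h3 : S.color w = b := hcon.2 hw.1
      refine hw.2 ?_
      simp only [State.swap, Function.update_apply]
      cases b
      · have : (w : ℕ) ≠ vert false (S.ptr false) := by
          intro h; exact hcon.1 (Fin.ext (by simpa using h.trans hv.symm))
        simp [this, h3]
      · have : (w : ℕ) ≠ vert true (S.ptr true) := by
          intro h; exact hcon.1 (Fin.ext (by simpa using h.trans hu.symm))
        simp [this, h3]
    have h2 : monoEdges H (S.swap.coloring n) ⊂ monoEdges H (S.coloring n) := by
      refine (Finset.ssubset_iff_of_subset ?_).2 ?_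
      · intro e he
        simp only [monoEdges, Finset.mem_filter] at he ⊢
        exact ⟨he.1, he.2.imp fun b hb => (monoIn_of_swap ha ht he.1 hb).1⟩
      · simp only [Proper, not_forall, not_not] at hp
        obtain ⟨e, he, b', hb'⟩ := hp
        -- The candidate of the color of the given monochromatic edge lies in some monochromatic
        -- edge, and that edge disappears.
        have : ∃ e ∈ H, ∃ b', MonoIn (S.coloring n) b' e ∧ ∃ w ∈ e, ∃ b'', (w : ℕ) = vert b'' (S.ptr b'') := by
          cases b'
          · obtain ⟨f, hf, hfm, hvf⟩ := hcv.2.2 ⟨e, he, hb'⟩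
            exact ⟨f, hf, _, hfm, v, hvf, false, hv⟩
          · obtain ⟨f, hf, hfm, hvf⟩ := hcu.2.2 ⟨e, he, hb'⟩
            exact ⟨f, hf, _, hfm, u, hvf, true, hu⟩
        obtain ⟨f, hf, b', hfm, w, hw, b'', hwb⟩ := this
        refine ⟨f, ?_, ?_⟩
        · simp only [monoEdges, Finset.mem_filter]; exact ⟨hf, b', hfm⟩
        · simp only [monoEdges, Finset.mem_filter, not_and, not_exists]
          intro _ b3 hb3
          exact (monoIn_of_swap ha ht hf hb3).2 w hw b'' hwb
    have h3 := Finset.card_lt_card h2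
    have h4 := (Finset.card_le_card h1).trans (Finset.card_insert_le _ _)
    omega
  · intro _ S h _ _; exact h

/-! ### What the procedure knows -/

open Classical in
/-- The sets among `U` that are monochromatic in the parity coloring. -/
noncomputable def initialQuery {n : ℕ} (U : Finset (Finset (Fin n))) : Finset (Finset (Fin n)) :=
  U.filter fun e => ∃ b, MonoIn (fun v : Fin n => parity v) b e

open Classical in
/-- The sets among `U` whose head is the vertex under inspection. -/
noncomputable def query {n : ℕ} (U : Finset (Finset (Fin n))) (S : State) :
    Finset (Finset (Fin n)) :=
  U.filter fun e => Heads S e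

open Classical in
/-- The sets about which it is known after `s` steps whether they are edges. -/
noncomputable def known {n : ℕ} (U : Finset (Finset (Fin n))) (H : Hypergraph n) (s : ℕ) :
    Finset (Finset (Fin n)) :=
  initialQuery U ∪ (Finset.range s).biUnion fun r => query U (run H r)

theorem known_succ {n : ℕ} (U : Finset (Finset (Fin n))) (H : Hypergraph n) (s : ℕ) :
    known U H (s + 1) = known U H s ∪ query U (run H s) := by
  ext e
  simp only [known, Finset.mem_union, Finset.mem_biUnion, Finset.mem_range,
    Nat.lt_succ_iff_lt_or_eq]
  constructor
  · rintro (h | ⟨r, h | rfl, hr⟩)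
    · exact Or.inl (Or.inl h)
    · exact Or.inl (Or.inr ⟨r, h, hr⟩)
    · exact Or.inr hr
  · rintro ((h | ⟨r, h, hr⟩) | h)
    · exact Or.inl h
    · exact Or.inr ⟨r, Or.inl h, hr⟩
    · exact Or.inr ⟨s, Or.inr rfl, h⟩

theorem known_subset {n : ℕ} (U : Finset (Finset (Fin n))) (H : Hypergraph n) (s : ℕ) :
    known U H s ⊆ U := by
  classical
  refine Finset.union_subset (Finset.filter_subset _ _) (Finset.biUnion_subset.2 fun r _ => ?_)
  exact Finset.filter_subset _ _

/-- No monochromatic edge is ever created, so an edge that is monochromatic at any time belongs to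
the initial query. That query does not depend on the hypergraph, whence the arbitrary `H'`. -/
theorem mem_known_of_mono {n : ℕ} {U : Finset (Finset (Fin n))} {H : Hypergraph n} (hH : H ⊆ U)
    (H' : Hypergraph n) {s r : ℕ} {e : Finset (Fin n)} (he : e ∈ H) {b : Bool}
    (hm : MonoIn ((run H r).coloring n) b e) : e ∈ known U H' s := by
  classical
  refine Finset.mem_union_left _ (Finset.mem_filter.2 ⟨hH he, b, ?_⟩)
  exact monoIn_mono H (Nat.zero_le r) he hm

theorem inter_eq_of_subset {α : Type*} [DecidableEq α] {A B Q Q' : Finset α} (hQ : Q' ⊆ Q)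
    (h : A ∩ Q = B ∩ Q) : A ∩ Q' = B ∩ Q' := by
  rw [← Finset.inter_eq_right.2 hQ, ← Finset.inter_assoc, h, Finset.inter_assoc]

theorem mem_iff_of_inter_eq {α : Type*} [DecidableEq α] {A B Q : Finset α} (h : A ∩ Q = B ∩ Q)
    {x : α} (hx : x ∈ Q) : x ∈ A ↔ x ∈ B := by
  have := Finset.ext_iff.1 h x
  simpa [hx] using this

theorem monoIn_iff_of_known {n : ℕ} {U : Finset (Finset (Fin n))} {H H' : Hypergraph n} (hH : H ⊆ U)
    (hH' : H' ⊆ U) {s : ℕ} (hk : H ∩ known U H s = H' ∩ known U H s) (hr : run H s = run H' s)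
    {e : Finset (Fin n)} {b : Bool} :
    (e ∈ H ∧ MonoIn ((run H s).coloring n) b e) ↔ (e ∈ H' ∧ MonoIn ((run H s).coloring n) b e) := by
  constructor
  · rintro ⟨he, hm⟩
    exact ⟨(mem_iff_of_inter_eq hk (mem_known_of_mono hH H he hm)).1 he, hm⟩
  · rintro ⟨he, hm⟩
    exact ⟨(mem_iff_of_inter_eq hk (mem_known_of_mono hH' H he (hr ▸ hm))).2 he, hm⟩

/-- Whether a test is made depends on monochromatic edges only, so this decision reveals nothing
beyond the initial query. -/
theorem searched_iff_of_known {n : ℕ} {U : Finset (Finset (Fin n))} {H H' : Hypergraph n}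
    (hH : H ⊆ U) (hH' : H' ⊆ U) {s : ℕ} (hk : H ∩ known U H s = H' ∩ known U H s)
    (hr : run H s = run H' s) : Searched H (run H s) ↔ Searched H' (run H' s) := by
  have key := fun e b => monoIn_iff_of_known hH hH' hk hr (e := e) (b := b)
  rw [← hr]
  have hp : Proper H ((run H s).coloring n) ↔ Proper H' ((run H s).coloring n) := by
    constructor <;> intro h e he b hm
    · exact h e ((key e b).2 ⟨he, hm⟩).1 b hm
    · exact h e ((key e b).1 ⟨he, hm⟩).1 b hm
  have h1 : ∀ p : Finset (Fin n) → Prop,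
      (∃ e ∈ H, MonoIn ((run H s).coloring n) (run H s).turn e ∧ p e) ↔
      (∃ e ∈ H', MonoIn ((run H s).coloring n) (run H s).turn e ∧ p e) := by
    intro p
    constructor <;> rintro ⟨e, he, hm, hpe⟩
    · exact ⟨e, ((key e _).1 ⟨he, hm⟩).1, hm, hpe⟩
    · exact ⟨e, ((key e _).2 ⟨he, hm⟩).1, hm, hpe⟩
  have h2 : (∀ e ∈ H, ¬ MonoIn ((run H s).coloring n) (run H s).turn e) ↔
      (∀ e ∈ H', ¬ MonoIn ((run H s).coloring n) (run H s).turn e) := by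
    constructor <;> intro h e he hm
    · exact h e ((key e _).2 ⟨he, hm⟩).1 hm
    · exact h e ((key e _).1 ⟨he, hm⟩).1 hm
  simp only [Searched, hp, h1, h2]

/-- Acceptance splits into a condition decided by what is known and one fresh question about the
hypergraph. -/
theorem accepts_iff {n : ℕ} {U : Finset (Finset (Fin n))} {H : Hypergraph n} (hH : H ⊆ U)
    {S : State} : Accepts H S ↔ Searched H S ∧ H ∩ query U S = ∅ := by
  refine and_congr_right fun _ => ?_
  rw [Finset.eq_empty_iff_forall_notMem]
  simp only [query, Finset.mem_inter, Finset.mem_filter, not_and]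
  exact ⟨fun h e he _ => h e he, fun h e he => h e he (hH he)⟩

/-- The course of the procedure depends only on what is known. -/
theorem run_eq_of_known {n : ℕ} {U : Finset (Finset (Fin n))} {H H' : Hypergraph n} (hH : H ⊆ U)
    (hH' : H' ⊆ U) {s : ℕ} (hk : H ∩ known U H s = H' ∩ known U H s) :
    run H s = run H' s ∧ known U H s = known U H' s := by
  induction s with
  | zero => exact ⟨rfl, by simp [known]⟩
  | succ s ih =>
    rw [known_succ] at hk
    have hk1 := inter_eq_of_subset Finset.subset_union_left hk
    have hk2 := inter_eq_of_subset Finset.subset_union_right hk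
    obtain ⟨h1, h2⟩ := ih hk1
    have hacc : Accepts H (run H s) ↔ Accepts H' (run H' s) := by
      rw [accepts_iff hH, accepts_iff hH', searched_iff_of_known hH hH' hk1 h1, hk2, h1]
    refine ⟨?_, by rw [known_succ, known_succ, h2, h1]⟩
    simp only [run, next]
    by_cases h : Accepts H' (run H' s)
    · rw [if_pos h, if_pos (hacc.2 h), h1]
    · rw [if_neg h, if_neg (mt hacc.1 h), h1]

/-- Sets that are not essentially contained in the part of the vertex set that may be recolored. -/
def Spread {n : ℕ} (e : Finset (Fin n)) : Prop :=
  (e.filter fun v : Fin n => 8 * ((v : ℕ) / 2) < n).card + 2 < e.card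

theorem not_spread_of {n : ℕ} {e : Finset (Fin n)} {u v : Fin n}
    (h : ∀ w ∈ e, w ≠ u → w ≠ v → 8 * ((w : ℕ) / 2) < n) : ¬ Spread e := by
  classical
  unfold Spread
  have h1 : (e.erase u).erase v ⊆ e.filter fun v : Fin n => 8 * ((v : ℕ) / 2) < n := by
    intro w hw
    simp only [Finset.mem_erase, Finset.mem_filter] at hw ⊢
    exact ⟨hw.2.2, h w hw.2.2 hw.2.1 hw.1⟩
  have h2 := Finset.card_le_card h1
  have h3 := Finset.pred_card_le_card_erase (s := e) (a := u)
  have h4 := Finset.pred_card_le_card_erase (s := e.erase u) (a := v)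
  omega

/-- A safety test never refers to a set about which something is already known. -/
theorem disjoint_query_known {n : ℕ} {U : Finset (Finset (Fin n))} (hU : ∀ e ∈ U, Spread e)
    (H : Hypergraph n) (s : ℕ) : Disjoint (query U (run H s)) (known U H s) := by
  rw [Finset.disjoint_left]
  intro e he hk
  simp only [query, Finset.mem_filter] at he
  obtain ⟨heU, v, hv, hvx, hvw⟩ := he
  have hpv : parity v = (run H s).turn := by rw [hvx, State.vertex, parity_vert]
  refine absurd (hU e heU) ?_
  simp only [known, initialQuery, query, Finset.mem_union, Finset.mem_filter, Finset.mem_biUnion,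
    Finset.mem_range] at hk
  rcases hk with ⟨_, b, hb⟩ | ⟨r, hr, _, u, hu, hux, huw⟩
  -- The set is monochromatic in the parity coloring, but now `v` is its head. A vertex `w ≠ v`
  -- outside the reserved stretches still has its parity color, which would have to be both equal
  -- and opposite to that of `v`.
  · refine not_spread_of (u := v) (v := v) fun w hw hwv _ => ?_
    by_contra hcon
    have h1 := color_eq_parity H s (v := w) (by omega)
    have h2 := hb v hv
    have h3 := hb w hw
    have h4 := hvw w hw hwv
    simp only at h2 h3
    rw [h1, h3, ← hpv, h2] at h4
    cases b <;> cases h4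
  -- If both tests search the same color, the later head `v` was not yet passed at time `r` and had
  -- the searched color, though it should have had the opposite one. If the colors differ, a vertex
  -- other than the two heads and outside the reserved stretches would need two different colors. So
  -- at most two vertices lie outside.
  · by_cases hturn : (run H s).turn = (run H r).turn
    · have hlt := ptr_lt H hr hturn
      have hne : v ≠ u := by
        rintro rfl
        rw [hvx, State.vertex, State.vertex, vert_inj, hturn] at hux
        omega
      have h1 := huw v hv hne
      rw [hvx, State.vertex, hturn, color_of_ptr_le H r hlt.le] at h1
      revert h1
      cases (run H r).turn <;> simp
    · refine not_spread_of (u := u) (v := v) fun w hw hwu hwv => ?_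
      by_contra hcon
      have h1 := color_eq_parity H s (v := w) (by omega)
      have h2 := color_eq_parity H r (v := w) (by omega)
      have h3 := hvw w hw hwv
      have h4 := huw w hw hwu
      rw [h1, ← h2, h4] at h3
      revert h3 hturn
      cases (run H r).turn <;> cases (run H s).turn <;> simp

/-! ### Adaptive tests -/

open Classical in
/-- If every test that is made fails with conditional probability at most `β`, given what is known
then, the probability that at least `r` tests are made and all of them fail is at most `β ^ r`. -/
theorem card_all_fail_le {Ω T : Type*} (A : Finset Ω) (κ : ℕ → Ω → T) (hit ok : ℕ → Ω → Prop)
    (p : Ω → Prop) {β : ℝ} (hβ : 0 < β) (hβ1 : β ≤ 1) (n : ℕ)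
    (hκ : ∀ s, ∀ ω ∈ A, ∀ ω' ∈ A, κ (s + 1) ω = κ (s + 1) ω' →
      κ s ω = κ s ω' ∧ (ok s ω ↔ ok s ω'))
    (hhit : ∀ s, ∀ ω ∈ A, ∀ ω' ∈ A, κ s ω = κ s ω' → (hit s ω ↔ hit s ω'))
    (hp : ∀ ω ∈ A, ∀ ω' ∈ A, κ 0 ω = κ 0 ω' → (p ω ↔ p ω'))
    (hb : ∀ s < n, ∀ ω₀ ∈ A, hit s ω₀ → ((A.filter fun ω => κ s ω = κ s ω₀ ∧ ¬ ok s ω).card : ℝ) ≤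
      β * (A.filter fun ω => κ s ω = κ s ω₀).card)
    {s : ℕ} (hs : s ≤ n) (r : ℕ) :
    ((A.filter fun ω => p ω ∧ (∀ t < s, hit t ω → ¬ ok t ω) ∧
      r ≤ ((Finset.range s).filter fun t => hit t ω).card).card : ℝ) ≤
      β ^ r * (A.filter p).card := by
  set cnt : ℕ → Ω → ℕ := fun s ω => ((Finset.range s).filter fun t => hit t ω).card with hcnt
  -- The potential: every failed test multiplies the weight by `β⁻¹`, a successful one or a
  -- violation of `p` kills it. The average of `g` cannot increase, which is `hW`.
  set g : ℕ → Ω → ℝ := fun s ω =>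
    if p ω ∧ ∀ t < s, hit t ω → ¬ ok t ω then β⁻¹ ^ cnt s ω else 0 with hg
  have hdesc : ∀ s, ∀ ω ∈ A, ∀ ω' ∈ A, κ s ω = κ s ω' →
      (p ω ↔ p ω') ∧ ∀ t < s, (hit t ω ↔ hit t ω') ∧ (ok t ω ↔ ok t ω') := by
    intro s
    induction s with
    | zero => intro ω hω ω' hω' h; exact ⟨hp ω hω ω' hω' h, by simp⟩
    | succ s ih =>
      intro ω hω ω' hω' h
      obtain ⟨h1, h2⟩ := hκ s ω hω ω' hω' h
      obtain ⟨h3, h4⟩ := ih ω hω ω' hω' h1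
      refine ⟨h3, fun t ht => ?_⟩
      rcases Nat.lt_succ_iff_lt_or_eq.1 ht with h | rfl
      · exact h4 t h
      · exact ⟨hhit t ω hω ω' hω' h1, h2⟩
  have hgc : ∀ s, ∀ ω ∈ A, ∀ ω' ∈ A, κ s ω = κ s ω' → g s ω = g s ω' := by
    intro s ω hω ω' hω' h
    obtain ⟨h1, h2⟩ := hdesc s ω hω ω' hω' h
    have h3 : cnt s ω = cnt s ω' := by
      simp only [hcnt]
      congr 1
      refine Finset.filter_congr fun t ht => (h2 t (Finset.mem_range.1 ht)).1
    have h4 : (p ω ∧ ∀ t < s, hit t ω → ¬ ok t ω) ↔ (p ω' ∧ ∀ t < s, hit t ω' → ¬ ok t ω') := by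
      rw [h1]
      refine and_congr_right fun _ => forall_congr' fun t => forall_congr' fun ht => ?_
      rw [(h2 t ht).1, (h2 t ht).2]
    simp only [hg, h3, h4]
  have hg0 : ∀ s ω, 0 ≤ g s ω := by
    intro s ω; simp only [hg]; split_ifs <;> positivity
  have hsucc : ∀ s ω, g (s + 1) ω = if hit s ω then (if ok s ω then 0 else β⁻¹ * g s ω) else g s ω := by
    intro s ω
    have h1 : (∀ t < s + 1, hit t ω → ¬ ok t ω) ↔
        (∀ t < s, hit t ω → ¬ ok t ω) ∧ (hit s ω → ¬ ok s ω) := by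
      constructor
      · intro h; exact ⟨fun t ht => h t (by omega), h s (by omega)⟩
      · rintro ⟨h1, h2⟩ t ht
        rcases Nat.lt_succ_iff_lt_or_eq.1 ht with h | rfl
        · exact h1 t h
        · exact h2
    have h2 : cnt (s + 1) ω = if hit s ω then cnt s ω + 1 else cnt s ω := by
      simp only [hcnt, Finset.range_add_one, Finset.filter_insert]
      split_ifs
      · rw [Finset.card_insert_of_notMem (by simp)]
      · rfl
    simp only [hg, h1, h2]
    by_cases hh : hit s ω <;> by_cases ho : ok s ω <;> simp [hh, ho, pow_succ, mul_comm]
  have hW : ∀ s ≤ n, ∑ ω ∈ A, g s ω ≤ (A.filter p).card := by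
    intro s hs
    induction s with
    | zero =>
      rw [Finset.card_filter]
      push_cast
      refine Finset.sum_le_sum fun ω _ => ?_
      simp [hg, hcnt]
    | succ s ih =>
      -- The sum is compared separately on each fiber of `κ s`. There the weight is constant, and
      -- the decision whether to test is the same for all elements.
      refine le_trans ?_ (ih (by omega))
      rw [← Finset.sum_fiberwise_of_maps_to (t := A.image (κ s)) (g := κ s)
          (fun ω h => Finset.mem_image_of_mem _ h),
        ← Finset.sum_fiberwise_of_maps_to (t := A.image (κ s)) (g := κ s)
          (fun ω h => Finset.mem_image_of_mem _ h)]
      refine Finset.sum_le_sum fun c hc => ?_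
      obtain ⟨ω₀, hω₀, rfl⟩ := Finset.mem_image.1 hc
      by_cases hh : hit s ω₀
      · have h1 : ∑ ω ∈ A.filter (fun ω => κ s ω = κ s ω₀), g (s + 1) ω =
            β⁻¹ * g s ω₀ * (A.filter fun ω => κ s ω = κ s ω₀ ∧ ¬ ok s ω).card := by
          rw [← Finset.filter_filter, Finset.card_filter]
          push_cast
          rw [Finset.mul_sum]
          refine Finset.sum_congr rfl fun ω hω => ?_
          obtain ⟨hωA, hωκ⟩ := Finset.mem_filter.1 hω
          rw [hsucc, if_pos ((hhit s ω hωA ω₀ hω₀ hωκ).2 hh), hgc s ω hωA ω₀ hω₀ hωκ]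
          by_cases ho : ok s ω <;> simp [ho]
        have h2 : ∑ ω ∈ A.filter (fun ω => κ s ω = κ s ω₀), g s ω =
            g s ω₀ * (A.filter fun ω => κ s ω = κ s ω₀).card := by
          rw [Finset.sum_congr rfl fun ω hω => hgc s ω (Finset.mem_filter.1 hω).1 ω₀ hω₀
            (Finset.mem_filter.1 hω).2, Finset.sum_const, nsmul_eq_mul, mul_comm]
        rw [h1, h2]
        calc β⁻¹ * g s ω₀ * ((A.filter fun ω => κ s ω = κ s ω₀ ∧ ¬ ok s ω).card : ℝ)
            ≤ β⁻¹ * g s ω₀ * (β * (A.filter fun ω => κ s ω = κ s ω₀).card) := by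
              refine mul_le_mul_of_nonneg_left (hb s (by omega) ω₀ hω₀ hh) ?_
              exact mul_nonneg (inv_nonneg.2 hβ.le) (hg0 _ _)
          _ = _ := by field_simp
      · refine Finset.sum_le_sum fun ω hω => ?_
        obtain ⟨hωA, hωκ⟩ := Finset.mem_filter.1 hω
        rw [hsucc, if_neg (mt (hhit s ω hωA ω₀ hω₀ hωκ).1 hh)]
  -- Markov's inequality: on the event in question the weight is at least `β⁻¹ ^ r`.
  have h1 : ((A.filter fun ω => p ω ∧ (∀ t < s, hit t ω → ¬ ok t ω) ∧ r ≤ cnt s ω).card : ℝ) * β⁻¹ ^ r ≤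
      ∑ ω ∈ A, g s ω := by
    rw [← nsmul_eq_mul]
    refine (Finset.card_nsmul_le_sum _ (g s) _ fun ω hω => ?_).trans
      (Finset.sum_le_sum_of_subset_of_nonneg (Finset.filter_subset _ _) fun _ _ _ => hg0 _ _)
    obtain ⟨_, h1, h2, h3⟩ := Finset.mem_filter.1 hω
    simp only [hg]
    rw [if_pos ⟨h1, h2⟩]
    exact pow_le_pow_right₀ ((one_le_inv₀ hβ).2 hβ1) h3
  have h2 := h1.trans (hW s hs)
  rw [inv_pow, ← div_eq_mul_inv, div_le_iff₀ (by positivity)] at h2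
  linarith

/-! ### Counting -/

/-- Once the trace on `Q` is prescribed, what is left is a free choice of the other elements outside
`Q`. This is the conditional distribution of the random hypergraph given what is known. -/
theorem card_powersetCard_inter {α : Type*} [DecidableEq α] {U Q h : Finset α} {m : ℕ} (hQ : Q ⊆ U)
    (hh : h ⊆ Q) (hm : h.card ≤ m) :
    ((U.powersetCard m).filter fun H => H ∩ Q = h).card = (U.card - Q.card).choose (m - h.card) := by
  rw [← Finset.card_sdiff_of_subset hQ, ← Finset.card_powersetCard]
  refine Finset.card_bij' (fun H _ => H \ Q) (fun X _ => X ∪ h) ?_ ?_ ?_ ?_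
  · intro H hH
    simp only [Finset.mem_filter, Finset.mem_powersetCard] at hH ⊢
    obtain ⟨⟨h1, h2⟩, h3⟩ := hH
    refine ⟨Finset.sdiff_subset_sdiff h1 subset_rfl, ?_⟩
    rw [← h3, ← h2]
    have := Finset.card_sdiff_add_card_inter H Q
    omega
  · intro X hX
    simp only [Finset.mem_filter, Finset.mem_powersetCard] at hX ⊢
    obtain ⟨h1, h2⟩ := hX
    have hXQ : Disjoint X Q := Finset.disjoint_of_subset_left h1 Finset.sdiff_disjoint
    refine ⟨⟨Finset.union_subset (h1.trans Finset.sdiff_subset) (hh.trans hQ), ?_⟩, ?_⟩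
    · rw [Finset.card_union_of_disjoint (Finset.disjoint_of_subset_right hh hXQ)]; omega
    · rw [Finset.union_inter_distrib_right, Finset.disjoint_iff_inter_eq_empty.1 hXQ,
        Finset.empty_union, Finset.inter_eq_left.2 hh]
  · intro H hH
    simp only [Finset.mem_filter, Finset.mem_powersetCard] at hH ⊢
    rw [← hH.2, Finset.sdiff_union_inter]
  · intro X hX
    simp only [Finset.mem_powersetCard] at hX ⊢
    have hXQ : Disjoint X Q := Finset.disjoint_of_subset_left hX.1 Finset.sdiff_disjoint
    rw [Finset.union_sdiff_distrib, Finset.sdiff_eq_empty_iff_subset.2 hh, Finset.union_empty,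
      Finset.sdiff_eq_self_of_disjoint hXQ]

/-- Removing the common head leaves `k - 1` vertices of the opposite color, and the class of that
color has exactly `n / 2` vertices because switches preserve balance. -/
theorem card_query_le {n k : ℕ} (hn : Even n) {U : Finset (Finset (Fin n))}
    (hU : ∀ e ∈ U, e.card = k) (H : Hypergraph n) (s : ℕ) :
    (query U (run H s)).card ≤ (n / 2).choose (k - 1) := by
  classical
  have heq := (greedyReaches_run hn H s).equitable (equitable_parity hn)
  rw [← heq.card_color (!(run H s).turn), ← Finset.card_powersetCard]
  by_cases hx : (run H s).vertex < n
  · refine Finset.card_le_card_of_injOn (fun e => e.erase ⟨_, hx⟩) ?_ ?_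
    · intro e he
      simp only [query, Finset.coe_filter, Set.mem_ofPred_eq] at he
      obtain ⟨heU, v, hv, hvx, hvw⟩ := he
      have hv' : v = ⟨_, hx⟩ := Fin.ext hvx
      subst hv'
      simp only [Finset.mem_coe, Finset.mem_powersetCard]
      refine ⟨fun w hw => ?_, by rw [Finset.card_erase_of_mem hv, hU e heU]⟩
      obtain ⟨h1, h2⟩ := Finset.mem_erase.1 hw
      exact Finset.mem_filter.2 ⟨Finset.mem_univ _, hvw w h2 h1⟩
    · intro e he f hf hef
      simp only [query, Finset.coe_filter, Set.mem_ofPred_eq] at he hf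
      obtain ⟨_, v, hv, hvx, _⟩ := he
      obtain ⟨_, w, hw, hwx, _⟩ := hf
      have hv' : v = ⟨_, hx⟩ := Fin.ext hvx
      have hw' : w = ⟨_, hx⟩ := Fin.ext hwx
      subst hv'
      simp only at hef
      rw [← Finset.insert_erase hv, hef, Finset.insert_erase (hw' ▸ hw)]
  · have : query U (run H s) = ∅ := by
      refine Finset.filter_eq_empty_iff.2 fun e _ ⟨v, _, hvx, _⟩ => hx (hvx ▸ v.2)
    rw [this]; simp

theorem card_initialQuery_le {n k : ℕ} (hn : Even n) {U : Finset (Finset (Fin n))}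
    (hU : ∀ e ∈ U, e.card = k) : (initialQuery U).card ≤ 2 * (n / 2).choose k := by
  classical
  have h : initialQuery U ⊆ (Finset.univ : Finset Bool).biUnion fun b =>
      (Finset.univ.filter fun v : Fin n => parity v = b).powersetCard k := by
    intro e he
    obtain ⟨heU, b, hb⟩ := Finset.mem_filter.1 he
    refine Finset.mem_biUnion.2 ⟨b, Finset.mem_univ _, Finset.mem_powersetCard.2 ⟨fun v hv => ?_, hU e heU⟩⟩
    exact Finset.mem_filter.2 ⟨Finset.mem_univ _, hb v hv⟩
  refine (Finset.card_le_card h).trans (Finset.card_biUnion_le.trans (le_of_eq ?_))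
  simp only [Finset.card_powersetCard]
  rw [Finset.sum_congr rfl fun b _ => by rw [(equitable_parity hn).card_color b]]
  simp

theorem card_known_le {n k : ℕ} (hn : Even n) {U : Finset (Finset (Fin n))}
    (hU : ∀ e ∈ U, e.card = k) (H : Hypergraph n) (s : ℕ) :
    (known U H s).card ≤ 2 * (n / 2).choose k + s * (n / 2).choose (k - 1) := by
  induction s with
  | zero => simpa [known] using card_initialQuery_le hn hU
  | succ s ih =>
    rw [known_succ]
    refine (Finset.card_union_le _ _).trans ?_
    have := card_query_le hn hU H s
    rw [add_mul, one_mul]; omega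

/-! ### The probability that many tests fail -/

/-- The vertices in `D` have all been tested within the first `t` steps, and none of them was safe. -/
def AllRejected {n : ℕ} (H : Hypergraph n) (t : ℕ) (D : Finset ℕ) : Prop :=
  (∀ x ∈ D, ∃ s < t, (run H s).vertex = x ∧ Searched H (run H s)) ∧
    ∀ s < t, (run H s).vertex ∈ D → ¬ Accepts H (run H s)

/-- In step `s`, a vertex of `D` is tested. -/
def TestsIn {n : ℕ} (D : Finset ℕ) (s : ℕ) (H : Hypergraph n) : Prop :=
  (run H s).vertex ∈ D ∧ Searched H (run H s)

/-- No edge is found by the test in step `s`. -/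
def Avoids {n : ℕ} (U : Finset (Finset (Fin n))) (s : ℕ) (H : Hypergraph n) : Prop :=
  H ∩ query U (run H s) = ∅

open Classical in
/-- The probability that many vertices are tested and none of them is safe. -/
theorem card_allRejected_le {n k m : ℕ} (hn : Even n) {U : Finset (Finset (Fin n))}
    (hU : ∀ e ∈ U, e.card = k) (hS : ∀ e ∈ U, Spread e) {γ : ℝ} (hγ0 : 0 ≤ γ) (hγ1 : γ < 1)
    (hγ : ∀ q M m', q ≤ (n / 2).choose (k - 1) →
      U.card ≤ M + (2 * (n / 2).choose k + n * (n / 2).choose (k - 1)) → m' ≤ m →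
      γ * M.choose m' ≤ (M - q).choose m')
    {t : ℕ} (ht : t ≤ n) (D : Finset ℕ) (p : Hypergraph n → Prop)
    (hp : ∀ H H', H ∩ initialQuery U = H' ∩ initialQuery U → (p H ↔ p H')) :
    (((U.powersetCard m).filter fun H => p H ∧ AllRejected H t D).card : ℝ) ≤
      (1 - γ) ^ D.card * ((U.powersetCard m).filter p).card := by
  have hsub : ∀ H ∈ U.powersetCard m, H ⊆ U := fun H hH => (Finset.mem_powersetCard.1 hH).1
  refine le_trans ?_ (card_all_fail_le (U.powersetCard m)
    (fun s H => (known U H s, H ∩ known U H s))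
    (TestsIn D)
    (Avoids U) p (β := 1 - γ) (by linarith) (by linarith) n
    ?_ ?_ ?_ ?_ ht D.card)
  · refine Nat.cast_le.2 (Finset.card_le_card fun H hH => ?_)
    obtain ⟨hHU, hpH, hr1, hr2⟩ := Finset.mem_filter.1 hH
    rw [Finset.mem_filter]
    refine ⟨hHU, hpH, fun s hs hhit => ?_, ?_⟩
    · have := hr2 s hs hhit.1
      rw [accepts_iff (hsub H hHU)] at this
      exact fun h => this ⟨hhit.2, h⟩
    · refine le_trans (Finset.card_le_card fun x hx => ?_)
        (Finset.card_image_le (f := fun s => (run H s).vertex))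
      obtain ⟨s, hs, hsx, hss⟩ := hr1 x hx
      rw [Finset.mem_image]
      refine ⟨s, ?_, hsx⟩
      rw [Finset.mem_filter]
      exact ⟨Finset.mem_range.2 hs, hsx ▸ hx, hss⟩
  · intro s H hH H' hH' h
    simp only [Prod.mk.injEq] at h ⊢
    have hk : H ∩ known U H (s + 1) = H' ∩ known U H (s + 1) := by rw [h.2, h.1]
    rw [known_succ] at hk
    have hk1 := inter_eq_of_subset Finset.subset_union_left hk
    have hk2 := inter_eq_of_subset Finset.subset_union_right hk
    obtain ⟨h1, h2⟩ := run_eq_of_known (hsub H hH) (hsub H' hH') hk1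
    refine ⟨⟨h2, by rw [hk1, h2]⟩, ?_⟩
    rw [Avoids, Avoids, hk2, h1]
  · intro s H hH H' hH' h
    simp only [Prod.mk.injEq] at h
    have hk : H ∩ known U H s = H' ∩ known U H s := by rw [h.2, h.1]
    obtain ⟨h1, h2⟩ := run_eq_of_known (hsub H hH) (hsub H' hH') hk
    rw [TestsIn, TestsIn, searched_iff_of_known (hsub H hH) (hsub H' hH') hk h1, h1]
  · intro H _ H' _ h
    simp only [Prod.mk.injEq] at h
    refine hp H H' ?_
    have : known U H 0 = initialQuery U := by simp [known]
    rw [← this, h.2, h.1]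
  · intro s hs H₀ hH₀ _
    obtain ⟨Q, hQ⟩ : ∃ Q, Q = known U H₀ s := ⟨_, rfl⟩
    obtain ⟨q, hq⟩ : ∃ q, q = query U (run H₀ s) := ⟨_, rfl⟩
    obtain ⟨h, hh⟩ : ∃ h, h = H₀ ∩ Q := ⟨_, rfl⟩
    have hQU : Q ⊆ U := hQ ▸ known_subset U H₀ s
    have hqU : q ⊆ U := hq ▸ Finset.filter_subset _ _
    have hdisj : Disjoint q Q := hq ▸ hQ ▸ disjoint_query_known hS H₀ s
    have hhQ : h ⊆ Q := hh ▸ Finset.inter_subset_right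
    have hm : h.card ≤ m := by
      rw [← (Finset.mem_powersetCard.1 hH₀).2, hh]
      exact Finset.card_le_card Finset.inter_subset_left
    have hcls : ∀ H ∈ U.powersetCard m, ((known U H s, H ∩ known U H s) =
        (known U H₀ s, H₀ ∩ known U H₀ s) ↔ H ∩ Q = h) := by
      intro H hH
      rw [hh, hQ]
      simp only [Prod.mk.injEq]
      constructor
      · rintro ⟨h1, h2⟩; rw [h1] at h2; exact h2
      · intro h1
        obtain ⟨h2, h3⟩ := run_eq_of_known (hsub _ hH₀) (hsub H hH) (s := s) h1.symm
        exact ⟨h3.symm, by rw [← h3]; exact h1⟩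
    have hok : ∀ H ∈ U.powersetCard m, H ∩ Q = h → run H s = run H₀ s := fun H hH h1 =>
      (run_eq_of_known (hsub _ hH₀) (hsub H hH) (s := s) (by rw [← hQ, ← hh, h1])).1.symm
    have e1 : (U.powersetCard m).filter (fun H => (known U H s, H ∩ known U H s) =
        (known U H₀ s, H₀ ∩ known U H₀ s)) = (U.powersetCard m).filter fun H => H ∩ Q = h :=
      Finset.filter_congr hcls
    -- A passed test means that the trace on `Q ∪ q` is still `h`, since `q` is disjoint from `Q`.
    -- So the failures are a difference of two classes that `card_powersetCard_inter` counts.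
    have e2 : (U.powersetCard m).filter (fun H => (known U H s, H ∩ known U H s) =
        (known U H₀ s, H₀ ∩ known U H₀ s) ∧ ¬ Avoids U s H) =
        ((U.powersetCard m).filter fun H => H ∩ Q = h) \
          ((U.powersetCard m).filter fun H => H ∩ (Q ∪ q) = h) := by
      ext H
      simp only [Finset.mem_filter, Finset.mem_sdiff, not_and]
      constructor
      · rintro ⟨h1, h2, h3⟩
        have h2 := (hcls H h1).1 h2
        refine ⟨⟨h1, h2⟩, fun _ h4 => h3 ?_⟩
        rw [Avoids, hok H h1 h2, ← hq]
        rw [Finset.inter_union_distrib_left, h2] at h4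
        have h5 : H ∩ q ⊆ h := h4 ▸ Finset.subset_union_right
        refine Finset.eq_empty_of_forall_notMem fun x hx => ?_
        exact Finset.disjoint_left.1 hdisj (Finset.mem_inter.1 hx).2
          (hhQ (h5 hx))
      · rintro ⟨⟨h1, h2⟩, h3⟩
        refine ⟨h1, (hcls H h1).2 h2, fun h4 => h3 h1 ?_⟩
        rw [Avoids, hok H h1 h2, ← hq] at h4
        rw [Finset.inter_union_distrib_left, h2, h4, Finset.union_empty]
    have c1 := card_powersetCard_inter hQU hhQ hm
    have c2 := card_powersetCard_inter (Finset.union_subset hQU hqU)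
      (hhQ.trans Finset.subset_union_left) hm
    rw [Finset.card_union_of_disjoint hdisj.symm, ← Nat.sub_sub] at c2
    have hle : ((U.powersetCard m).filter fun H => H ∩ (Q ∪ q) = h) ⊆
        (U.powersetCard m).filter fun H => H ∩ Q = h := by
      intro H hH
      obtain ⟨h1, h2⟩ := Finset.mem_filter.1 hH
      refine Finset.mem_filter.2 ⟨h1, ?_⟩
      have := inter_eq_of_subset (A := H) (B := h) (Q := Q ∪ q) (Q' := Q) Finset.subset_union_left
        (by rw [h2, Finset.inter_eq_left.2
          (hhQ.trans Finset.subset_union_left)])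
      rw [this, Finset.inter_eq_left.2 hhQ]
    have hkey := hγ q.card (U.card - Q.card) (m - h.card) (hq ▸ card_query_le hn hU H₀ s) (by
      have h1 := card_known_le hn hU H₀ s
      have h2 : s * (n / 2).choose (k - 1) ≤ n * (n / 2).choose (k - 1) :=
        Nat.mul_le_mul_right _ hs.le
      rw [← hQ] at h1
      omega) (Nat.sub_le _ _)
    have e3 := congrArg (fun X : Finset (Hypergraph n) => (X.card : ℝ)) e1
    have e4 := congrArg (fun X : Finset (Hypergraph n) => (X.card : ℝ)) e2
    beta_reduce at e3 e4
    rw [Finset.card_sdiff_of_subset hle, Nat.cast_sub (Finset.card_le_card hle), c1, c2] at e4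
    rw [c1] at e3
    have key : ((U.card - Q.card).choose (m - h.card) : ℝ) -
        (U.card - Q.card - q.card).choose (m - h.card) ≤
        (1 - γ) * (U.card - Q.card).choose (m - h.card) := by linarith
    refine le_of_eq_of_le ?_ (le_of_le_of_eq key ?_)
    · rw [← e4]; congr!
    · rw [← e3]; congr!

/-! ### Unsuccessful runs -/

/-- A switch moves the red pointer in a step in which blue is searched. The auxiliary clause of the
induction therefore remembers that the waiting red position was inspected earlier. -/
theorem exists_of_lt_ptr {n : ℕ} (H : Hypergraph n) (s : ℕ) {b : Bool} {y : ℕ}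
    (h : y < (run H s).ptr b) : ∃ r < s, (run H r).turn = b ∧ (run H r).ptr b = y := by
  refine (run_induction (H := H) (p := fun s S =>
    (∀ b y, y < S.ptr b → ∃ r < s, (run H r).turn = b ∧ (run H r).ptr b = y) ∧
    (S.turn = false → ∃ r < s, (run H r).turn = true ∧ (run H r).ptr true = S.ptr true))
    ?_ ?_ ?_ ?_ s).1 b y h
  · simp [State.init]
  · intro s S ih hS _ ht
    refine ⟨fun b y hy => ?_, fun _ => ⟨s, by omega, hS ▸ ht, by rw [← hS]; rfl⟩⟩
    obtain ⟨r, hr, h⟩ := ih.1 b y hy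
    exact ⟨r, by omega, h⟩
  · intro s S ih hS _ ht
    refine ⟨fun b y hy => ?_, fun h => by simp [State.swap] at h⟩
    rcases Nat.lt_succ_iff_lt_or_eq.1 hy with h | rfl
    · obtain ⟨r, hr, h⟩ := ih.1 b y h
      exact ⟨r, by omega, h⟩
    · cases b
      · exact ⟨s, by omega, hS ▸ ht, by rw [← hS]⟩
      · obtain ⟨r, hr, h⟩ := ih.2 ht
        exact ⟨r, by omega, h⟩
  · intro s S ih hS _
    refine ⟨fun b y hy => ?_, fun h => ?_⟩
    · by_cases hb : b = S.turn
      · subst hb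
        simp only [State.advance, Function.update_self] at hy
        rcases Nat.lt_succ_iff_lt_or_eq.1 hy with h | rfl
        · obtain ⟨r, hr, h⟩ := ih.1 _ y h
          exact ⟨r, by omega, h⟩
        · exact ⟨s, by omega, by rw [← hS], by rw [← hS]⟩
      · simp only [State.advance, Function.update_of_ne hb] at hy
        obtain ⟨r, hr, h⟩ := ih.1 b y hy
        exact ⟨r, by omega, h⟩
    · have ht : S.turn = false := h
      obtain ⟨r, hr, h⟩ := ih.2 ht
      refine ⟨r, by omega, ?_⟩
      simpa [State.advance, ht] using h

/-- A vertex that has been chosen is recolored, or it still waits for its partner. -/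
theorem recolored_of_accepts {n : ℕ} (H : Hypergraph n) {r s : ℕ} (hrs : r < s)
    (ha : Accepts H (run H r)) :
    (run H s).color (run H r).vertex ≠ (run H r).turn ∨
      ((run H r).turn = true ∧ (run H s).turn = false ∧ (run H s).ptr true = (run H r).ptr true) := by
  refine run_induction (H := H) (p := fun s S => ∀ r < s, Accepts H (run H r) →
    S.color (run H r).vertex ≠ (run H r).turn ∨
      ((run H r).turn = true ∧ S.turn = false ∧ S.ptr true = (run H r).ptr true))
    ?_ ?_ ?_ ?_ s r hrs ha
  · intro r hr; omega
  · intro s S ih hS _ ht r hr ha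
    rcases Nat.lt_succ_iff_lt_or_eq.1 hr with h | rfl
    · rcases ih r h ha with h | h
      · exact Or.inl h
      · rw [ht] at h; cases h.2.1
    · exact Or.inr ⟨hS ▸ ht, rfl, by rw [← hS]; rfl⟩
  · intro s S ih hS _ ht r hr ha
    rcases Nat.lt_succ_iff_lt_or_eq.1 hr with h | rfl
    · left
      rcases ih r h ha with h | ⟨h1, _, h3⟩
      · subst hS
        rw [swap_color_of_ne]
        · exact h
        · rwa [State.vertex, parity_vert, ← State.vertex]
      · simp [State.vertex, h1, ← h3, State.swap, vert_inj]
    · left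
      rw [← hS]
      simp [State.vertex, ht, State.swap]
  · intro s S ih hS hna r hr ha
    rcases Nat.lt_succ_iff_lt_or_eq.1 hr with h | rfl
    · rcases ih r h ha with h | ⟨h1, h2, h3⟩
      · exact Or.inl h
      · exact Or.inr ⟨h1, h2, by simpa [State.advance, h2] using h3⟩
    · exact absurd ha (hS ▸ hna)

/-- A clock for the scan. It implies that `n` steps take at least one pointer beyond the reserved
stretches. -/
theorem ptr_add_ptr {n : ℕ} (H : Hypergraph n) (s : ℕ) :
    (run H s).ptr true + (run H s).ptr false + (if (run H s).turn = true then 0 else 1) = s := by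
  refine run_induction (H := H) (p := fun s S =>
    S.ptr true + S.ptr false + (if S.turn = true then 0 else 1) = s) ?_ ?_ ?_ ?_ s
  · rfl
  · intro s S ih _ _ ht
    simp only [ht, State.withTurn] at ih ⊢
    simpa using ih
  · intro s S ih _ _ ht
    simp only [ht, State.swap] at ih ⊢
    simp at ih ⊢
    omega
  · intro s S ih _ _
    cases ht : S.turn <;> simp [ht, State.advance] at ih ⊢ <;> omega

/-- The vertices of `f` that may be recolored in order to destroy monochromatic edges. -/
def core {n : ℕ} (f : Finset (Fin n)) : Finset ℕ :=
  (f.image Fin.val).filter fun x => 16 * (x / 2) < n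

/-- The vertices of color `b` that may be recolored when there are no monochromatic edges of
color `b`. -/
def filler (n : ℕ) (b : Bool) : Finset ℕ :=
  (Finset.range n).filter fun x => parity x = b ∧ n ≤ 16 * (x / 2) ∧ 8 * (x / 2) < n

theorem mem_core {n : ℕ} {f : Finset (Fin n)} {x : ℕ} :
    x ∈ core f ↔ (∃ v ∈ f, (v : ℕ) = x) ∧ 16 * (x / 2) < n := by
  simp [core]

/-- The edge `f` has been monochromatic all along, so each of its core vertices was tested when the
pointer passed it. An accepted one would by now be recolored, as the pointer has moved on, and `f`
would not be monochromatic. -/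
theorem allRejected_core {n : ℕ} {H : Hypergraph n} {t : ℕ} {b : Bool} {f : Finset (Fin n)}
    (hf : f ∈ H) (hm : MonoIn ((run H t).coloring n) b f) (hp : n ≤ 16 * (run H t).ptr b) :
    AllRejected H t (core f) := by
  have hpar : ∀ v ∈ f, parity v = b := monoIn_mono H (Nat.zero_le t) hf hm
  refine ⟨fun x hx => ?_, fun r hr hx ha => ?_⟩
  · obtain ⟨⟨v, hv, rfl⟩, hlt⟩ := mem_core.1 hx
    have hvb := hpar v hv
    obtain ⟨r, hr, hrt, hrp⟩ := exists_of_lt_ptr H t (b := b) (y := (v : ℕ) / 2) (by omega)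
    have hvx : (run H r).vertex = v := by
      rw [State.vertex, hrt, hrp, ← hvb, vert_parity]
    have hmr := monoIn_mono H hr.le hf hm
    refine ⟨r, hr, hvx, ?_, fun h => h f hf b hmr, fun _ => ?_, fun h => ?_⟩
    · rw [hrt, hrp]; omega
    · rw [hrt]; exact ⟨f, hf, hmr, v, hv, hvx.symm⟩
    · rw [hrt, hrp] at h; omega
  · obtain ⟨⟨v, hv, hvx⟩, hlt⟩ := mem_core.1 hx
    have hturn : (run H r).turn = b := by
      rw [← hpar v hv, hvx, State.vertex, parity_vert]
    rcases recolored_of_accepts H hr ha with h | ⟨h1, _, h3⟩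
    · rw [← hvx, hturn] at h
      exact h (hm v hv)
    · rw [State.vertex, vert_div_two] at hlt
      rw [h1] at hlt hturn
      subst hturn
      omega

/-- Either some edge survives the passage of its pointer through the first stretch, or else all of
the second stretch of an exhausted color was really tested, since that color had no monochromatic
edges then. In the latter case a vertex was either rejected or recolored, and recolored vertices are
as few as the initial monochromatic edges. -/
theorem exists_allRejected {n : ℕ} (hn : Even n) (hn0 : 0 < n) {H : Hypergraph n}
    (hH : ¬ Proper H ((run H n).coloring n)) :
    ∃ t ≤ n, (∃ f ∈ H, (∃ b, MonoIn (fun v => parity v) b f) ∧ AllRejected H t (core f)) ∨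
      ∃ b, ∃ S ⊆ filler n b, S.card ≤ (monoEdges H fun v => parity v).card ∧
        AllRejected H t (filler n b \ S) := by
  classical
  by_cases hA : ∃ t ≤ n, ∃ b, ∃ f ∈ H, MonoIn ((run H t).coloring n) b f ∧
      n ≤ 16 * (run H t).ptr b
  · obtain ⟨t, ht, b, f, hf, hm, hp⟩ := hA
    exact ⟨t, ht, Or.inl ⟨f, hf, ⟨b, monoIn_mono H (Nat.zero_le t) hf hm⟩, allRejected_core hf hm hp⟩⟩
  have hb : ∃ b, n ≤ 8 * (run H n).ptr b := by
    by_contra hcon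
    push Not at hcon
    have h1 := hcon true
    have h2 := hcon false
    have h3 := ptr_add_ptr H n
    obtain ⟨N, hN⟩ := hn
    split_ifs at h3 <;> omega
  obtain ⟨b, hb⟩ := hb
  -- The exceptional set consists of the filler vertices that have been recolored.
  refine ⟨n, le_rfl, Or.inr ⟨b, (filler n b).filter fun x => (run H n).color x ≠ b,
    Finset.filter_subset _ _, ?_, fun x hx => ?_, fun r hr hx ha => ?_⟩⟩
  · refine le_trans ?_ ((Nat.le_add_right _ _).trans (card_recolored_add_le hn H b n))
    refine le_trans (Finset.card_le_card fun x hx => ?_) (Finset.card_image_le (f := Fin.val))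
    obtain ⟨h1, h2⟩ := Finset.mem_filter.1 hx
    obtain ⟨h3, h4, _⟩ := Finset.mem_filter.1 h1
    exact Finset.mem_image.2 ⟨⟨x, Finset.mem_range.1 h3⟩,
      Finset.mem_filter.2 ⟨Finset.mem_univ _, h4, h2⟩, rfl⟩
  · simp only [Finset.mem_sdiff, filler, Finset.mem_filter, Finset.mem_range] at hx
    obtain ⟨⟨hxn, hxb, hx1, hx2⟩, _⟩ := hx
    obtain ⟨r, hr, hrt, hrp⟩ := exists_of_lt_ptr H n (b := b) (y := x / 2) (by omega)
    have hvx : (run H r).vertex = x := by rw [State.vertex, hrt, hrp, ← hxb, vert_parity]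
    refine ⟨r, hr, hvx, ?_, fun h => hH fun e he b hm => h e he b (monoIn_mono H hr.le he hm),
      fun h => ?_, fun h e he hm => hA ⟨r, hr.le, b, e, he, hrt ▸ hm, by omega⟩⟩
    · rw [hrt, hrp]; omega
    · rw [hrt, hrp] at h; omega
  · simp only [Finset.mem_sdiff, filler, Finset.mem_filter, Finset.mem_range] at hx
    obtain ⟨⟨hxn, hxb, hx1, hx2⟩, hx3⟩ := hx
    have hturn : (run H r).turn = b := by rw [← hxb, State.vertex, parity_vert]
    rcases recolored_of_accepts H hr ha with h | ⟨h1, _, h3⟩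
    · exact hx3 ⟨⟨hxn, hxb, hx1, hx2⟩, hturn ▸ h⟩
    · rw [State.vertex, vert_div_two, h1] at hx2
      rw [h1] at hturn
      subst hturn
      omega

/-! ### A bound for the probability of failure -/

theorem card_filter_mem_mul {α : Type*} [DecidableEq α] (K : Finset α) (m : ℕ) {e : α} (he : e ∈ K) :
    ((K.powersetCard m).filter fun H => e ∈ H).card * K.card = m * (K.powersetCard m).card := by
  rcases Nat.eq_zero_or_pos m with rfl | hm
  · simp
  have h1 : ((K.powersetCard m).filter fun H => e ∈ H).card = (K.card - 1).choose (m - 1) := by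
    have := card_powersetCard_inter (U := K) (Q := {e}) (h := {e}) (m := m)
      (Finset.singleton_subset_iff.2 he) subset_rfl (by rw [Finset.card_singleton]; exact hm)
    rw [Finset.card_singleton] at this
    rw [← this]
    congr 1
    refine Finset.filter_congr fun H _ => ?_
    rw [Finset.inter_eq_right, Finset.singleton_subset_iff]
  have hK : 0 < K.card := Finset.card_pos.2 ⟨e, he⟩
  obtain ⟨N, hN⟩ := Nat.exists_eq_succ_of_ne_zero hK.ne'
  obtain ⟨m', rfl⟩ := Nat.exists_eq_succ_of_ne_zero hm.ne'
  rw [h1, Finset.card_powersetCard, hN]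
  simp only [Nat.succ_eq_add_one, Nat.add_sub_cancel]
  have := Nat.add_one_mul_choose_eq N m'
  linarith

theorem card_filter_mem {α : Type*} [DecidableEq α] (K : Finset α) (m : ℕ) {e : α} (he : e ∈ K) :
    (((K.powersetCard m).filter fun H => e ∈ H).card : ℝ) =
      m / K.card * (K.powersetCard m).card := by
  have hK : (K.card : ℝ) ≠ 0 := by exact_mod_cast (Finset.card_pos.2 ⟨e, he⟩).ne'
  rw [div_mul_eq_mul_div, eq_div_iff hK]
  exact_mod_cast card_filter_mem_mul K m he

/-- The expected number of elements in `B` of a random set. -/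
theorem sum_card_filter {α : Type*} [DecidableEq α] (K : Finset α) (m : ℕ) {B : Finset α}
    (hB : B ⊆ K) :
    ∑ H ∈ K.powersetCard m, ((H.filter (· ∈ B)).card : ℝ) =
      B.card * (m / K.card * (K.powersetCard m).card) := by
  have h1 : ∀ H ∈ K.powersetCard m, ((H.filter (· ∈ B)).card : ℝ) =
      ∑ e ∈ B, if e ∈ H then (1 : ℝ) else 0 := by
    intro H _
    rw [Finset.sum_boole]
    congr 2
    ext e; simp [and_comm]
  rw [Finset.sum_congr rfl h1, Finset.sum_comm, ← nsmul_eq_mul, ← Finset.sum_const]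
  refine Finset.sum_congr rfl fun e he => ?_
  rw [← card_filter_mem K m (hB he), Finset.sum_boole]

theorem card_filter_exists_le {α : Type*} [DecidableEq α] (K : Finset α) (m : ℕ) {B : Finset α}
    (hB : B ⊆ K) :
    (((K.powersetCard m).filter fun H => ∃ e ∈ B, e ∈ H).card : ℝ) ≤
      m / K.card * B.card * (K.powersetCard m).card := by
  rw [mul_right_comm, mul_comm, ← sum_card_filter K m hB, Finset.card_filter]
  push_cast
  refine Finset.sum_le_sum fun H _ => ?_
  split_ifs with h
  · obtain ⟨e, he, heH⟩ := h
    exact_mod_cast Finset.card_pos.2 ⟨e, Finset.mem_filter.2 ⟨heH, he⟩⟩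
  · positivity

/-- Markov's inequality for the number of elements in `B`, as an integer exceeding `T` is at least
`T + 1`. -/
theorem card_filter_lt_le {α : Type*} [DecidableEq α] (K : Finset α) (m T : ℕ) {B : Finset α}
    (hB : B ⊆ K) :
    (((K.powersetCard m).filter fun H => T < (H.filter (· ∈ B)).card).card : ℝ) ≤
      m / K.card * B.card / (T + 1) * (K.powersetCard m).card := by
  rw [div_mul_eq_mul_div, mul_right_comm, mul_comm _ (B.card : ℝ), ← sum_card_filter K m hB,
    le_div_iff₀ (by positivity), ← nsmul_eq_mul]
  refine (Finset.card_nsmul_le_sum _ (fun H => ((H.filter (· ∈ B)).card : ℝ)) _ fun H hH => ?_).trans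
      (Finset.sum_le_sum_of_subset_of_nonneg (Finset.filter_subset _ _) fun _ _ _ => by positivity)
  exact_mod_cast (Finset.mem_filter.1 hH).2

/-- This crude count is the price of a union bound over the exceptional sets of recolored vertices.
-/
theorem card_powerset_filter_le {α : Type*} [DecidableEq α] (F : Finset α) (T : ℕ) :
    (F.powerset.filter fun S => S.card ≤ T).card ≤ (F.card + 1) ^ T := by
  induction T with
  | zero =>
    refine (Finset.card_le_card (t := {∅}) fun S hS => ?_).trans (by simp)
    have := (Finset.mem_filter.1 hS).2
    simpa using this
  | succ T ih =>
    have h : (F.powerset.filter fun S => S.card ≤ T + 1) ⊆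
        (F.powerset.filter fun S => S.card ≤ T) ∪
        ((F.powerset.filter fun S => S.card ≤ T) ×ˢ F).image fun p => insert p.2 p.1 := by
      intro S hS
      obtain ⟨h1, h2⟩ := Finset.mem_filter.1 hS
      rw [Finset.mem_powerset] at h1
      rw [Finset.mem_union]
      rcases S.eq_empty_or_nonempty with rfl | ⟨x, hx⟩
      · left; simp
      · right
        refine Finset.mem_image.2 ⟨(S.erase x, x), ?_, Finset.insert_erase hx⟩
        simp only [Finset.mem_product, Finset.mem_filter, Finset.mem_powerset]
        refine ⟨⟨(Finset.erase_subset _ _).trans h1, ?_⟩, h1 hx⟩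
        rw [Finset.card_erase_of_mem hx]; omega
    refine (Finset.card_le_card h).trans ((Finset.card_union_le _ _).trans ?_)
    refine (Nat.add_le_add_left Finset.card_image_le _).trans ?_
    rw [Finset.card_product, pow_succ]
    nlinarith [ih]

/-- The sets of size `k` that are not spread. -/
noncomputable def clusteredSets (n k : ℕ) : Finset (Finset (Fin n)) := by
  classical exact (Finset.univ.powersetCard k).filter fun e => ¬ Spread e

/-- The monochromatic sets of size `k`. -/
noncomputable def monoSets (n k : ℕ) : Finset (Finset (Fin n)) :=
  initialQuery (Finset.univ.powersetCard k)

/-- The monochromatic sets of size `k` with less than `r` vertices that may be recolored. -/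
noncomputable def thinSets (n k r : ℕ) : Finset (Finset (Fin n)) :=
  (monoSets n k).filter fun f => (core f).card < r

theorem mem_monoSets {n k : ℕ} {e : Finset (Fin n)} :
    e ∈ monoSets n k ↔ e.card = k ∧ ∃ b, MonoIn (fun v : Fin n => parity v) b e := by
  classical
  simp [monoSets, initialQuery, Finset.mem_powersetCard]

theorem card_monoSets_le {n k : ℕ} (hn : Even n) : (monoSets n k).card ≤ 2 * (n / 2).choose k :=
  card_initialQuery_le hn fun _ he => (Finset.mem_powersetCard.1 he).2

/-- The sets of size `k` that are spread. -/
noncomputable def spreadSets (n k : ℕ) : Finset (Finset (Fin n)) := by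
  classical exact (Finset.univ.powersetCard k).filter Spread

theorem mem_spreadSets {n k : ℕ} {e : Finset (Fin n)} :
    e ∈ spreadSets n k ↔ e.card = k ∧ Spread e := by
  classical
  simp [spreadSets, Finset.mem_powersetCard]

theorem spreadSets_subset (n k : ℕ) : spreadSets n k ⊆ Finset.univ.powersetCard k := by
  classical
  exact Finset.filter_subset _ _

theorem card_spreadSets_add (n k : ℕ) :
    (spreadSets n k).card + (clusteredSets n k).card = n.choose k := by
  classical
  have h := Finset.card_filter_add_card_filter_not
    (s := (Finset.univ : Finset (Fin n)).powersetCard k) Spread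
  simp only [Finset.card_powersetCard, Finset.card_univ, Fintype.card_fin] at h
  rw [← h, spreadSets, clusteredSets]

-- A union bound over times and monochromatic sets `f`. Whether `f` is an edge is part of the
-- initial query, so its probability `m / C(n, k)` multiplies with that of the rejections. Counting
-- inside `spreadSets` is harmless, because the bound compares with all of `kGraphs`.
open Classical in
theorem card_core_rejected_le {n k m : ℕ} (hn : Even n) {γ : ℝ} (hγ0 : 0 ≤ γ) (hγ1 : γ < 1)
    (hγ : ∀ q M m', q ≤ (n / 2).choose (k - 1) →
      (spreadSets n k).card ≤ M + (2 * (n / 2).choose k + n * (n / 2).choose (k - 1)) → m' ≤ m →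
      γ * M.choose m' ≤ (M - q).choose m') (r : ℕ) :
    ((((spreadSets n k).powersetCard m).filter fun H => ∃ t ≤ n, ∃ f ∈ monoSets n k,
      r ≤ (core f).card ∧ f ∈ H ∧ AllRejected H t (core f)).card : ℝ) ≤
      (n + 1) * (m / n.choose k * (monoSets n k).card) * (1 - γ) ^ r * (kGraphs n k m).card := by
  have hsub : (((spreadSets n k).powersetCard m).filter fun H => ∃ t ≤ n, ∃ f ∈ monoSets n k,
      r ≤ (core f).card ∧ f ∈ H ∧ AllRejected H t (core f)) ⊆
      ((Finset.range (n + 1)) ×ˢ ((monoSets n k).filter fun f => r ≤ (core f).card)).biUnion fun x =>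
        ((spreadSets n k).powersetCard m).filter fun H => x.2 ∈ H ∧ AllRejected H x.1 (core x.2) := by
    intro H hH
    obtain ⟨h1, t, ht, f, hf, hr, hfH, hrej⟩ := Finset.mem_filter.1 hH
    refine Finset.mem_biUnion.2 ⟨(t, f), ?_, Finset.mem_filter.2 ⟨h1, hfH, hrej⟩⟩
    exact Finset.mem_product.2 ⟨Finset.mem_range.2 (by omega), Finset.mem_filter.2 ⟨hf, hr⟩⟩
  refine le_trans (Nat.cast_le.2 ((Finset.card_le_card hsub).trans Finset.card_biUnion_le)) ?_
  push_cast
  have hX : ∀ x ∈ (Finset.range (n + 1)) ×ˢ ((monoSets n k).filter fun f => r ≤ (core f).card),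
      ((((spreadSets n k).powersetCard m).filter fun H =>
        x.2 ∈ H ∧ AllRejected H x.1 (core x.2)).card : ℝ) ≤
        (1 - γ) ^ r * (m / n.choose k * (kGraphs n k m).card) := by
    rintro ⟨t, f⟩ hx
    obtain ⟨ht, hf⟩ := Finset.mem_product.1 hx
    obtain ⟨hf, hr⟩ := Finset.mem_filter.1 hf
    by_cases hfU : f ∈ spreadSets n k
    · refine le_trans (le_of_eq ?_) ((card_allRejected_le hn (fun e he => (mem_spreadSets.1 he).1)
        (fun e he => (mem_spreadSets.1 he).2) hγ0 hγ1 hγ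
        (Nat.lt_succ_iff.1 (Finset.mem_range.1 ht)) (core f) (fun H => f ∈ H) fun H H' h => ?_).trans ?_)
      · congr!
      · exact mem_iff_of_inter_eq h (Finset.mem_filter.2 ⟨hfU, (mem_monoSets.1 hf).2⟩)
      · refine mul_le_mul (pow_le_pow_of_le_one (by linarith) (by linarith) hr) ?_ (by positivity)
          (pow_nonneg (by linarith) _)
        have h1 := card_filter_mem (Finset.univ.powersetCard k) m (spreadSets_subset n k hfU)
        rw [Finset.card_powersetCard, Finset.card_univ, Fintype.card_fin] at h1
        rw [kGraphs, ← h1]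
        refine Nat.cast_le.2 (Finset.card_le_card fun H hH => ?_)
        simp only [Finset.mem_filter] at hH ⊢
        exact ⟨Finset.powersetCard_mono (spreadSets_subset n k) hH.1, hH.2⟩
    · have : ((spreadSets n k).powersetCard m).filter (fun H =>
          f ∈ H ∧ AllRejected H t (core f)) = ∅ := by
        refine Finset.filter_eq_empty_iff.2 fun H hH h => hfU ?_
        exact (Finset.mem_powersetCard.1 hH).1 h.1
      simp only [this, Finset.card_empty, Nat.cast_zero]
      exact mul_nonneg (pow_nonneg (by linarith) _) (by positivity)
  refine (Finset.sum_le_card_nsmul _ _ _ hX).trans ?_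
  rw [nsmul_eq_mul, Finset.card_product, Finset.card_range]
  have h1 : (((monoSets n k).filter fun f => r ≤ (core f).card).card : ℝ) ≤ (monoSets n k).card :=
    Nat.cast_le.2 (Finset.card_le_card (Finset.filter_subset _ _))
  push_cast
  have h2 : 0 ≤ (1 - γ) ^ r * ((m : ℝ) / n.choose k * (kGraphs n k m).card) :=
    mul_nonneg (pow_nonneg (by linarith) _) (by positivity)
  calc ((n : ℝ) + 1) * (((monoSets n k).filter fun f => r ≤ (core f).card).card : ℝ) *
        ((1 - γ) ^ r * ((m : ℝ) / n.choose k * (kGraphs n k m).card))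
      ≤ ((n : ℝ) + 1) * (monoSets n k).card *
        ((1 - γ) ^ r * ((m : ℝ) / n.choose k * (kGraphs n k m).card)) := by gcongr
    _ = _ := by ring

-- A union bound over times, colors and exceptional sets; at least `l` filler vertices remain
-- outside each exceptional set.
open Classical in
theorem card_filler_rejected_le {n k m : ℕ} (hn : Even n) {γ : ℝ} (hγ0 : 0 ≤ γ) (hγ1 : γ < 1)
    (hγ : ∀ q M m', q ≤ (n / 2).choose (k - 1) →
      (spreadSets n k).card ≤ M + (2 * (n / 2).choose k + n * (n / 2).choose (k - 1)) → m' ≤ m →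
      γ * M.choose m' ≤ (M - q).choose m') (T l : ℕ) (hl : ∀ b, l + T ≤ (filler n b).card) :
    ((((spreadSets n k).powersetCard m).filter fun H => ∃ t ≤ n, ∃ b, ∃ S ⊆ filler n b,
      S.card ≤ T ∧ AllRejected H t (filler n b \ S)).card : ℝ) ≤
      2 * (n + 1) ^ (T + 1) * (1 - γ) ^ l * (kGraphs n k m).card := by
  have hsub : (((spreadSets n k).powersetCard m).filter fun H => ∃ t ≤ n, ∃ b, ∃ S ⊆ filler n b,
      S.card ≤ T ∧ AllRejected H t (filler n b \ S)) ⊆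
      ((Finset.range (n + 1)) ×ˢ ((Finset.univ : Finset Bool) ×ˢ
        ((Finset.range n).powerset.filter fun S => S.card ≤ T))).biUnion fun x =>
        ((spreadSets n k).powersetCard m).filter fun H => x.2.2 ⊆ filler n x.2.1 ∧
          AllRejected H x.1 (filler n x.2.1 \ x.2.2) := by
    intro H hH
    obtain ⟨h1, t, ht, b, S, hS, hT, hrej⟩ := Finset.mem_filter.1 hH
    refine Finset.mem_biUnion.2 ⟨(t, b, S), ?_, Finset.mem_filter.2 ⟨h1, hS, hrej⟩⟩
    simp only [Finset.mem_product, Finset.mem_range, Finset.mem_univ, Finset.mem_filter,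
      Finset.mem_powerset, true_and]
    exact ⟨by omega, hS.trans (Finset.filter_subset _ _), hT⟩
  refine le_trans (Nat.cast_le.2 ((Finset.card_le_card hsub).trans Finset.card_biUnion_le)) ?_
  push_cast
  have hX : ∀ x ∈ (Finset.range (n + 1)) ×ˢ ((Finset.univ : Finset Bool) ×ˢ
        ((Finset.range n).powerset.filter fun S => S.card ≤ T)),
      ((((spreadSets n k).powersetCard m).filter fun H => x.2.2 ⊆ filler n x.2.1 ∧
          AllRejected H x.1 (filler n x.2.1 \ x.2.2)).card : ℝ) ≤
        (1 - γ) ^ l * (kGraphs n k m).card := by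
    rintro ⟨t, b, S⟩ hx
    simp only [Finset.mem_product, Finset.mem_range, Finset.mem_univ, Finset.mem_filter,
      Finset.mem_powerset, true_and] at hx
    refine le_trans (le_of_eq ?_) ((card_allRejected_le hn (fun e he => (mem_spreadSets.1 he).1)
        (fun e he => (mem_spreadSets.1 he).2) hγ0 hγ1 hγ
        (Nat.lt_succ_iff.1 hx.1) (filler n b \ S) (fun _ => S ⊆ filler n b) fun H H' h => Iff.rfl).trans ?_)
    · congr!
    refine mul_le_mul (pow_le_pow_of_le_one (by linarith) (by linarith) ?_) ?_ (by positivity)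
          (pow_nonneg (by linarith) _)
    · have := Finset.le_card_sdiff S (filler n b)
      have := hl b
      omega
    · refine Nat.cast_le.2 (Finset.card_le_card fun H hH => ?_)
      simp only [Finset.mem_filter] at hH
      exact Finset.powersetCard_mono (spreadSets_subset n k) hH.1
  refine (Finset.sum_le_card_nsmul _ _ _ hX).trans ?_
  rw [nsmul_eq_mul, Finset.card_product, Finset.card_product, Finset.card_range]
  have h1 : ((((Finset.range n).powerset.filter fun S => S.card ≤ T).card : ℕ) : ℝ) ≤
      ((n : ℝ) + 1) ^ T := by
    have := card_powerset_filter_le (Finset.range n) T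
    rw [Finset.card_range] at this
    exact_mod_cast this
  push_cast
  have h2 : 0 ≤ (1 - γ) ^ l * ((kGraphs n k m).card : ℝ) :=
    mul_nonneg (pow_nonneg (by linarith) _) (by positivity)
  calc ((n : ℝ) + 1) * (Fintype.card Bool *
        (((Finset.range n).powerset.filter fun S => S.card ≤ T).card : ℝ)) *
        ((1 - γ) ^ l * ((kGraphs n k m).card : ℝ))
      ≤ ((n : ℝ) + 1) * (2 * ((n : ℝ) + 1) ^ T) *
        ((1 - γ) ^ l * ((kGraphs n k m).card : ℝ)) := by
        rw [Fintype.card_bool]; push_cast; gcongr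
    _ = _ := by ring

open Classical in
/-- A union bound for the probability that the scanning procedure fails. -/
theorem card_failure_le {n k m : ℕ} (hn : Even n) (hn0 : 0 < n) {γ : ℝ} (hγ0 : 0 ≤ γ) (hγ1 : γ < 1)
    (hγ : ∀ q M m', q ≤ (n / 2).choose (k - 1) →
      (spreadSets n k).card ≤ M + (2 * (n / 2).choose k + n * (n / 2).choose (k - 1)) → m' ≤ m →
      γ * M.choose m' ≤ (M - q).choose m') (r T l : ℕ) (hl : ∀ b, l + T ≤ (filler n b).card) :
    (((kGraphs n k m).filter fun H => ¬ Proper H ((run H n).coloring n)).card : ℝ) ≤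
      (m / n.choose k * (clusteredSets n k).card + m / n.choose k * (thinSets n k r).card +
        m / n.choose k * (monoSets n k).card / (T + 1) +
        (n + 1) * (m / n.choose k * (monoSets n k).card) * (1 - γ) ^ r +
        2 * (n + 1) ^ (T + 1) * (1 - γ) ^ l) * (kGraphs n k m).card := by
  have h1 := card_core_rejected_le hn hγ0 hγ1 hγ r
  have h2 := card_filler_rejected_le hn hγ0 hγ1 hγ T l hl
  have hc : (Finset.powersetCard k (Finset.univ : Finset (Fin n))).card = n.choose k := by simp
  have h3 := card_filter_exists_le (Finset.univ.powersetCard k) m (B := clusteredSets n k)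
    (by rw [clusteredSets]; exact Finset.filter_subset _ _)
  have h4 := card_filter_exists_le (Finset.univ.powersetCard k) m (B := thinSets n k r)
    ((Finset.filter_subset _ _).trans (Finset.filter_subset _ _))
  have h5 := card_filter_lt_le (Finset.univ.powersetCard k) m T (B := monoSets n k)
    (Finset.filter_subset _ _)
  rw [hc] at h3 h4 h5
  change _ ≤ _ * ((kGraphs n k m).card : ℝ) at h3
  change _ ≤ _ * ((kGraphs n k m).card : ℝ) at h4
  change _ ≤ _ * ((kGraphs n k m).card : ℝ) at h5
  rw [add_mul, add_mul, add_mul, add_mul]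
  refine le_trans ?_ (add_le_add (add_le_add (add_le_add (add_le_add h3 h4) h5) h1) h2)
  rw [← Nat.cast_add, ← Nat.cast_add, ← Nat.cast_add, ← Nat.cast_add, Nat.cast_le]
  refine le_trans (Finset.card_le_card ?_) ((Finset.card_union_le _ _).trans
    (Nat.add_le_add_right ((Finset.card_union_le _ _).trans
    (Nat.add_le_add_right ((Finset.card_union_le _ _).trans
    (Nat.add_le_add_right (Finset.card_union_le _ _) _)) _)) _))
  intro H hH
  obtain ⟨hHX, hbad⟩ := Finset.mem_filter.1 hH
  have hHX' := hHX
  rw [kGraphs, Finset.mem_powersetCard] at hHX'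
  have hcard : ∀ e ∈ H, e.card = k := fun e he => (Finset.mem_powersetCard.1 (hHX'.1 he)).2
  simp only [Finset.mem_union]
  by_cases hc1 : ∃ e ∈ clusteredSets n k, e ∈ H
  · exact Or.inl (Or.inl (Or.inl (Or.inl (Finset.mem_filter.2 ⟨hHX, hc1⟩))))
  by_cases hc2 : ∃ e ∈ thinSets n k r, e ∈ H
  · exact Or.inl (Or.inl (Or.inl (Or.inr (Finset.mem_filter.2 ⟨hHX, hc2⟩))))
  by_cases hc3 : T < (H.filter (· ∈ monoSets n k)).card
  · exact Or.inl (Or.inl (Or.inr (Finset.mem_filter.2 ⟨hHX, hc3⟩)))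
  -- With no clustered edge, `H` lies in the family for which tests are independent of the past, and
  -- the witness falls under one of the last two terms.
  have hHU : H ∈ (spreadSets n k).powersetCard m := by
    refine Finset.mem_powersetCard.2 ⟨fun e he => ?_, hHX'.2⟩
    by_contra hcon
    refine hc1 ⟨e, ?_, he⟩
    rw [clusteredSets, Finset.mem_filter]
    refine ⟨hHX'.1 he, fun hs => hcon (mem_spreadSets.2 ⟨hcard e he, hs⟩)⟩
  obtain ⟨t, ht, ⟨f, hf, hfm, hrej⟩ | ⟨b, S, hS, hST, hrej⟩⟩ := exists_allRejected hn hn0 hbad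
  · have hfM : f ∈ monoSets n k := mem_monoSets.2 ⟨hcard f hf, hfm⟩
    refine Or.inl (Or.inr (Finset.mem_filter.2 ⟨hHU, t, ht, f, hfM, ?_, hf, hrej⟩))
    by_contra hcon
    exact hc2 ⟨f, Finset.mem_filter.2 ⟨hfM, by omega⟩, hf⟩
  · refine Or.inr (Finset.mem_filter.2 ⟨hHU, t, ht, b, S, hS, hST.trans ?_, hrej⟩)
    refine le_trans (Finset.card_le_card fun e he => ?_) (not_lt.1 hc3)
    obtain ⟨h6, h7⟩ := Finset.mem_filter.1 he
    exact Finset.mem_filter.2 ⟨h6, mem_monoSets.2 ⟨hcard e h6, h7⟩⟩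

/-! ### Running time of structured programs -/

theorem Memory.set_apply (s : Memory) (a i x b j : ℕ) :
    s.set a i x b j = if b = a ∧ j = i then x else s b j := by
  by_cases hb : b = a
  · subst hb
    by_cases hj : j = i <;> simp [Memory.set, hj]
  · simp [Memory.set, hb]

/-- The final memory of a program without loops. -/
def Program.result : Program → Memory → Memory
  | .skip, s => s
  | .write a i e, s => s.set a (i.eval s) (e.eval s)
  | .seq p q, s => q.result (p.result s)
  | .ite e p q, s => if e.eval s = 0 then q.result s else p.result s
  | .loop _ _, s => s

/-- A bound for the running time of a program without loops. -/
def Program.cost : Program → ℕ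
  | .skip => 1
  | .write _ i e => i.size + e.size + 1
  | .seq p q => p.cost + q.cost
  | .ite e p q => e.size + 1 + p.cost + q.cost
  | .loop _ _ => 0

/-- The program contains no loops. -/
def Program.LoopFree : Program → Prop
  | .skip => True
  | .write _ _ _ => True
  | .seq p q => p.LoopFree ∧ q.LoopFree
  | .ite _ p q => p.LoopFree ∧ q.LoopFree
  | .loop _ _ => False

/-- Started with memory `s`, the program `p` halts within `B` steps, with a memory satisfying `Q`. -/
def Halts (p : Program) (s : Memory) (B : ℕ) (Q : Memory → Prop) : Prop :=
  ∃ t s', Exec p s t s' ∧ t ≤ B ∧ Q s'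

theorem Program.LoopFree.halts {p : Program} (hp : p.LoopFree) {s : Memory} {Q : Memory → Prop}
    (hQ : Q (p.result s)) : Halts p s p.cost Q := by
  suffices h : ∀ s, ∃ t, Exec p s t (p.result s) ∧ t ≤ p.cost by
    obtain ⟨t, h1, h2⟩ := h s
    exact ⟨t, _, h1, h2, hQ⟩
  clear hQ
  induction p with
  | skip => exact fun s => ⟨1, .skip s, le_rfl⟩
  | write a i e => exact fun s => ⟨_, .write a i e s, le_rfl⟩
  | seq p q ihp ihq =>
    intro s
    obtain ⟨t₁, h1, h1'⟩ := ihp hp.1 s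
    obtain ⟨t₂, h2, h2'⟩ := ihq hp.2 (p.result s)
    exact ⟨_, .seq h1 h2, Nat.add_le_add h1' h2'⟩
  | ite e p q ihp ihq =>
    intro s
    by_cases he : e.eval s = 0
    · obtain ⟨t, h, h'⟩ := ihq hp.2 s
      refine ⟨e.size + 1 + t, ?_, ?_⟩
      · simp only [Program.result, he, if_true]; exact .ite_false he h
      · simp only [Program.cost]; omega
    · obtain ⟨t, h, h'⟩ := ihp hp.1 s
      refine ⟨e.size + 1 + t, ?_, ?_⟩
      · simp only [Program.result, he, if_false]; exact .ite_true he h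
      · simp only [Program.cost]; omega
  | loop e p _ => exact hp.elim

theorem Halts.seq {p q : Program} {s : Memory} {B B' : ℕ} {P Q : Memory → Prop}
    (hp : Halts p s B P) (hq : ∀ s', P s' → Halts q s' B' Q) :
    Halts (.seq p q) s (B + B') Q := by
  obtain ⟨t, s', h1, h2, h3⟩ := hp
  obtain ⟨t', s'', h1', h2', h3'⟩ := hq s' h3
  exact ⟨_, _, .seq h1 h1', Nat.add_le_add h2 h2', h3'⟩

/-- The invariant is indexed by the number of completed rounds, so the guard equivalence fixes their
number at exactly `N` and the time bound follows. -/
theorem Halts.loop {e : Expr} {p : Program} {N B : ℕ} (I : ℕ → Memory → Prop)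
    (hg : ∀ i s, i ≤ N → I i s → (e.eval s = 0 ↔ i = N))
    (hb : ∀ i s, i < N → I i s → Halts p s B (I (i + 1))) {s : Memory} (h0 : I 0 s) :
    Halts (.loop e p) s (N * (B + e.size + 1) + (e.size + 1)) (I N) := by
  suffices h : ∀ d i s, i + d = N → I i s →
      Halts (.loop e p) s (d * (B + e.size + 1) + (e.size + 1)) (I N) from h N 0 s (by omega) h0
  intro d
  induction d with
  | zero =>
    intro i s hi hs
    have hi : i = N := by omega
    subst hi
    exact ⟨_, s, .loop_false ((hg i s le_rfl hs).2 rfl), by omega, hs⟩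
  | succ d ih =>
    intro i s hi hs
    obtain ⟨t, s', h1, h2, h3⟩ := hb i s (by omega) hs
    obtain ⟨t', s'', h1', h2', h3'⟩ := ih (i + 1) s' (by omega) h3
    refine ⟨_, s'', .loop_true (fun h => ?_) h1 h1', ?_, h3'⟩
    · have := (hg i s (by omega) hs).1 h; omega
    · rw [add_mul]; omega

/-! ### The program -/

/-- The scalar variable stored in array `a`. -/
def var (a : ℕ) : Expr := .read a (.lit 0)

/-- Assignment to a scalar variable. -/
def assign (a : ℕ) (e : Expr) : Program := .write a (.lit 0) e

/-- Adding to a scalar variable. -/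
def addTo (a : ℕ) (e : Expr) : Program := assign a (.add (var a) e)

/-- The vertex of the edge list that is being read, which is found in the cell
given by variable `11`. -/
def currentVertex : Expr := .read 1 (var 11)

/-- Whether it has the color searched for, which is given by variable `3`. -/
def currentMatches : Expr := .eq (.read 2 currentVertex) (var 3)

/-- For a vertex of an edge: updating the multiplicity of the vertex under inspection (variable
`12`), the number of other vertices of the color searched for (variable `13`), and the numbers of
vertices of the opposite color and of the color searched for (variables `14` and `15`). -/
def vertexBody : Program :=
  .seq (addTo 12 (.eq currentVertex (var 7)))
  (.seq (addTo 13 (.lt (.eq currentVertex (var 7)) currentMatches))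
  (.seq (addTo 14 (.eq currentMatches (.lit 0)))
  (.seq (addTo 15 currentMatches)
  (.seq (addTo 11 (.lit 1)) (addTo 10 (.lit 1))))))

/-- Resetting the counters before an edge is read. -/
def edgeInit : Program :=
  .seq (assign 12 (.lit 0)) (.seq (assign 13 (.lit 0)) (.seq (assign 14 (.lit 0))
    (.seq (assign 15 (.lit 0)) (assign 10 (.lit 0)))))

/-- Evaluating an edge: variable `16` counts monochromatic edges, `17` those of the color searched
for, `18` those among them that contain the vertex under inspection, and `19` the edges of which it
is the head. -/
def edgeFinish : Program :=
  .seq (addTo 16 (.add (.eq (var 14) (.lit 0)) (.eq (var 15) (.lit 0))))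
  (.seq (addTo 17 (.eq (var 14) (.lit 0)))
  (.seq (addTo 18 (.lt (.eq (var 12) (.lit 0)) (.eq (var 14) (.lit 0))))
  (.seq (addTo 19 (.lt (.eq (var 12) (.lit 0)) (.eq (var 13) (.lit 0))))
  (addTo 9 (.lit 1)))))

/-- Reading an edge. -/
def edgeBody : Program :=
  .seq edgeInit (.seq (.loop (.lt (var 10) (.read 0 (.lit 1))) vertexBody) edgeFinish)

/-- Computing the vertex under inspection (variable `7`) and its position (variable `8`). -/
def scanInit : Program :=
  .seq (.ite (var 3) (.seq (assign 8 (var 4)) (assign 7 (.add (var 4) (var 4))))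
    (.seq (assign 8 (var 5)) (assign 7 (.add (.add (var 5) (var 5)) (.lit 1)))))
  (.seq (assign 9 (.lit 0)) (.seq (assign 11 (.lit 0)) (.seq (assign 16 (.lit 0))
    (.seq (assign 17 (.lit 0)) (.seq (assign 18 (.lit 0)) (assign 19 (.lit 0)))))))

/-- Doubling an expression. -/
def double (e : Expr) : Expr := .add e e

/-- The number of reasons to pass over the vertex under inspection. -/
def objections : Expr :=
  .add (.eq (.lt (double (double (double (var 8)))) (.read 0 (.lit 0))) (.lit 0))
  (.add (.eq (var 16) (.lit 0))
  (.add (var 19)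
  (.add (.lt (.eq (.lt (double (double (double (double (var 8))))) (.read 0 (.lit 0))) (.lit 0))
      (.eq (var 18) (.lit 0)))
    (.lt (.lt (double (double (double (double (var 8))))) (.read 0 (.lit 0)))
      (.lt (.lit 0) (var 17))))))

/-- Updating the state. -/
def scanFinish : Program :=
  .ite objections
    (.ite (var 3) (addTo 4 (.lit 1)) (addTo 5 (.lit 1)))
    (.ite (var 3) (assign 3 (.lit 0))
      (.seq (.write 2 (.add (var 4) (var 4)) (.lit 0))
      (.seq (.write 2 (.add (.add (var 5) (var 5)) (.lit 1)) (.lit 1))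
      (.seq (addTo 4 (.lit 1)) (.seq (addTo 5 (.lit 1)) (assign 3 (.lit 1)))))))

/-- One step of the scanning procedure. -/
def scanBody : Program :=
  .seq scanInit (.seq (.loop (.lt (var 9) (.read 0 (.lit 2))) edgeBody) scanFinish)

/-- Coloring a vertex according to its parity. -/
def colorBody : Program :=
  .seq (.write 2 (var 6) (.eq (.read 2 (.sub (var 6) (.lit 1))) (.lit 0))) (addTo 6 (.lit 1))

/-- The program: starting from the parity coloring, it makes `n` steps of the scanning procedure. -/
def scanProgram : Program :=
  .seq (.loop (.lt (var 6) (.read 0 (.lit 0))) colorBody)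
  (.seq (.seq (assign 6 (.lit 0)) (assign 3 (.lit 1)))
    (.loop (.lt (var 6) (.read 0 (.lit 0))) (.seq scanBody (addTo 6 (.lit 1)))))

/-! ### Its effect -/

open Classical in
/-- Truth values of the machine. -/
noncomputable def bit (p : Prop) : ℕ := if p then 1 else 0

theorem bit_eq_zero {p : Prop} : bit p = 0 ↔ ¬ p := by
  unfold bit; split_ifs <;> simp_all

theorem eval_lt (e f : Expr) (s : Memory) : (Expr.lt e f).eval s = bit (e.eval s < f.eval s) := by
  simp only [Expr.eval, bit]; split_ifs <;> rfl

theorem eval_eq (e f : Expr) (s : Memory) : (Expr.eq e f).eval s = bit (e.eval s = f.eval s) := by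
  simp only [Expr.eval, bit]; split_ifs <;> rfl

theorem eval_add (e f : Expr) (s : Memory) : (Expr.add e f).eval s = e.eval s + f.eval s := rfl

theorem eval_sub (e f : Expr) (s : Memory) : (Expr.sub e f).eval s = e.eval s - f.eval s := rfl

theorem eval_lit (c : ℕ) (s : Memory) : (Expr.lit c).eval s = c := rfl

theorem eval_read (a : ℕ) (e : Expr) (s : Memory) : (Expr.read a e).eval s = s a (e.eval s) := rfl

/-- The counters after the first `j` vertices of the edge that starts in cell `q` have been read. -/
def Counted (s₀ : Memory) (q j : ℕ) (s : Memory) : Prop :=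
  s 10 0 = j ∧ s 11 0 = q + j ∧
  s 12 0 = ∑ i ∈ Finset.range j, bit (s₀ 1 (q + i) = s₀ 7 0) ∧
  s 13 0 = ∑ i ∈ Finset.range j,
    bit (bit (s₀ 1 (q + i) = s₀ 7 0) < bit (s₀ 2 (s₀ 1 (q + i)) = s₀ 3 0)) ∧
  s 14 0 = ∑ i ∈ Finset.range j, bit (bit (s₀ 2 (s₀ 1 (q + i)) = s₀ 3 0) = 0) ∧
  s 15 0 = ∑ i ∈ Finset.range j, bit (s₀ 2 (s₀ 1 (q + i)) = s₀ 3 0) ∧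
  ∀ a i, a < 10 ∨ 15 < a → s a i = s₀ a i

theorem vertexBody_loopFree : vertexBody.LoopFree := by
  simp [vertexBody, addTo, assign, Program.LoopFree]

theorem counted_succ {s₀ s : Memory} {q j : ℕ} (h : Counted s₀ q j s) :
    Counted s₀ q (j + 1) (vertexBody.result s) := by
  obtain ⟨h10, h11, h12, h13, h14, h15, hf⟩ := h
  have e1 : s 1 (q + j) = s₀ 1 (q + j) := hf _ _ (by omega)
  have e2 : ∀ v, s 2 v = s₀ 2 v := fun v => hf _ _ (by omega)
  have e3 : s 3 0 = s₀ 3 0 := hf _ _ (by omega)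
  have e7 : s 7 0 = s₀ 7 0 := hf _ _ (by omega)
  refine ⟨?_, ?_, ?_, ?_, ?_, ?_, fun a i ha => ?_⟩
  on_goal 7 =>
    rw [← hf a i ha]
    simp only [vertexBody, addTo, assign, Program.result, Memory.set_apply]
    repeat rw [if_neg (by omega)]
  all_goals
    simp [vertexBody, addTo, assign, Program.result, Memory.set_apply, eval_lt, eval_eq, eval_add,
      eval_lit, eval_read, var, currentVertex, currentMatches, h10, h11, h12, h13, h14, h15,
      Finset.sum_range_succ, e1, e2, e3, e7, add_assoc]

/-- The value of a counter for the edge that starts in cell `q`: its multiplicity of the vertex under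
inspection. -/
noncomputable def multiplicity (s : Memory) (k q : ℕ) : ℕ :=
  ∑ i ∈ Finset.range k, bit (s 1 (q + i) = s 7 0)

/-- The number of other vertices of the color searched for. -/
noncomputable def othersMatching (s : Memory) (k q : ℕ) : ℕ :=
  ∑ i ∈ Finset.range k, bit (bit (s 1 (q + i) = s 7 0) < bit (s 2 (s 1 (q + i)) = s 3 0))

/-- The number of vertices of the opposite color. -/
noncomputable def opposite (s : Memory) (k q : ℕ) : ℕ :=
  ∑ i ∈ Finset.range k, bit (bit (s 2 (s 1 (q + i)) = s 3 0) = 0)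

/-- The number of vertices of the color searched for. -/
noncomputable def matching (s : Memory) (k q : ℕ) : ℕ :=
  ∑ i ∈ Finset.range k, bit (s 2 (s 1 (q + i)) = s 3 0)

/-- The counters after the first `i` edges have been read. -/
def Scanned (s₀ : Memory) (k i : ℕ) (s : Memory) : Prop :=
  s 9 0 = i ∧ s 11 0 = i * k ∧
  s 16 0 = ∑ i ∈ Finset.range i,
    (bit (opposite s₀ k (i * k) = 0) + bit (matching s₀ k (i * k) = 0)) ∧
  s 17 0 = ∑ i ∈ Finset.range i, bit (opposite s₀ k (i * k) = 0) ∧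
  s 18 0 = ∑ i ∈ Finset.range i,
    bit (bit (multiplicity s₀ k (i * k) = 0) < bit (opposite s₀ k (i * k) = 0)) ∧
  s 19 0 = ∑ i ∈ Finset.range i,
    bit (bit (multiplicity s₀ k (i * k) = 0) < bit (othersMatching s₀ k (i * k) = 0)) ∧
  ∀ a i, a < 9 → s a i = s₀ a i

theorem halts_edgeBody {s₀ s : Memory} {k i : ℕ} (hk : s₀ 0 1 = k) (h : Scanned s₀ k i s) :
    Halts edgeBody s (edgeInit.cost +
      ((k * (vertexBody.cost + 5 + 1) + (5 + 1)) + edgeFinish.cost)) (Scanned s₀ k (i + 1)) := by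
  obtain ⟨h9, h11, h16, h17, h18, h19, hf⟩ := h
  refine Halts.seq (P := Counted s (i * k) 0) (Program.LoopFree.halts ?_ ?_) fun s₁ h₁ => ?_
  · simp [edgeInit, assign, Program.LoopFree]
  · refine ⟨?_, ?_, ?_, ?_, ?_, ?_, fun a i ha => ?_⟩
    on_goal 7 =>
      simp only [edgeInit, assign, Program.result, Memory.set_apply]
      repeat rw [if_neg (by omega)]
    all_goals
      simp [edgeInit, assign, Program.result, Memory.set_apply, eval_lit, h11]
  refine Halts.seq (P := Counted s (i * k) k) (Halts.loop (e := .lt (var 10) (.read 0 (.lit 1)))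
    (fun j => Counted s (i * k) j) (fun j s' hj h' => ?_) (fun j s' hj h' => ?_) h₁) fun s₂ h₂ => ?_
  · obtain ⟨h10, _, _, _, _, _, hf'⟩ := h'
    have e : s' 0 1 = k := by rw [hf' _ _ (by omega), hf _ _ (by omega), hk]
    simp only [eval_lt, bit_eq_zero, var, eval_read, eval_lit, h10, e]
    omega
  · exact Program.LoopFree.halts vertexBody_loopFree (counted_succ h')
  refine Program.LoopFree.halts ?_ ?_
  · simp [edgeFinish, addTo, assign, Program.LoopFree]
  · obtain ⟨_, h11', h12', h13', h14', h15', hf'⟩ := h₂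
    have e1 : ∀ v, s 1 v = s₀ 1 v := fun v => hf _ _ (by omega)
    have e2 : ∀ v, s 2 v = s₀ 2 v := fun v => hf _ _ (by omega)
    have e3 : s 3 0 = s₀ 3 0 := hf _ _ (by omega)
    have e7 : s 7 0 = s₀ 7 0 := hf _ _ (by omega)
    simp only [e1, e2, e3, e7] at h12' h13' h14' h15'
    change _ = multiplicity s₀ k (i * k) at h12'
    change _ = othersMatching s₀ k (i * k) at h13'
    change _ = opposite s₀ k (i * k) at h14'
    change _ = matching s₀ k (i * k) at h15'
    rw [← hf' 9 0 (by omega)] at h9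
    rw [← hf' 16 0 (by omega)] at h16
    rw [← hf' 17 0 (by omega)] at h17
    rw [← hf' 18 0 (by omega)] at h18
    rw [← hf' 19 0 (by omega)] at h19
    refine ⟨?_, ?_, ?_, ?_, ?_, ?_, fun a i ha => ?_⟩
    on_goal 7 =>
      rw [← hf a i ha, ← hf' a i (by omega)]
      simp only [edgeFinish, addTo, assign, Program.result, Memory.set_apply]
      repeat rw [if_neg (by omega)]
    all_goals
      simp [edgeFinish, addTo, assign, Program.result, Memory.set_apply, eval_lit, eval_lt, eval_eq,
        eval_add, eval_read, var, h9, h11', h12', h13', h14', h15', h16, h17, h18, h19, add_mul,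
        Finset.sum_range_succ]

/-- The memory contains the `M` edges of size `k` and the state `S`. -/
def Represents (n k M : ℕ) (E : ℕ → ℕ) (S : State) (s : Memory) : Prop :=
  s 0 0 = n ∧ s 0 1 = k ∧ s 0 2 = M ∧ s 1 = E ∧ (∀ v < n, s 2 v = bit (S.color v = true)) ∧
    s 3 0 = bit (S.turn = true) ∧ s 4 0 = S.ptr true ∧ s 5 0 = S.ptr false

/-- The edges with numbers less than `M` in the list `E` of vertices are those of `H`. -/
def Lists {n : ℕ} (k M : ℕ) (E : ℕ → ℕ) (H : Hypergraph n) : Prop :=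
  ∃ e : ℕ → Finset (Fin n), H = (Finset.range M).image e ∧
    ∀ i < M, (∀ v : Fin n, v ∈ e i ↔ ∃ j < k, E (i * k + j) = v) ∧ ∀ j < k, E (i * k + j) < n

/-! ### From counters back to the hypergraph -/

theorem bit_inj {p q : Prop} : bit p = bit q ↔ (p ↔ q) := by
  unfold bit; split_ifs <;> simp_all

/-- On truth values `lt` serves as "not the first, but the second"; this is how the program
expresses conjunctions. -/
theorem bit_lt {p q : Prop} : bit p < bit q ↔ ¬ p ∧ q := by
  unfold bit; split_ifs <;> simp_all

theorem sum_bit_eq_zero {k : ℕ} {p : ℕ → Prop} :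
    ∑ j ∈ Finset.range k, bit (p j) = 0 ↔ ∀ j < k, ¬ p j := by
  rw [Finset.sum_eq_zero_iff]
  simp only [Finset.mem_range, bit_eq_zero]

/-- Only the vanishing of a counter is ever used, and it expresses a statement about all vertices of
the edge, whatever their order. -/
theorem sum_bit_edge {n k q : ℕ} {E : ℕ → ℕ} {e : Finset (Fin n)}
    (he : ∀ v : Fin n, v ∈ e ↔ ∃ j < k, E (q + j) = v) (hn : ∀ j < k, E (q + j) < n) (p : ℕ → Prop) :
    ∑ j ∈ Finset.range k, bit (p (E (q + j))) = 0 ↔ ∀ v ∈ e, ¬ p v := by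
  rw [sum_bit_eq_zero]
  constructor
  · intro h v hv
    obtain ⟨j, hj, hjv⟩ := (he v).1 hv
    rw [← hjv]; exact h j hj
  · intro h j hj
    exact h ⟨_, hn j hj⟩ ((he _).2 ⟨j, hj, rfl⟩)

theorem objections_eq_zero {n k M : ℕ} {E : ℕ → ℕ} {H : Hypergraph n} (hE : Lists k M E H)
    {S : State} {s₀ s : Memory} (h₀ : Represents n k M E S s₀) (h7 : s₀ 7 0 = S.vertex)
    (h8 : s₀ 8 0 = S.ptr S.turn) (h : Scanned s₀ k M s) :
    objections.eval s = 0 ↔ Accepts H S := by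
  obtain ⟨e, rfl, he⟩ := hE
  obtain ⟨h0n, h0k, h0M, h1, h2, h3, h4, h5⟩ := h₀
  obtain ⟨h9, h11, h16, h17, h18, h19, hf⟩ := h
  have e8 : s 8 0 = S.ptr S.turn := by rw [hf _ _ (by omega), h8]
  have e0 : s 0 0 = n := by rw [hf _ _ (by omega), h0n]
  have hmatch : ∀ v < n, s₀ 2 v = s₀ 3 0 ↔ S.color v = S.turn := by
    intro v hv
    rw [h2 v hv, h3, bit_inj]
    cases S.color v <;> cases S.turn <;> simp
  have hmult : ∀ i < M, multiplicity s₀ k (i * k) = 0 ↔ ¬ ∃ v ∈ e i, (v : ℕ) = S.vertex := by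
    intro i hi
    rw [multiplicity, h1, h7, sum_bit_edge (he i hi).1 (he i hi).2 (fun x => x = S.vertex)]
    push Not; rfl
  have hopp : ∀ i < M, opposite s₀ k (i * k) = 0 ↔ MonoIn (S.coloring n) S.turn (e i) := by
    intro i hi
    rw [opposite, h1, sum_bit_edge (he i hi).1 (he i hi).2 (fun x => bit (s₀ 2 x = s₀ 3 0) = 0)]
    refine forall_congr' fun v => forall_congr' fun _ => ?_
    rw [bit_eq_zero, not_not, hmatch v v.2]; rfl
  have hmat : ∀ i < M, matching s₀ k (i * k) = 0 ↔ MonoIn (S.coloring n) (!S.turn) (e i) := by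
    intro i hi
    rw [matching, h1, sum_bit_edge (he i hi).1 (he i hi).2 (fun x => s₀ 2 x = s₀ 3 0)]
    refine forall_congr' fun v => forall_congr' fun _ => ?_
    rw [hmatch v v.2, State.coloring]
    cases S.color v <;> cases S.turn <;> simp
  have hoth : ∀ i < M, othersMatching s₀ k (i * k) = 0 ↔
      ∀ w ∈ e i, (w : ℕ) ≠ S.vertex → S.color w = !S.turn := by
    intro i hi
    rw [othersMatching, h1, sum_bit_edge (he i hi).1 (he i hi).2
      (fun x => bit (x = s₀ 7 0) < bit (s₀ 2 x = s₀ 3 0))]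
    refine forall_congr' fun v => forall_congr' fun _ => ?_
    rw [bit_lt, hmatch v v.2, h7]
    cases S.color v <;> cases S.turn <;> simp
  have hheads : ∀ i < M, (bit (bit (multiplicity s₀ k (i * k) = 0) <
      bit (othersMatching s₀ k (i * k) = 0)) = 0 ↔ ¬ Heads S (e i)) := by
    intro i hi
    rw [bit_eq_zero, bit_lt, hmult i hi, hoth i hi, not_not, not_iff_not]
    constructor
    · rintro ⟨⟨v, hv, hvx⟩, hw⟩
      exact ⟨v, hv, hvx, fun w hwe hwv => hw w hwe fun h => hwv (Fin.ext (h.trans hvx.symm))⟩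
    · rintro ⟨v, hv, hvx, hw⟩
      exact ⟨⟨v, hv, hvx⟩, fun w hwe hwv => hw w hwe fun h => hwv (h ▸ hvx)⟩
  have h16' : s 16 0 = 0 ↔ Proper ((Finset.range M).image e) (S.coloring n) := by
    rw [h16, Finset.sum_eq_zero_iff]
    simp only [Proper, Finset.mem_image, forall_exists_index, and_imp, forall_apply_eq_imp_iff₂,
      Finset.mem_range]
    refine forall_congr' fun i => forall_congr' fun hi => ?_
    rw [Nat.add_eq_zero_iff, bit_eq_zero, bit_eq_zero, hopp i hi, hmat i hi]
    cases S.turn <;> simp [and_comm]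
  have h17' : s 17 0 = 0 ↔ ∀ f ∈ (Finset.range M).image e, ¬ MonoIn (S.coloring n) S.turn f := by
    rw [h17, sum_bit_eq_zero]
    simp only [Finset.mem_image, forall_exists_index, and_imp, forall_apply_eq_imp_iff₂,
      Finset.mem_range]
    exact forall_congr' fun i => forall_congr' fun hi => not_congr (hopp i hi)
  have h18' : s 18 0 = 0 ↔ ¬ ∃ f ∈ (Finset.range M).image e, MonoIn (S.coloring n) S.turn f ∧
      ∃ v ∈ f, (v : ℕ) = S.vertex := by
    rw [h18, sum_bit_eq_zero]
    simp only [not_exists, not_and, Finset.mem_image, forall_exists_index, and_imp,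
      forall_apply_eq_imp_iff₂, Finset.mem_range]
    refine forall_congr' fun i => forall_congr' fun hi => ?_
    rw [bit_lt, hmult i hi, hopp i hi, not_not]
    push Not
    constructor
    · intro h hm v hv hvx; exact h ⟨v, hv, hvx⟩ hm
    · rintro h ⟨v, hv, hvx⟩ hm; exact h hm v hv hvx
  have h19' : s 19 0 = 0 ↔ ∀ f ∈ (Finset.range M).image e, ¬ Heads S f := by
    rw [h19, Finset.sum_eq_zero_iff]
    simp only [Finset.mem_image, forall_exists_index, and_imp, forall_apply_eq_imp_iff₂,
      Finset.mem_range]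
    exact forall_congr' fun i => forall_congr' fun hi => hheads i hi
  simp only [objections, double, eval_add, eval_eq, eval_lt, eval_read, eval_lit, var, e8, e0,
    Nat.add_eq_zero_iff, bit_eq_zero, bit_lt, h16', h18', h19', not_not, not_lt, not_and,
    Nat.pos_iff_ne_zero, Ne, h17', Accepts, Searched]
  -- The machine cannot multiply, so the thresholds `8 * ptr` and `16 * ptr` appear as repeated
  -- doublings.
  have a1 : S.ptr S.turn + S.ptr S.turn + (S.ptr S.turn + S.ptr S.turn) +
      (S.ptr S.turn + S.ptr S.turn + (S.ptr S.turn + S.ptr S.turn)) = 8 * S.ptr S.turn := by ring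
  rw [a1, ← two_mul (8 * S.ptr S.turn), ← mul_assoc]
  simp only [not_le, Nat.reduceMul]
  exact ⟨fun ⟨a, b, c, d, f⟩ => ⟨⟨a, b, d, f⟩, c⟩, fun ⟨⟨a, b, d, f⟩, c⟩ => ⟨a, b, c, d, f⟩⟩

theorem halts_scanBody {n k M : ℕ} {E : ℕ → ℕ} {H : Hypergraph n} (hE : Lists k M E H)
    {S : State} {s : Memory} (h : Represents n k M E S s) :
    Halts scanBody s (scanInit.cost + ((M * ((edgeInit.cost +
      ((k * (vertexBody.cost + 5 + 1) + (5 + 1)) + edgeFinish.cost)) + 5 + 1) + (5 + 1)) +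
        scanFinish.cost)) fun s' => Represents n k M E (next H S) s' ∧ s' 6 0 = s 6 0 := by
  classical
  refine Halts.seq (P := fun s₀ => Represents n k M E S s₀ ∧ s₀ 7 0 = S.vertex ∧
    s₀ 8 0 = S.ptr S.turn ∧ s₀ 6 0 = s 6 0 ∧ Scanned s₀ k 0 s₀)
    (Program.LoopFree.halts ?_ ?_) fun s₀ h₀ => ?_
  · simp [scanInit, assign, Program.LoopFree]
  · obtain ⟨h0n, h0k, h0M, h1, h2, h3, h4, h5⟩ := h
    have hfr : ∀ a i, a < 7 → scanInit.result s a i = s a i := by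
      intro a i ha
      by_cases hs3 : s 3 0 = 0
      all_goals
        simp only [scanInit, assign, Program.result, var, eval_read, eval_lit, hs3, if_true, if_false,
          Memory.set_apply]
        repeat rw [if_neg (by omega)]
    refine ⟨⟨by rw [hfr _ _ (by omega), h0n], by rw [hfr _ _ (by omega), h0k],
      by rw [hfr _ _ (by omega), h0M], ?_, fun v hv => by rw [hfr _ _ (by omega), h2 v hv],
      by rw [hfr _ _ (by omega), h3], by rw [hfr _ _ (by omega), h4],
      by rw [hfr _ _ (by omega), h5]⟩, ?_, ?_, by rw [hfr _ _ (by omega)], ?_⟩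
    · funext i; rw [hfr _ _ (by omega), h1]
    · cases ht : S.turn <;> simp [ht, bit] at h3 <;>
      simp [scanInit, assign, Program.result, Memory.set_apply, eval_read, eval_lit, eval_add, var,
        h3, h4, h5, State.vertex, ht, vert, two_mul]
    · cases ht : S.turn <;> simp [ht, bit] at h3 <;>
      simp [scanInit, assign, Program.result, Memory.set_apply, eval_read, eval_lit, eval_add, var,
        h3, h4, h5]
    · refine ⟨?_, ?_, ?_, ?_, ?_, ?_, fun _ _ _ => rfl⟩ <;>
      simp [scanInit, assign, Program.result, Memory.set_apply, eval_lit]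
  obtain ⟨hR, h7, h8, h6, hS⟩ := h₀
  refine Halts.seq (P := Scanned s₀ k M) (Halts.loop (N := M)
    (B := edgeInit.cost + ((k * (vertexBody.cost + 5 + 1) + (5 + 1)) + edgeFinish.cost))
    (e := .lt (var 9) (.read 0 (.lit 2)))
    (Scanned s₀ k) (fun i s' hi h' => ?_) (fun i s' hi h' => ?_) hS) fun s₁ h₁ => ?_
  · have e : s' 0 2 = M := by rw [h'.2.2.2.2.2.2 _ _ (by omega), hR.2.2.1]
    simp only [eval_lt, bit_eq_zero, var, eval_read, eval_lit, h'.1, e]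
    omega
  · exact halts_edgeBody hR.2.1 h'
  have hobj := objections_eq_zero hE hR h7 h8 h₁
  obtain ⟨h0n, h0k, h0M, h1, h2, h3, h4, h5⟩ := hR
  have hf : ∀ a i, a < 9 → s₁ a i = s₀ a i := h₁.2.2.2.2.2.2
  have e0 : ∀ i, s₁ 0 i = s₀ 0 i := fun i => hf _ _ (by omega)
  have e1 : s₁ 1 = E := by rw [← h1]; funext i; exact hf _ _ (by omega)
  have e2 : ∀ v < n, s₁ 2 v = bit (S.color v = true) := fun v hv => by rw [hf _ _ (by omega), h2 v hv]
  have e3 : s₁ 3 0 = bit (S.turn = true) := by rw [hf _ _ (by omega), h3]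
  have e4 : s₁ 4 0 = S.ptr true := by rw [hf _ _ (by omega), h4]
  have e5 : s₁ 5 0 = S.ptr false := by rw [hf _ _ (by omega), h5]
  have e6 : s₁ 6 0 = s 6 0 := by rw [hf _ _ (by omega), h6]
  refine Program.LoopFree.halts ?_ ?_
  · simp [scanFinish, addTo, assign, Program.LoopFree]
  have hrow : ∀ (t : Memory) a i x b, b ≠ a → t.set a i x b = t b := by
    intro t a i x b hb; funext j; rw [Memory.set_apply, if_neg (by omega)]
  by_cases ha : Accepts H S
  · have ho := hobj.2 ha
    cases ht : S.turn
    · rw [ht] at e3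
      have e3' : s₁ 3 0 = 0 := by rw [e3, bit_eq_zero]; simp
      simp only [next, if_pos ha, ht, scanFinish, Program.result, ho, if_true, eval_read, eval_lit,
        var, e3', addTo, assign, eval_add]
      refine ⟨⟨?_, ?_, ?_, ?_, fun v hv => ?_, ?_, ?_, ?_⟩, ?_⟩
      on_goal 5 =>
        have hsw : S.swap.color v = if v = S.ptr false + S.ptr false + 1 then true else
            if v = S.ptr true + S.ptr true then false else S.color v := by
          simp [State.swap, Function.update_apply, vert, two_mul]
        change _ = bit (S.swap.color v = true)
        simp only [Memory.set_apply, e4, e5, hsw]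
        by_cases hv1 : v = S.ptr false + S.ptr false + 1
        · simp [← hv1, bit]
        · by_cases hv2 : v = S.ptr true + S.ptr true
          · simp [hv1, ← hv2, bit]
          · simp [hv1, hv2, e2 v hv]
      all_goals simp [Memory.set_apply, hrow, e0, e1, e4, e5, e6, h0n, h0k, h0M, State.swap, bit]
    · rw [ht] at e3
      have e3' : s₁ 3 0 = 1 := by rw [e3]; simp [bit]
      simp only [next, if_pos ha, ht, scanFinish, Program.result, ho, if_true, eval_read, eval_lit,
        var, e3', assign, one_ne_zero, if_false]
      refine ⟨⟨?_, ?_, ?_, ?_, fun v hv => ?_, ?_, ?_, ?_⟩, ?_⟩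
      all_goals simp [Memory.set_apply, hrow, e0, e1, e4, e5, e6, h0n, h0k, h0M, State.withTurn]
      · simp [e2 v hv]
      · simp [bit]
  · have ho := mt hobj.1 ha
    cases ht : S.turn
    · rw [ht] at e3
      have e3' : s₁ 3 0 = 0 := by rw [e3, bit_eq_zero]; simp
      simp only [next, if_neg ha, ht, scanFinish, Program.result, ho, if_true, if_false, eval_read,
        eval_lit, var, e3', addTo, assign, eval_add]
      refine ⟨⟨?_, ?_, ?_, ?_, fun v hv => ?_, ?_, ?_, ?_⟩, ?_⟩
      all_goals simp [Memory.set_apply, hrow, e0, e1, e4, e5, e6, h0n, h0k, h0M, State.advance, ht,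
        e3', bit]
      simp [e2 v hv, bit]
    · rw [ht] at e3
      have e3' : s₁ 3 0 = 1 := by rw [e3]; simp [bit]
      simp only [next, if_neg ha, ht, scanFinish, Program.result, ho, if_false, eval_read,
        eval_lit, var, e3', addTo, assign, eval_add, one_ne_zero]
      refine ⟨⟨?_, ?_, ?_, ?_, fun v hv => ?_, ?_, ?_, ?_⟩, ?_⟩
      all_goals simp [Memory.set_apply, hrow, e0, e1, e4, e5, e6, h0n, h0k, h0M, State.advance, ht,
        e3', bit]
      simp [e2 v hv, bit]


/-- The invariant of the loop that writes down the initial coloring. -/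
def Colored (s₀ : Memory) (i : ℕ) (s : Memory) : Prop :=
  s 6 0 = i ∧ (∀ a j, a ≠ 2 → a ≠ 6 → s a j = s₀ a j) ∧ ∀ v, s 2 v = bit (v < i ∧ parity v = true)

theorem colored_succ {s₀ : Memory} {i : ℕ} {s : Memory} (h : Colored s₀ i s) :
    Colored s₀ (i + 1) (colorBody.result s) := by
  obtain ⟨h6, hf, h2⟩ := h
  -- Each color negates the preceding one. For `i = 0` the truncated `i - 1` is cell `0` itself,
  -- still `0`, so vertex `0` becomes red.
  have hval : bit (s 2 (i - 1) = 0) = bit (parity i = true) := by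
    rw [h2, bit_eq_zero, bit_inj]
    simp only [parity, decide_eq_true_eq]
    omega
  refine ⟨?_, fun a j h2 h6 => ?_, fun v => ?_⟩
  · simp [colorBody, addTo, assign, Program.result, Memory.set_apply, eval_read, eval_lit, eval_add,
      var, h6]
  · rw [← hf a j h2 h6]
    simp only [colorBody, addTo, assign, Program.result, Memory.set_apply]
    repeat rw [if_neg (by omega)]
  · simp only [colorBody, addTo, assign, Program.result, Memory.set_apply, eval_read, eval_lit,
      eval_add, eval_sub, eval_eq, var, h6, hval]
    rcases eq_or_ne v i with rfl | hv
    · simp [bit]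
    · have : v < i + 1 ↔ v < i := by omega
      simp [hv, h2, this]

/-- A bound for the running time of the program. -/
def timeBound (n k M : ℕ) : ℕ :=
  (n * (colorBody.cost + 5 + 1) + (5 + 1)) + ((Program.seq (assign 6 (.lit 0)) (assign 3 (.lit 1))).cost +
    (n * ((scanInit.cost + ((M * ((edgeInit.cost +
      ((k * (vertexBody.cost + 5 + 1) + (5 + 1)) + edgeFinish.cost)) + 5 + 1) + (5 + 1)) +
        scanFinish.cost)) + (addTo 6 (.lit 1)).cost + 5 + 1) + (5 + 1)))

theorem halts_scanProgram {n k M : ℕ} {E : ℕ → ℕ} {H : Hypergraph n} (hE : Lists k M E H)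
    {s₀ : Memory} (h0n : s₀ 0 0 = n) (h0k : s₀ 0 1 = k) (h0M : s₀ 0 2 = M) (h1 : s₀ 1 = E)
    (h2 : ∀ a j, 2 ≤ a → s₀ a j = 0) :
    Halts scanProgram s₀ (timeBound n k M)
      fun s => ∀ v < n, s 2 v = bit ((run H n).color v = true) := by
  refine Halts.seq (P := Colored s₀ n) (Halts.loop (N := n) (B := colorBody.cost)
    (e := .lt (var 6) (.read 0 (.lit 0))) (Colored s₀) (fun i s hi h => ?_) (fun i s hi h => ?_) ?_)
    fun s₁ hs₁ => ?_
  · have e : s 0 0 = n := by rw [h.2.1 _ _ (by omega) (by omega), h0n]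
    simp only [eval_lt, bit_eq_zero, var, eval_read, eval_lit, h.1, e]
    omega
  · exact Program.LoopFree.halts (by simp [colorBody, addTo, assign, Program.LoopFree])
      (colored_succ h)
  · exact ⟨h2 _ _ (by omega), fun _ _ _ _ => rfl, fun v => by
      rw [h2 _ _ le_rfl, eq_comm, bit_eq_zero]; simp⟩
  obtain ⟨_, hf, hc⟩ := hs₁
  refine Halts.seq (P := fun s => Represents n k M E (run H 0) s ∧ s 6 0 = 0)
    (Program.LoopFree.halts ?_ ?_) fun s₂ hs₂ => ?_
  · simp [assign, Program.LoopFree]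
  · have hrow : s₁ 1 = E := by rw [← h1]; funext j; exact hf _ _ (by omega) (by omega)
    have hrow' : ∀ (t : Memory) a i x b, b ≠ a → t.set a i x b = t b := by
      intro t a i x b hb; funext j; rw [Memory.set_apply, if_neg (by omega)]
    refine ⟨⟨?_, ?_, ?_, ?_, fun v hv => ?_, ?_, ?_, ?_⟩, ?_⟩
    on_goal 5 =>
      simp only [assign, Program.result, Memory.set_apply]
      rw [if_neg (by omega), if_neg (by omega), hc]
      simp [hv, run, State.init]
    all_goals simp [assign, Program.result, eval_lit, Memory.set_apply, hrow', hf, h0n, h0k, h0M, hrow,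
      h2, run, State.init, bit]
  obtain ⟨t, s, hs, ht, hI⟩ := Halts.loop (N := n) (e := .lt (var 6) (.read 0 (.lit 0)))
    (p := .seq scanBody (addTo 6 (.lit 1)))
    (fun i s => Represents n k M E (run H i) s ∧ s 6 0 = i)
    (fun i s hi h => by
      simp only [eval_lt, bit_eq_zero, var, eval_read, eval_lit, h.1.1, h.2]
      omega)
    (fun i s hi h => (halts_scanBody hE h.1).seq fun s' hs' =>
      Program.LoopFree.halts (Q := fun s => Represents n k M E (run H (i + 1)) s ∧ s 6 0 = i + 1)
        (by simp [addTo, assign, Program.LoopFree]) (by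
        have hrow' : ∀ (t : Memory) a i x b, b ≠ a → t.set a i x b = t b := by
          intro t a i x b hb; funext j; rw [Memory.set_apply, if_neg (by omega)]
        obtain ⟨⟨g1, g2, g3, g4, g5, g6, g7, g8⟩, g9⟩ := hs'
        refine ⟨⟨?_, ?_, ?_, ?_, fun v hv => ?_, ?_, ?_, ?_⟩, ?_⟩
        on_goal 5 => rw [run, ← g5 v hv]
        all_goals simp [addTo, assign, Program.result, eval_lit, eval_add, eval_read, var,
          Memory.set_apply, hrow', g1, g2, g3, g4, g6, g7, g8, g9, h.2, run])) hs₂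
  exact ⟨t, s, hs, ht, hI.1.2.2.2.2.1⟩

/-- The running time is at most quadratic in the size of the input. -/
theorem timeBound_le {n k M : ℕ} (hM : M ≤ k * M + 1) :
    timeBound n k M ≤ 1000 * (n + k * M + 1) ^ 2 := by
  simp only [timeBound, colorBody, scanInit, edgeInit, vertexBody, edgeFinish, scanFinish, objections,
    double, addTo, assign, var, currentVertex, currentMatches, Program.cost, Expr.size]
  nlinarith [Nat.zero_le (n * (k * M)), Nat.mul_le_mul_left n hM, Nat.zero_le (n * n),
    Nat.zero_le ((k * M) * (k * M))]

/-! ### Lists of edges as inputs -/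

theorem getD_flatten {α : Type*} {k : ℕ} (d : α) (L : List (List α)) (hL : ∀ l ∈ L, l.length = k)
    {i j : ℕ} (hi : i < L.length) (hj : j < k) :
    L.flatten.getD (i * k + j) d = (L.getD i []).getD j d := by
  induction L generalizing i with
  | nil => simp at hi
  | cons l L ih =>
    have hl : l.length = k := hL l (by simp)
    cases i with
    | zero =>
      rw [List.flatten_cons, zero_mul, zero_add, List.getD_append _ _ _ _ (by omega)]
      rfl
    | succ i =>
      rw [List.flatten_cons, List.getD_append_right _ _ _ _ (by rw [hl, add_mul]; omega), hl,
        show (i + 1) * k + j - k = i * k + j by rw [add_mul]; omega,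
        ih (fun l hl => hL l (by simp [hl])) (by simpa using hi)]
      rfl

theorem lists_inputMemory {n k : ℕ} {H : Hypergraph n} (hH : ∀ e ∈ H, e.card = k)
    {L : List (List (Fin n))} (hL : IsListing H L) :
    Lists k L.length (inputMemory n k L 1) H ∧ L.length = H.card := by
  obtain ⟨h1, h2, h3⟩ := hL
  have hlen : ∀ l ∈ L, l.length = k := by
    intro l hl
    rw [← List.toFinset_card_of_nodup (h1 l hl)]
    refine hH _ ?_
    rw [← h3, List.mem_toFinset]
    exact List.mem_map_of_mem hl
  refine ⟨⟨fun i => (L.getD i []).toFinset, ?_, fun i hi => ?_⟩, ?_⟩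
  · ext e
    rw [← h3]
    simp only [List.mem_toFinset, List.mem_map, Finset.mem_image, Finset.mem_range]
    constructor
    · rintro ⟨l, hl, rfl⟩
      obtain ⟨i, hi, rfl⟩ := List.mem_iff_getElem.1 hl
      exact ⟨i, hi, by rw [List.getD_eq_getElem _ _ hi]⟩
    · rintro ⟨i, hi, rfl⟩
      exact ⟨L[i], List.getElem_mem hi, by rw [List.getD_eq_getElem _ _ hi]⟩
  · have hE : ∀ j < k, ∃ hj : j < (L[i]).length,
        inputMemory n k L 1 (i * k + j) = ((L[i])[j] : ℕ) := by
      intro j hj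
      have hl := hlen _ (List.getElem_mem hi)
      refine ⟨by omega, ?_⟩
      simp only [inputMemory, one_ne_zero, if_false, if_true]
      rw [List.map_flatten, getD_flatten (k := k) 0 _ (by simpa using hlen) (by simpa using hi) hj,
        show (L.map (List.map Fin.val)).getD i [] = (L[i]).map Fin.val by
          simp [List.getD_eq_getElem?_getD, hi],
        List.getD_eq_getElem _ _ (by rw [List.length_map]; omega), List.getElem_map]
    dsimp only
    rw [List.getD_eq_getElem _ _ hi]
    have hl := hlen _ (List.getElem_mem hi)
    refine ⟨fun v => ?_, fun j hj => ?_⟩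
    · rw [List.mem_toFinset, List.mem_iff_getElem]
      constructor
      · rintro ⟨j, hj, rfl⟩
        exact ⟨j, by omega, (hE j (by omega)).2⟩
      · rintro ⟨j, hj, h⟩
        obtain ⟨hj', h'⟩ := hE j hj
        exact ⟨j, hj', Fin.ext (h'.symm.trans h)⟩
    · obtain ⟨hj', h'⟩ := hE j hj
      rw [h']; exact Fin.is_lt _
  · rw [← h3, List.toFinset_card_of_nodup h2, List.length_map]

theorem exec_scanProgram {n k : ℕ} {H : Hypergraph n} (hH : ∀ e ∈ H, e.card = k)
    {L : List (List (Fin n))} (hL : IsListing H L) :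
    ∃ t s, Exec scanProgram (inputMemory n k L) t s ∧ t ≤ 1000 * (n + k * H.card + 1) ^ 2 ∧
      outputColoring n s = (run H n).coloring n := by
  obtain ⟨hE, hlen⟩ := lists_inputMemory hH hL
  obtain ⟨t, s, h1, h2, h3⟩ := halts_scanProgram hE (s₀ := inputMemory n k L) (by simp [inputMemory])
    (by simp [inputMemory]) (by simp [inputMemory]) rfl (fun a j ha => by
      simp only [inputMemory]; rw [if_neg (by omega), if_neg (by omega)])
  refine ⟨t, s, h1, h2.trans ?_, ?_⟩
  · rw [← hlen]
    refine timeBound_le ?_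
    -- For `k = 0` the list contributes nothing to `k * M`, but then the empty set is the only
    -- possible edge.
    rcases Nat.eq_zero_or_pos k with rfl | hk
    · rw [hlen, zero_mul, zero_add, Finset.card_le_one]
      intro a ha b hb
      rw [Finset.card_eq_zero.1 (hH a ha), Finset.card_eq_zero.1 (hH b hb)]
    · nlinarith
  · funext v
    have := h3 v v.2
    simp only [outputColoring, State.coloring, this, ne_eq, bit_eq_zero, not_not]
    simp

theorem polyTime_scanProgram : PolyTime scanProgram :=
  ⟨1000, 2, fun _ _ _ hH _ hL =>
    let ⟨t, s, h1, h2, _⟩ := exec_scanProgram hH hL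
    ⟨t, s, h1, h2⟩⟩

theorem findsProperColoring_scanProgram {n k : ℕ} (hn : Even n) {H : Hypergraph n}
    (hH : ∀ e ∈ H, e.card = k) (hp : Proper H ((run H n).coloring n)) :
    FindsProperColoring scanProgram k (fun v : Fin n => parity v) H := by
  intro L hL
  obtain ⟨t, s, h1, _, h3⟩ := exec_scanProgram hH hL
  exact ⟨t, s, h1, h3 ▸ hp, h3 ▸ greedyReaches_run hn H n⟩

/-! ### Estimates for binomial coefficients -/

theorem descFactorial_mul_pow_le {w h : ℕ} (hwh : w ≤ h) (j : ℕ) :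
    w.descFactorial j * h ^ j ≤ w ^ j * h.descFactorial j := by
  induction j with
  | zero => simp
  | succ j ih =>
    rw [Nat.descFactorial_succ, Nat.descFactorial_succ, pow_succ, pow_succ]
    have h1 : (w - j) * h ≤ w * (h - j) := by
      rw [Nat.sub_mul, Nat.mul_sub]
      have : w * j ≤ j * h := by rw [mul_comm]; exact Nat.mul_le_mul_left _ hwh
      omega
    calc (w - j) * w.descFactorial j * (h ^ j * h)
        = ((w - j) * h) * (w.descFactorial j * h ^ j) := by ring
      _ ≤ (w * (h - j)) * (w ^ j * h.descFactorial j) := Nat.mul_le_mul h1 ih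
      _ = _ := by ring

theorem choose_mul_pow_le {w h : ℕ} (hwh : w ≤ h) (j : ℕ) :
    w.choose j * h ^ j ≤ w ^ j * h.choose j := by
  have h1 := descFactorial_mul_pow_le hwh j
  rw [Nat.descFactorial_eq_factorial_mul_choose, Nat.descFactorial_eq_factorial_mul_choose] at h1
  refine Nat.le_of_mul_le_mul_left ?_ j.factorial_pos
  calc j.factorial * (w.choose j * h ^ j) = j.factorial * w.choose j * h ^ j := by ring
    _ ≤ _ := h1
    _ = _ := by ring

theorem choose_le_mul_choose {w h : ℕ} (hwh : w ≤ h) (hh : 0 < h) {c : ℝ} (hc : (w : ℝ) ≤ c * h)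
    (j : ℕ) : (w.choose j : ℝ) ≤ c ^ j * h.choose j := by
  have h1 : (w.choose j : ℝ) * (h : ℝ) ^ j ≤ (w : ℝ) ^ j * h.choose j := by
    exact_mod_cast choose_mul_pow_le hwh j
  have h2 : (w : ℝ) ^ j ≤ (c * h) ^ j := pow_le_pow_left₀ (Nat.cast_nonneg _) hc j
  have h3 : (0 : ℝ) < (h : ℝ) ^ j := by positivity
  refine le_of_mul_le_mul_right ?_ h3
  calc (w.choose j : ℝ) * (h : ℝ) ^ j ≤ (w : ℝ) ^ j * h.choose j := h1
    _ ≤ (c * h) ^ j * h.choose j := by gcongr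
    _ = _ := by rw [mul_pow]; ring

theorem choose_le_choose_of_le {h i j : ℕ} (hij : i ≤ j) (hj : 2 * j ≤ h) :
    h.choose i ≤ h.choose j := by
  induction j, hij using Nat.le_induction with
  | base => exact le_rfl
  | succ j _ ih =>
    exact (ih (by omega)).trans (Nat.choose_le_succ_of_lt_half_left (by omega))

theorem pow_two_le_choose {h k : ℕ} (hk : 2 * k ≤ h) : 2 ^ k ≤ h.choose k := by
  have h1 : 2 ^ k * 1 ^ k ≤ (2 * k).choose k := by
    rcases Nat.eq_zero_or_pos k with rfl | hk0
    · simp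
    have := choose_mul_pow_le (w := k) (h := 2 * k) (by omega) k
    rw [Nat.choose_self, one_mul, mul_pow, mul_comm (k ^ k)] at this
    have h2 : 2 ^ k ≤ (2 * k).choose k := by
      refine Nat.le_of_mul_le_mul_right ?_ (pow_pos hk0 k)
      exact this
    simpa using h2
  rw [one_pow, mul_one] at h1
  exact h1.trans (Nat.choose_le_choose k hk)

/-- The quotient of the two binomials is a product of factors `1 - q / (M - j)`, each at least `1 -
q₀ / B`, since `B ≤ M - j` for all `j < m`. -/
theorem pow_mul_choose_le {q₀ m : ℕ} {B : ℝ} (hB : 0 < B) (hqB : (q₀ : ℝ) ≤ B) {M q m' : ℕ}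
    (hq : q ≤ q₀) (hM : B + m ≤ M) (hm : m' ≤ m) :
    (1 - q₀ / B) ^ m * (M.choose m' : ℝ) ≤ ((M - q).choose m' : ℝ) := by
  have hρ0 : 0 ≤ 1 - q₀ / B := by
    rw [sub_nonneg, div_le_one hB]; exact hqB
  have hρ1 : 1 - q₀ / B ≤ 1 := by
    have : 0 ≤ (q₀ : ℝ) / B := by positivity
    linarith
  suffices h : (1 - q₀ / B) ^ m' * (M.choose m' : ℝ) ≤ ((M - q).choose m' : ℝ) by
    refine le_trans ?_ h
    gcongr ?_ * _
    exact pow_le_pow_of_le_one hρ0 hρ1 hm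
  induction m' with
  | zero => simp
  | succ j ih =>
    have ih := ih (by omega)
    have hj : (j : ℝ) + 1 ≤ m := by exact_mod_cast hm
    have hqr : (q : ℝ) ≤ q₀ := by exact_mod_cast hq
    have hjM : j + q ≤ M := by
      have : (j : ℝ) + q ≤ M := by linarith
      exact_mod_cast this
    have e1 : (M.choose (j + 1) : ℝ) * (j + 1) = M.choose j * (M - j) := by
      have := Nat.choose_succ_right_eq M j
      rw [← Nat.cast_sub (show j ≤ M by omega)]
      exact_mod_cast this
    have e2 : ((M - q).choose (j + 1) : ℝ) * (j + 1) = (M - q).choose j * (M - q - j) := by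
      have := Nat.choose_succ_right_eq (M - q) j
      rw [← Nat.cast_sub (show q ≤ M by omega), ← Nat.cast_sub (show j ≤ M - q by omega)]
      exact_mod_cast this
    have h1 : (1 - q₀ / B) * ((M : ℝ) - j) ≤ (M : ℝ) - q - j := by
      have h2 : B ≤ (M : ℝ) - j := by linarith
      have h3 : (q₀ : ℝ) ≤ q₀ / B * ((M : ℝ) - j) := by
        rw [div_mul_eq_mul_div, le_div_iff₀ hB]
        exact mul_le_mul_of_nonneg_left h2 (Nat.cast_nonneg _)
      linarith
    have h0 : (0 : ℝ) ≤ (M : ℝ) - j := by linarith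
    refine le_of_mul_le_mul_right ?_ (show (0 : ℝ) < j + 1 by positivity)
    calc (1 - q₀ / B) ^ (j + 1) * (M.choose (j + 1) : ℝ) * (j + 1)
        = ((1 - q₀ / B) ^ j * M.choose j) * ((1 - q₀ / B) * ((M : ℝ) - j)) := by
          rw [mul_assoc, e1]; ring
      _ ≤ ((M - q).choose j : ℝ) * ((M : ℝ) - q - j) :=
          mul_le_mul ih h1 (mul_nonneg hρ0 h0) (Nat.cast_nonneg _)
      _ = _ := e2.symm

/-! ### Sets with few vertices outside a given set -/

/-- Such a set is the union of `k - r` elements of `Z` and `r` arbitrary ones. -/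
theorem card_mostly_inside_le {α : Type*} [DecidableEq α] (S Z : Finset α) {k r : ℕ} (hr : r ≤ k) :
    ((S.powersetCard k).filter fun e => k ≤ (e ∩ Z).card + r).card ≤
      Z.card.choose (k - r) * S.card ^ r := by
  have h : ((S.powersetCard k).filter fun e => k ≤ (e ∩ Z).card + r) ⊆
      ((Z.powersetCard (k - r)) ×ˢ (S.powersetCard r)).image fun p => p.1 ∪ p.2 := by
    intro e he
    obtain ⟨h1, h2⟩ := Finset.mem_filter.1 he
    obtain ⟨h3, h4⟩ := Finset.mem_powersetCard.1 h1
    obtain ⟨A, hA, hAc⟩ := Finset.exists_subset_card_eq (s := e ∩ Z) (n := k - r) (by omega)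
    have hAe : A ⊆ e := hA.trans Finset.inter_subset_left
    refine Finset.mem_image.2 ⟨(A, e \ A), ?_, Finset.union_sdiff_of_subset hAe⟩
    simp only [Finset.mem_product, Finset.mem_powersetCard]
    refine ⟨⟨hA.trans Finset.inter_subset_right, hAc⟩, Finset.sdiff_subset.trans h3, ?_⟩
    rw [Finset.card_sdiff_of_subset hAe]; omega
  refine (Finset.card_le_card h).trans (Finset.card_image_le.trans ?_)
  rw [Finset.card_product, Finset.card_powersetCard, Finset.card_powersetCard]
  exact Nat.mul_le_mul_left _ (Nat.choose_le_pow _ _)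

theorem card_clusteredSets_le {n k : ℕ} (hk : 2 ≤ k) :
    (clusteredSets n k).card ≤ (2 * ((n + 7) / 8)).choose (k - 2) * n ^ 2 := by
  classical
  have hW : (Finset.univ.filter fun v : Fin n => 8 * ((v : ℕ) / 2) < n).card ≤ 2 * ((n + 7) / 8) := by
    rw [← Finset.card_range (2 * ((n + 7) / 8))]
    refine Finset.card_le_card_of_injOn Fin.val (fun v hv => ?_) Fin.val_injective.injOn
    have := (Finset.mem_filter.1 (Finset.mem_coe.1 hv)).2
    simp only [Finset.coe_range, Set.mem_Iio]
    omega
  have h := card_mostly_inside_le (Finset.univ : Finset (Fin n))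
    (Finset.univ.filter fun v : Fin n => 8 * ((v : ℕ) / 2) < n) hk
  rw [Finset.card_univ, Fintype.card_fin] at h
  refine le_trans (Finset.card_le_card fun e he => ?_)
    (h.trans (Nat.mul_le_mul_right _ (Nat.choose_le_choose _ hW)))
  rw [clusteredSets, Finset.mem_filter] at he
  refine Finset.mem_filter.2 ⟨he.1, ?_⟩
  have h1 := he.2
  rw [Spread, (Finset.mem_powersetCard.1 he.1).2, not_lt] at h1
  have h2 : e ∩ (Finset.univ.filter fun v : Fin n => 8 * ((v : ℕ) / 2) < n) =
      e.filter fun v : Fin n => 8 * ((v : ℕ) / 2) < n := by ext; simp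
  rwa [h2]

theorem card_thinSets_le {n k r : ℕ} (hn : Even n) (hr : r ≤ k) :
    (thinSets n k r).card ≤ 2 * ((n / 2 - (n + 15) / 16).choose (k - r) * (n / 2) ^ r) := by
  classical
  have hZ : ∀ b, (Finset.univ.filter fun v : Fin n => parity v = b ∧ n ≤ 16 * ((v : ℕ) / 2)).card ≤
      n / 2 - (n + 15) / 16 := by
    intro b
    rw [← Nat.card_Ico]
    refine Finset.card_le_card_of_injOn (fun v => (v : ℕ) / 2) (fun v hv => ?_) fun v hv w hw hvw => ?_
    · have := (Finset.mem_filter.1 (Finset.mem_coe.1 hv)).2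
      have := v.2
      obtain ⟨N, rfl⟩ := hn
      simp only [Finset.coe_Ico, Set.mem_Ico]
      omega
    · have h1 := (Finset.mem_filter.1 (Finset.mem_coe.1 hv)).2.1
      have h2 := (Finset.mem_filter.1 (Finset.mem_coe.1 hw)).2.1
      simp only at hvw
      refine Fin.ext ?_
      rw [← vert_parity v, ← vert_parity w, h1, h2, hvw]
  have hsub : thinSets n k r ⊆ (Finset.univ : Finset Bool).biUnion fun b =>
      ((Finset.univ.filter fun v : Fin n => parity v = b).powersetCard k).filter fun e =>
        k ≤ (e ∩ Finset.univ.filter fun v : Fin n => parity v = b ∧ n ≤ 16 * ((v : ℕ) / 2)).card + r := by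
    intro f hf
    obtain ⟨h1, h2⟩ := Finset.mem_filter.1 hf
    obtain ⟨hk, b, hb⟩ := mem_monoSets.1 h1
    refine Finset.mem_biUnion.2 ⟨b, Finset.mem_univ _, Finset.mem_filter.2
      ⟨Finset.mem_powersetCard.2 ⟨fun v hv => Finset.mem_filter.2 ⟨Finset.mem_univ _, hb v hv⟩, hk⟩, ?_⟩⟩
    have h3 := Finset.card_filter_add_card_filter_not (s := f) (fun v : Fin n => 16 * ((v : ℕ) / 2) < n)
    have h4 : (f.filter fun v : Fin n => 16 * ((v : ℕ) / 2) < n).card ≤ (core f).card := by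
      refine Finset.card_le_card_of_injOn Fin.val (fun v hv => ?_) Fin.val_injective.injOn
      obtain ⟨h5, h6⟩ := Finset.mem_filter.1 (Finset.mem_coe.1 hv)
      exact Finset.mem_coe.2 (mem_core.2 ⟨⟨v, h5, rfl⟩, h6⟩)
    have h5 : (f.filter fun v : Fin n => ¬ 16 * ((v : ℕ) / 2) < n) ⊆
        f ∩ Finset.univ.filter fun v : Fin n => parity v = b ∧ n ≤ 16 * ((v : ℕ) / 2) := by
      intro v hv
      obtain ⟨h6, h7⟩ := Finset.mem_filter.1 hv
      exact Finset.mem_inter.2 ⟨h6, Finset.mem_filter.2 ⟨Finset.mem_univ _, hb v h6, not_lt.1 h7⟩⟩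
    have := Finset.card_le_card h5
    omega
  refine (Finset.card_le_card hsub).trans (Finset.card_biUnion_le.trans ?_)
  refine (Finset.sum_le_card_nsmul _ _ ((n / 2 - (n + 15) / 16).choose (k - r) * (n / 2) ^ r)
    fun b _ => ?_).trans (by simp)
  refine (card_mostly_inside_le _ _ hr).trans ?_
  rw [(equitable_parity hn).card_color b]
  exact Nat.mul_le_mul_right _ (Nat.choose_le_choose _ (hZ b))

theorem le_card_filler {n : ℕ} (hn : Even n) (h128 : 128 ≤ n) (b : Bool) :
    n / 32 + n / 64 ≤ (filler n b).card := by
  -- There are about `n / 16` filler positions: `n / 64` of them are allotted to exceptional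
  -- vertices and `n / 32` to tests.
  have h : n / 32 + n / 64 ≤ (Finset.Ico ((n + 15) / 16) ((n + 7) / 8)).card := by
    rw [Nat.card_Ico]; omega
  refine h.trans (Finset.card_le_card_of_injOn (vert b) (fun y hy => ?_) fun y _ y' _ h => (vert_inj.1 h).2)
  obtain ⟨h1, h2⟩ := Finset.mem_Ico.1 (Finset.mem_coe.1 hy)
  have h3 := vert_lt hn (b := b) (y := y) (by omega)
  simp only [filler, Finset.coe_filter, Finset.mem_range, Set.mem_ofPred_eq, parity_vert, vert_div_two]
  exact ⟨h3, trivial, by omega, by omega⟩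

theorem prod_sub_eq_descFactorial (h k : ℕ) :
    ∏ j ∈ Finset.range k, ((h : ℝ) - j) = h.descFactorial k := by
  induction k with
  | zero => simp
  | succ k ih =>
    rw [Finset.prod_range_succ, ih, Nat.descFactorial_succ]
    rcases le_or_gt k h with hk | hk
    · push_cast [Nat.cast_sub hk]; ring
    · rw [Nat.descFactorial_eq_zero_iff_lt.2 hk]; simp

theorem phi_eq {n : ℕ} (hn : Even n) (k : ℕ) :
    phi n k = 2 ^ k * ((n / 2).choose k / n.choose k) := by
  have h2 : (n : ℝ) / 2 = ((n / 2 : ℕ) : ℝ) := by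
    rw [Nat.cast_div hn.two_dvd (by norm_num)]; norm_num
  rw [phi, h2, prod_sub_eq_descFactorial, prod_sub_eq_descFactorial,
    Nat.descFactorial_eq_factorial_mul_choose, Nat.descFactorial_eq_factorial_mul_choose]
  push_cast
  rw [mul_div_mul_left]
  exact_mod_cast k.factorial_ne_zero

theorem cast_half {n : ℕ} (hn : Even n) : ((n / 2 : ℕ) : ℝ) = n / 2 := by
  rw [Nat.cast_div hn.two_dvd (by norm_num)]; norm_num

open Classical in
/-- The failure probability in terms of the main parameters. -/
theorem card_failure_le_of_expectation {n k m r T : ℕ} {lam γ : ℝ} (hn : Even n) (h128 : 128 ≤ n)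
    (hk2 : 2 ≤ k) (hkn : 4 * k ≤ n) (hr : r ≤ k) (hT : T ≤ n / 64)
    (hlam : (m : ℝ) / n.choose k * (n / 2).choose k ≤ lam) (hγ0 : 0 ≤ γ) (hγ1 : γ < 1)
    (hγ : ∀ q M m', q ≤ (n / 2).choose (k - 1) →
      (spreadSets n k).card ≤ M + (2 * (n / 2).choose k + n * (n / 2).choose (k - 1)) → m' ≤ m →
      γ * M.choose m' ≤ (M - q).choose m') :
    (((kGraphs n k m).filter fun H => ¬ Proper H ((run H n).coloring n)).card : ℝ) ≤
      (lam * n ^ 2 * (3 / 4) ^ (k - 2) + 2 * lam * n ^ r * (7 / 8) ^ (k - r) + 2 * lam / (T + 1) +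
        (n + 1) * (2 * lam) * (1 - γ) ^ r + 2 * (n + 1) ^ (T + 1) * (1 - γ) ^ (n / 32)) *
        (kGraphs n k m).card := by
  have hh := cast_half hn
  set h := n / 2 with hhdef
  have hh0 : 0 < h := by omega
  set p : ℝ := (m : ℝ) / n.choose k with hp
  have hp0 : 0 ≤ p := by positivity
  have hlam0 : 0 ≤ lam := le_trans (by positivity) hlam
  have h1γ : 0 ≤ 1 - γ := by linarith
  have b1 : p * (clusteredSets n k).card ≤ lam * n ^ 2 * (3 / 4) ^ (k - 2) := by
    have e1 : ((clusteredSets n k).card : ℝ) ≤ ((2 * ((n + 7) / 8)).choose (k - 2) : ℝ) * n ^ 2 := by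
      exact_mod_cast card_clusteredSets_le (n := n) hk2
    have e2 : ((2 * ((n + 7) / 8)).choose (k - 2) : ℝ) ≤ (3 / 4) ^ (k - 2) * h.choose (k - 2) := by
      -- The reserved stretches hold about half as many vertices as a color class; `3 / 4` absorbs
      -- the rounding.
      refine choose_le_mul_choose (by omega) hh0 ?_ _
      rw [hh]
      have : (2 * ((n + 7) / 8)) * 8 ≤ 3 * n := by omega
      have : ((2 * ((n + 7) / 8) : ℕ) : ℝ) * 8 ≤ 3 * n := by exact_mod_cast this
      linarith
    have e3 : (h.choose (k - 2) : ℝ) ≤ h.choose k := by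
      exact_mod_cast choose_le_choose_of_le (by omega) (by omega)
    calc p * (clusteredSets n k).card
        ≤ p * ((3 / 4) ^ (k - 2) * h.choose k * n ^ 2) := by
          gcongr
          refine e1.trans ?_
          gcongr
          exact e2.trans (by gcongr)
      _ = (p * h.choose k) * n ^ 2 * (3 / 4) ^ (k - 2) := by ring
      _ ≤ _ := by gcongr
  have b2 : p * (thinSets n k r).card ≤ 2 * lam * n ^ r * (7 / 8) ^ (k - r) := by
    have e1 : ((thinSets n k r).card : ℝ) ≤ 2 * (((h - (n + 15) / 16).choose (k - r) : ℝ) * h ^ r) := by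
      exact_mod_cast card_thinSets_le hn hr
    have e2 : ((h - (n + 15) / 16).choose (k - r) : ℝ) ≤ (7 / 8) ^ (k - r) * h.choose (k - r) := by
      -- The first stretch is at least one eighth of the color class, leaving a proportion of at
      -- most `7 / 8`.
      refine choose_le_mul_choose (by omega) hh0 ?_ _
      have : (h - (n + 15) / 16) * 8 ≤ 7 * h := by omega
      have : ((h - (n + 15) / 16 : ℕ) : ℝ) * 8 ≤ 7 * h := by exact_mod_cast this
      linarith
    have e3 : (h.choose (k - r) : ℝ) ≤ h.choose k := by
      exact_mod_cast choose_le_choose_of_le (by omega) (by omega)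
    have e4 : (h : ℝ) ≤ n := by rw [hh]; linarith [(Nat.cast_nonneg n : (0 : ℝ) ≤ n)]
    calc p * (thinSets n k r).card
        ≤ p * (2 * (((7 / 8) ^ (k - r) * h.choose k) * n ^ r)) := by
          gcongr
          refine e1.trans ?_
          gcongr
          exact e2.trans (by gcongr)
      _ = 2 * (p * h.choose k) * n ^ r * (7 / 8) ^ (k - r) := by ring
      _ ≤ _ := by gcongr
  have b3 : p * (monoSets n k).card ≤ 2 * lam := by
    have e1 : ((monoSets n k).card : ℝ) ≤ 2 * h.choose k := by exact_mod_cast card_monoSets_le hn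
    calc p * (monoSets n k).card ≤ p * (2 * h.choose k) := by gcongr
      _ = 2 * (p * h.choose k) := by ring
      _ ≤ _ := by gcongr
  refine (card_failure_le hn (by omega) hγ0 hγ1 hγ r T (n / 32) fun b =>
    (Nat.add_le_add_left hT _).trans (le_card_filler hn h128 b)).trans ?_
  gcongr

theorem choose_half_le {n j : ℕ} (hn : Even n) (hn0 : 0 < n) :
    ((n / 2).choose j : ℝ) ≤ (1 / 2) ^ j * n.choose j := by
  refine choose_le_mul_choose (by omega) hn0 ?_ j
  rw [cast_half hn]; linarith

set_option maxHeartbeats 1000000 in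
/-- The conditional probability of success of a test. -/
theorem gamma_mul_choose_le {n k m : ℕ} {a η x lam γ : ℝ} (hn : Even n) (hk2 : 2 ≤ k)
    (hkn : 4 * k ≤ n) (h128 : 128 ≤ n)
    (hlam : (m : ℝ) / n.choose k * (n / 2).choose k ≤ lam) (hlamn : lam ≤ n)
    (hη0 : 0 < η) (hη1 : η < 1) (hsmall : 9 * (n : ℝ) ^ 2 / 2 ^ k ≤ η * (1 - η))
    (hlamx : lam = a * (n * x / k)) (hx : 0 ≤ x) (ha : 0 ≤ a) (hkη : (k : ℝ) ≤ η * (n / 2))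
    (hγ : γ ≤ Real.exp (-(2 * a * x / (1 - η) ^ 3))) :
    m < n.choose k ∧ ∀ q M m', q ≤ (n / 2).choose (k - 1) →
      (spreadSets n k).card ≤ M + (2 * (n / 2).choose k + n * (n / 2).choose (k - 1)) → m' ≤ m →
      γ * M.choose m' ≤ (M - q).choose m' := by
  have hh := cast_half hn
  have hn0 : 0 < n := by omega
  obtain ⟨h, hhdef⟩ : ∃ h, h = n / 2 := ⟨_, rfl⟩
  rw [← hhdef] at hh hlam ⊢
  obtain ⟨N, hN⟩ : ∃ N, N = n.choose k := ⟨_, rfl⟩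
  have hNpos : (0 : ℝ) < N := by rw [hN]; exact_mod_cast Nat.choose_pos (by omega)
  obtain ⟨p, hp⟩ : ∃ p : ℝ, p = (m : ℝ) / N := ⟨_, rfl⟩
  rw [← hN, ← hp] at hlam
  have hpm : (m : ℝ) = p * N := by rw [hp]; field_simp
  have hp0 : 0 ≤ p := by rw [hp]; positivity
  have hn1 : (1 : ℝ) ≤ n := by exact_mod_cast hn0
  have h2k : (0 : ℝ) < 2 ^ k := by positivity
  have hk1 : ((1 : ℝ) / 2) ^ (k - 1) = 2 / 2 ^ k := by
    obtain ⟨j, rfl⟩ : ∃ j, k = j + 1 := ⟨k - 1, by omega⟩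
    rw [Nat.add_sub_cancel, pow_succ, div_pow, one_pow]; field_simp
  have hk2' : ((1 : ℝ) / 2) ^ (k - 2) = 4 / 2 ^ k := by
    obtain ⟨j, rfl⟩ : ∃ j, k = j + 2 := ⟨k - 2, by omega⟩
    rw [Nat.add_sub_cancel, pow_succ, pow_succ, div_pow, one_pow]; field_simp; norm_num
  have c0 : (h.choose k : ℝ) ≤ 1 / 2 ^ k * N := by
    have := choose_half_le (j := k) hn hn0
    rw [← hhdef, ← hN, div_pow, one_pow] at this; exact this
  have c1 : (h.choose (k - 1) : ℝ) ≤ 2 / 2 ^ k * N := by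
    have h1 := choose_half_le (j := k - 1) hn hn0
    rw [← hhdef, hk1] at h1
    refine h1.trans ?_
    gcongr
    rw [hN]; exact choose_le_choose_of_le (by omega) (by omega)
  have c2 : (h.choose (k - 2) : ℝ) ≤ 4 / 2 ^ k * N := by
    have h1 := choose_half_le (j := k - 2) hn hn0
    rw [← hhdef, hk2'] at h1
    refine h1.trans ?_
    gcongr
    rw [hN]; exact choose_le_choose_of_le (by omega) (by omega)
  have c3 : ((clusteredSets n k).card : ℝ) ≤ 4 / 2 ^ k * N * n ^ 2 := by
    have e1 : ((clusteredSets n k).card : ℝ) ≤ ((2 * ((n + 7) / 8)).choose (k - 2) : ℝ) * n ^ 2 := by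
      exact_mod_cast card_clusteredSets_le (n := n) hk2
    have e2 : ((2 * ((n + 7) / 8)).choose (k - 2) : ℝ) ≤ h.choose (k - 2) := by
      exact_mod_cast Nat.choose_le_choose _ (by omega)
    refine e1.trans ?_
    gcongr
    exact e2.trans c2
  -- The edge density is tiny: `p * C(n/2, k) ≤ lam ≤ n`, while `C(n/2, k) ≥ 2 ^ k`.
  have c4 : p ≤ n / 2 ^ k := by
    rw [le_div_iff₀ h2k]
    have h2 : (2 : ℝ) ^ k ≤ h.choose k := by exact_mod_cast pow_two_le_choose (by omega)
    calc p * 2 ^ k ≤ p * h.choose k := by gcongr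
      _ ≤ lam := hlam
      _ ≤ n := hlamn
  -- `B` counts what is left of all `k`-sets after discarding clustered sets, everything that may
  -- become known, and `m` more. By `hloss` this discards only a negligible proportion.
  obtain ⟨B, hB⟩ : ∃ B : ℝ, B = N - ((clusteredSets n k).card + (2 * h.choose k +
      n * h.choose (k - 1)) + m) := ⟨_, rfl⟩
  have hloss : ((clusteredSets n k).card : ℝ) + (2 * h.choose k + n * h.choose (k - 1)) + m ≤
      9 * (n : ℝ) ^ 2 / 2 ^ k * N := by
    have hinv : (0 : ℝ) ≤ 1 / 2 ^ k * N := by positivity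
    calc ((clusteredSets n k).card : ℝ) + (2 * h.choose k + n * h.choose (k - 1)) + m
        ≤ 4 / 2 ^ k * N * n ^ 2 + (2 * (1 / 2 ^ k * N) + n * (2 / 2 ^ k * N)) + n / 2 ^ k * N := by
          rw [hpm]; gcongr
      _ = (4 * n ^ 2 + 2 + 2 * n + n) * (1 / 2 ^ k * N) := by ring
      _ ≤ (9 * n ^ 2) * (1 / 2 ^ k * N) := by
          refine mul_le_mul_of_nonneg_right ?_ hinv
          nlinarith
      _ = _ := by ring
  have hηη : η * (1 - η) ≤ η := by nlinarith
  have hBN : (1 - η) * N ≤ B := by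
    rw [hB]
    have := mul_le_mul_of_nonneg_right (hsmall.trans hηη) hNpos.le
    linarith
  have h1η : 0 < 1 - η := by linarith
  have hBpos : 0 < B := lt_of_lt_of_le (by positivity) hBN
  have hqB : (h.choose (k - 1) : ℝ) ≤ η * B := by
    calc (h.choose (k - 1) : ℝ) ≤ 2 / 2 ^ k * N := c1
      _ ≤ 9 * (n : ℝ) ^ 2 / 2 ^ k * N := by
          gcongr
          nlinarith
      _ ≤ η * (1 - η) * N := by gcongr
      _ = η * ((1 - η) * N) := by ring
      _ ≤ η * B := by gcongr
  have hmN : (m : ℝ) ≤ η * N := by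
    have := mul_le_mul_of_nonneg_right (hsmall.trans hηη) hNpos.le
    have h1 : (0 : ℝ) ≤ (clusteredSets n k).card := Nat.cast_nonneg _
    have h2 : (0 : ℝ) ≤ 2 * h.choose k + n * h.choose (k - 1) :=
      add_nonneg (mul_nonneg two_pos.le (Nat.cast_nonneg _))
        (mul_nonneg (Nat.cast_nonneg _) (Nat.cast_nonneg _))
    linarith
  refine ⟨?_, ?_⟩
  · have h1 : η * (N : ℝ) < 1 * N := mul_lt_mul_of_pos_right hη1 hNpos
    rw [one_mul] at h1
    rw [← hN]
    exact Nat.cast_lt.1 (hmN.trans_lt h1)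
  intro q M m' hq hM hm'
  have hM' : B + m ≤ M := by
    have h1 := card_spreadSets_add n k
    have h2 : N ≤ M + (2 * h.choose k + n * h.choose (k - 1)) + (clusteredSets n k).card := by omega
    have h3 : (N : ℝ) ≤ M + (2 * h.choose k + n * h.choose (k - 1)) + (clusteredSets n k).card := by
      exact_mod_cast h2
    rw [hB]; linarith
  have hqB1 : (h.choose (k - 1) : ℝ) ≤ B := hqB.trans (mul_le_of_le_one_left hBpos.le hη1.le)
  refine le_trans ?_ (pow_mul_choose_le hBpos hqB1 hq hM' hm')
  gcongr
  refine hγ.trans ?_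
  obtain ⟨y, hy⟩ : ∃ y : ℝ, y = (h.choose (k - 1) : ℝ) / B := ⟨_, rfl⟩
  rw [← hy]
  have hy0 : 0 ≤ y := by rw [hy]; positivity
  have hyη : y ≤ η := by rw [hy, div_le_iff₀ hBpos]; exact hqB
  have h1y : 0 < 1 - y := by linarith
  have hexp : Real.exp (-(y / (1 - y))) ≤ 1 - y := by
    rw [Real.exp_neg, inv_le_comm₀ (Real.exp_pos _) h1y]
    have := Real.add_one_le_exp (y / (1 - y))
    refine le_trans (le_of_eq ?_) this
    field_simp; ring
  -- Up to corrections, `m * y` is the expected number of edges with a given head. One factor `1 -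
  -- η` each accounts for `n/2 - k + 1` against `n/2`, for `B` against `N`, and for `1 - y`.
  have hkey : m * (y / (1 - y)) ≤ 2 * a * x / (1 - η) ^ 3 := by
    have f1 : (h.choose (k - 1) : ℝ) * (h - k + 1) = h.choose k * k := by
      have := Nat.choose_succ_right_eq h (k - 1)
      rw [Nat.sub_add_cancel (by omega)] at this
      have e : ((h - (k - 1) : ℕ) : ℝ) = h - k + 1 := by
        rw [Nat.cast_sub (by omega), Nat.cast_sub (by omega)]; push_cast; ring
      rw [← e]; exact_mod_cast this.symm
    have f2 : (1 - η) * (n / 2) ≤ (h : ℝ) - k + 1 := by rw [hh]; linarith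
    have hk0 : (0 : ℝ) < k := by exact_mod_cast (by omega : 0 < k)
    have f3 : p * h.choose (k - 1) * ((1 - η) * (n / 2)) ≤ a * n * x := by
      calc p * h.choose (k - 1) * ((1 - η) * (n / 2))
          ≤ p * h.choose (k - 1) * ((h : ℝ) - k + 1) := by gcongr
        _ = p * h.choose k * k := by rw [mul_assoc, f1]; ring
        _ ≤ lam * k := by gcongr
        _ = a * n * x := by rw [hlamx]; field_simp
    have f4 : p * h.choose (k - 1) * (1 - η) ≤ 2 * a * x := by
      have : (0 : ℝ) < n / 2 := by linarith
      refine le_of_mul_le_mul_right ?_ this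
      linarith
    have f5 : (m : ℝ) * y * (1 - η) ^ 2 ≤ 2 * a * x := by
      calc (m : ℝ) * y * (1 - η) ^ 2 = p * h.choose (k - 1) * (1 - η) * ((1 - η) * N / B) := by
            rw [hpm, hy]; ring
        _ ≤ 2 * a * x * 1 := by
            gcongr
            rw [div_le_one hBpos]; exact hBN
        _ = _ := mul_one _
    rw [le_div_iff₀ (by positivity), ← mul_div_assoc, div_mul_eq_mul_div, div_le_iff₀ h1y]
    calc (m : ℝ) * y * (1 - η) ^ 3 = (m * y * (1 - η) ^ 2) * (1 - η) := by ring
      _ ≤ 2 * a * x * (1 - y) := by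
          gcongr
  calc Real.exp (-(2 * a * x / (1 - η) ^ 3)) ≤ Real.exp (m * (-(y / (1 - y)))) := by
        rw [Real.exp_le_exp]; linarith
    _ = Real.exp (-(y / (1 - y))) ^ m := by rw [Real.exp_nat_mul]
    _ ≤ (1 - y) ^ m := by gcongr

/-! ### The error terms -/

theorem pow_le_exp_mul_log {x D L : ℝ} (hx : 0 < x) (hlog : Real.log x ≤ D * L) (j : ℕ) :
    x ^ j ≤ Real.exp (j * (D * L)) := by
  rw [Real.exp_nat_mul]
  refine pow_le_pow_left₀ hx.le ?_ j
  rw [← Real.log_le_iff_le_exp hx]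
  exact hlog

theorem one_sub_pow_le_exp {γ : ℝ} (hγ1 : γ ≤ 1) (j : ℕ) :
    (1 - γ) ^ j ≤ Real.exp (-(γ * j)) := by
  calc (1 - γ) ^ j ≤ Real.exp (-γ) ^ j :=
        pow_le_pow_left₀ (by linarith) (Real.one_sub_le_exp_neg γ) j
    _ = Real.exp (-(γ * j)) := by rw [← Real.exp_nat_mul]; congr 1; ring

/-- Here `n ^ (r + 1)` is `exp(O(k^τ log k))`, which `hbig` makes at most half of the exponential
gain from `(7/8) ^ (k - r)`. -/
theorem thin_error_le {n k r : ℕ} {lam u D L : ℝ} (hn : 0 < n) (hlam : lam ≤ n)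
    (hlog : Real.log n ≤ D * L) (hDL : 0 ≤ D * L) (hr : (r : ℝ) ≤ u + 1) (hrk : r ≤ k)
    (hbig : (u + 2) * (D * L + Real.log (8 / 7)) ≤ Real.log (8 / 7) * k / 2) :
    2 * lam * n ^ r * (7 / 8) ^ (k - r) ≤ 2 * Real.exp (-(Real.log (8 / 7) / 2 * k)) := by
  have hn0 : (0 : ℝ) < n := by exact_mod_cast hn
  have hc : 0 < Real.log (8 / 7) := Real.log_pos (by norm_num)
  have h1 := pow_le_exp_mul_log hn0 hlog (r + 1)
  have h2 : (7 / 8 : ℝ) ^ (k - r) = Real.exp (-(Real.log (8 / 7) * (k - r))) := by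
    rw [← Nat.cast_sub hrk, mul_comm, ← mul_neg, Real.exp_nat_mul, Real.exp_neg,
      Real.exp_log (by norm_num)]
    norm_num
  calc 2 * lam * n ^ r * (7 / 8) ^ (k - r) ≤ 2 * n * n ^ r * (7 / 8) ^ (k - r) := by gcongr
    _ = 2 * (n ^ (r + 1) * (7 / 8) ^ (k - r)) := by ring
    _ ≤ 2 * (Real.exp ((r + 1 : ℕ) * (D * L)) * (7 / 8) ^ (k - r)) := by gcongr
    _ = 2 * Real.exp ((r + 1) * (D * L) - Real.log (8 / 7) * (k - r)) := by
        rw [h2, ← Real.exp_add]; push_cast; ring_nf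
    _ ≤ _ := by
        gcongr
        have h3 : ((r : ℝ) + 1) * (D * L) ≤ (u + 2) * (D * L) :=
          mul_le_mul_of_nonneg_right (by linarith) hDL
        have h4 : Real.log (8 / 7) * r ≤ Real.log (8 / 7) * (u + 2) :=
          mul_le_mul_of_nonneg_left (by linarith) hc.le
        linarith

theorem size_error_le {n k T : ℕ} {lam a u L : ℝ} (hn : 0 < n) (hu : 0 < u) (ha : 0 ≤ a)
    (hL : 0 ≤ L) (hlam : lam = a * (n * L / k)) (hT : n / u ≤ T + 1) :
    2 * lam / (T + 1) ≤ 2 * a * (L * u / k) := by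
  have hn0 : (0 : ℝ) < n := by exact_mod_cast hn
  calc 2 * lam / (T + 1) ≤ 2 * lam / (n / u) := by
        gcongr
        rw [hlam]; positivity
    _ = _ := by rw [hlam]; field_simp

theorem long_error_le {n r : ℕ} {lam γ v D L : ℝ} (hn : 0 < n) (hlam : lam ≤ n) (hγ1 : γ ≤ 1)
    (hlog : Real.log n ≤ D * L) (hr : v ≤ γ * r) (hv : 4 * (D * L) ≤ v) :
    (n + 1) * (2 * lam) * (1 - γ) ^ r ≤ 4 * Real.exp (-(v / 2)) := by
  have hn0 : (0 : ℝ) < n := by exact_mod_cast hn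
  have hn1 : (1 : ℝ) ≤ n := by exact_mod_cast hn
  have h1γ : 0 ≤ 1 - γ := by linarith
  have h1 := pow_le_exp_mul_log hn0 hlog 2
  have h2 := one_sub_pow_le_exp hγ1 r
  calc (n + 1) * (2 * lam) * (1 - γ) ^ r ≤ (n + 1) * (2 * n) * (1 - γ) ^ r := by gcongr
    _ ≤ (n + n) * (2 * n) * (1 - γ) ^ r := by gcongr
    _ = 4 * (n ^ 2 * (1 - γ) ^ r) := by ring
    _ ≤ 4 * (Real.exp ((2 : ℕ) * (D * L)) * Real.exp (-(γ * r))) := by gcongr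
    _ = 4 * Real.exp (2 * (D * L) - γ * r) := by rw [← Real.exp_add]; push_cast; ring_nf
    _ ≤ _ := by gcongr; linarith

/-- The exponent for choosing the exceptional set is at most `2 (n/u) (v/256) = γ n / 128`, half of
the `γ n / 64` gained from the tests. -/
theorem wide_error_le {n T : ℕ} {γ u v D L : ℝ} (hn : 64 ≤ n) (hu : 0 < u) (hγ1 : γ ≤ 1)
    (hγ : γ * u = v) (hDL : 0 ≤ D * L) (hv0 : 0 ≤ v)
    (hlog : Real.log (n + 1) ≤ D * L) (hT : (T : ℝ) + 1 ≤ 2 * (n / u)) (hv : 256 * (D * L) ≤ v) :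
    2 * (n + 1) ^ (T + 1) * (1 - γ) ^ (n / 32) ≤ 2 * Real.exp (-(γ * n / 128)) := by
  have hn0 : (0 : ℝ) < n := by exact_mod_cast (by omega : 0 < n)
  have h1 := pow_le_exp_mul_log (x := (n : ℝ) + 1) (by linarith) hlog (T + 1)
  have h2 := one_sub_pow_le_exp hγ1 (n / 32)
  have h1γ : 0 ≤ 1 - γ := by linarith
  have hγ0 : 0 ≤ γ := by
    by_contra! h
    nlinarith
  have h3 : (n : ℝ) / 64 ≤ (n / 32 : ℕ) := by
    have : n ≤ 64 * (n / 32) := by omega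
    have : (n : ℝ) ≤ 64 * (n / 32 : ℕ) := by exact_mod_cast this
    linarith
  calc 2 * ((n : ℝ) + 1) ^ (T + 1) * (1 - γ) ^ (n / 32)
      ≤ 2 * Real.exp ((T + 1 : ℕ) * (D * L)) * Real.exp (-(γ * (n / 32 : ℕ))) := by gcongr
    _ = 2 * Real.exp ((T + 1) * (D * L) - γ * (n / 32 : ℕ)) := by
        rw [mul_assoc, ← Real.exp_add]; push_cast; ring_nf
    _ ≤ _ := by
        gcongr
        have h4 : ((T : ℝ) + 1) * (D * L) ≤ 2 * (n / u) * (v / 256) := by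
          gcongr; linarith
        have h5 : 2 * (n / u) * (v / 256) = γ * n / 128 := by
          rw [← hγ]; field_simp; ring
        have h6 : γ * (n / 64) ≤ γ * (n / 32 : ℕ) := by gcongr
        linarith

open Classical in
theorem one_sub_le_prob {n k m : ℕ} {ε : ℝ} (hm : m ≤ n.choose k) (E : Hypergraph n → Prop)
    (h : (((kGraphs n k m).filter fun H => ¬ E H).card : ℝ) ≤ ε * (kGraphs n k m).card) :
    1 - ε ≤ prob n k m E := by
  have hpos : (0 : ℝ) < (kGraphs n k m).card := by
    rw [kGraphs, Finset.card_powersetCard, Finset.card_powersetCard, Finset.card_univ,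
      Fintype.card_fin]
    exact_mod_cast Nat.choose_pos hm
  have hadd : (((kGraphs n k m).filter E).card : ℝ) + ((kGraphs n k m).filter fun H => ¬ E H).card =
      (kGraphs n k m).card := by
    exact_mod_cast Finset.card_filter_add_card_filter_not (s := kGraphs n k m) E
  rw [prob, le_div_iff₀ hpos]
  linarith

theorem prob_le_one (n k m : ℕ) (E : Hypergraph n → Prop) : prob n k m E ≤ 1 := by
  classical
  refine div_le_one_of_le₀ ?_ (Nat.cast_nonneg _)
  exact_mod_cast Finset.card_filter_le _ _

/-- An upper bound for the failure probability. -/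
noncomputable def errorBound (a θ τ : ℝ) (D k : ℕ) : ℝ :=
  16 / 9 * ((k : ℝ) ^ (3 * D) * (3 / 4) ^ k) + 2 * Real.exp (-(Real.log (8 / 7) / 2 * k)) +
    2 * a * (Real.log k * (k : ℝ) ^ τ / k) + 4 * Real.exp (-((k : ℝ) ^ (τ - θ) / 2)) +
    2 * Real.exp (-((k : ℝ) ^ (1 - θ) / 128))

theorem eventually_mul_log_le {s : ℝ} (hs : 0 < s) (C : ℝ) :
    ∀ᶠ k : ℕ in atTop, C * Real.log k ≤ (k : ℝ) ^ s := by
  have h1 := ((isLittleO_log_rpow_atTop hs).const_mul_left C).comp_tendsto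
    tendsto_natCast_atTop_atTop
  filter_upwards [h1.bound one_pos] with k hk
  simp only [Function.comp_apply, one_mul] at hk
  exact (le_abs_self _).trans (hk.trans (by rw [Real.norm_of_nonneg (by positivity)]))

theorem tendsto_exp_neg_mul_rpow {c s : ℝ} (hc : 0 < c) (hs : 0 < s) :
    Tendsto (fun k : ℕ => Real.exp (-(c * (k : ℝ) ^ s))) atTop (𝓝 0) := by
  refine Real.tendsto_exp_neg_atTop_nhds_zero.comp ?_
  exact ((tendsto_rpow_atTop hs).comp tendsto_natCast_atTop_atTop).const_mul_atTop hc

theorem tendsto_errorBound (a : ℝ) {θ τ : ℝ} (hθτ : θ < τ) (hτ : τ < 1) (D : ℕ) :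
    Tendsto (errorBound a θ τ D) atTop (𝓝 0) := by
  have h1 : Tendsto (fun k : ℕ => (k : ℝ) ^ (3 * D) * (3 / 4 : ℝ) ^ k) atTop (𝓝 0) :=
    tendsto_pow_const_mul_const_pow_of_abs_lt_one _ (by rw [abs_of_pos] <;> norm_num)
  have h2 := tendsto_exp_neg_mul_rpow (c := Real.log (8 / 7) / 2)
    (half_pos (Real.log_pos (by norm_num))) one_pos
  have h3 : Tendsto (fun k : ℕ => Real.log k * (k : ℝ) ^ τ / k) atTop (𝓝 0) := by
    have h := ((isLittleO_log_rpow_atTop (sub_pos.2 hτ)).tendsto_div_nhds_zero).comp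
      tendsto_natCast_atTop_atTop
    refine h.congr' ?_
    filter_upwards [eventually_gt_atTop 0] with k hk
    have hk0 : (0 : ℝ) < k := by exact_mod_cast hk
    simp only [Function.comp_apply]
    rw [Real.rpow_sub hk0, Real.rpow_one]
    have := Real.rpow_pos_of_pos hk0 τ
    field_simp
  have h4 := tendsto_exp_neg_mul_rpow (c := 1 / 2) (by norm_num) (sub_pos.2 hθτ)
  have h5 := tendsto_exp_neg_mul_rpow (c := 1 / 128) (by norm_num) (sub_pos.2 (hθτ.trans hτ))
  have h := ((((h1.const_mul (16 / 9)).add (h2.const_mul 2)).add (h3.const_mul (2 * a))).add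
    (h4.const_mul 4)).add (h5.const_mul 2)
  simp only [mul_zero, add_zero] at h
  refine h.congr fun k => ?_
  simp only [errorBound, Real.rpow_one]
  ring_nf

/-- The factor `φ` cancels against `C(n/2, k) / C(n, k)`. The left side is half the expected number
of monochromatic edges. -/
theorem card_div_choose_mul_choose_le {n k m : ℕ} {α x : ℝ} (hn : Even n) (hk : 1 ≤ k)
    (hkn : 2 * k ≤ n) (hm : (m : ℝ) ≤ 2 * α * x * (phi n k)⁻¹ * 2 ^ (k - 1)) :
    (m : ℝ) / n.choose k * (n / 2).choose k ≤ α * x := by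
  have h1 : (0 : ℝ) < n.choose k := by exact_mod_cast Nat.choose_pos (by omega)
  have h2 : (0 : ℝ) < (n / 2).choose k := by exact_mod_cast Nat.choose_pos (by omega)
  obtain ⟨j, rfl⟩ : ∃ j, k = j + 1 := ⟨k - 1, by omega⟩
  rw [phi_eq hn, Nat.add_sub_cancel] at hm
  rw [div_mul_eq_mul_div, div_le_iff₀ h1, ← le_div_iff₀ h2]
  refine hm.trans (le_of_eq ?_)
  rw [pow_succ]
  field_simp

/-- The parameters are `u = k^τ`, `γ = k^(-θ)`, core threshold `r = ⌈u⌉` and at most `T = ⌊n / u⌋`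
monochromatic edges. Then `γ u = k^(τ-θ)` outgrows `log k`, and the five error terms match those of
`errorBound`. -/
theorem one_sub_errorBound_le_prob {n k m D : ℕ} {α a θ τ η : ℝ} (hn : Even n) (ha : 0 ≤ a)
    (hαa : α ≤ a) (hθ : 0 < θ) (hη0 : 0 < η) (hη1 : η < 1)
    (hηθ : 2 * a ≤ θ * (1 - η) ^ 3) (hk2 : 2 ≤ k) (h128 : 128 ≤ n) (hkn : 4 * k ≤ n)
    (hkη : (k : ℝ) ≤ η * (n / 2)) (hnD : (n : ℝ) ≤ (k : ℝ) ^ D)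
    (hsmall : 9 * ((k : ℝ) ^ D) ^ 2 / 2 ^ k ≤ η * (1 - η)) (hlogk : a * Real.log k ≤ k)
    (hv : 256 * ((D + 1) * Real.log k) ≤ (k : ℝ) ^ (τ - θ)) (h64 : 64 ≤ (k : ℝ) ^ τ)
    (hrk : (k : ℝ) ^ τ ≤ k)
    (hbig : ((k : ℝ) ^ τ + 2) * ((D + 1) * Real.log k + Real.log (8 / 7)) ≤
      Real.log (8 / 7) * k / 2)
    (hm : (m : ℝ) ≤ 2 * α * (n * Real.log k / k) * (phi n k)⁻¹ * 2 ^ (k - 1)) :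
    1 - errorBound a θ τ D k ≤
      prob n k m (FindsProperColoring scanProgram k (fun v : Fin n => parity v)) := by
  classical
  have hk0 : (0 : ℝ) < k := by exact_mod_cast (by omega : 0 < k)
  have hk1 : (1 : ℝ) < k := by exact_mod_cast (by omega : 1 < k)
  have hn0 : (0 : ℝ) < n := by exact_mod_cast (by omega : 0 < n)
  have hnk : (k : ℝ) ≤ n := by exact_mod_cast (by omega : k ≤ n)
  obtain ⟨L, hL⟩ : ∃ L, L = Real.log k := ⟨_, rfl⟩
  have hL0 : 0 ≤ L := hL ▸ Real.log_nonneg hk1.le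
  obtain ⟨u, hu⟩ : ∃ u, u = (k : ℝ) ^ τ := ⟨_, rfl⟩
  obtain ⟨γ, hγ⟩ : ∃ γ, γ = (k : ℝ) ^ (-θ) := ⟨_, rfl⟩
  obtain ⟨lam, hlamdef⟩ : ∃ lam, lam = a * (n * L / k) := ⟨_, rfl⟩
  rw [← hL] at hlogk hv hbig hm
  rw [← hu] at h64 hrk hbig
  have hu0 : 0 < u := by linarith
  have hγ0 : 0 ≤ γ := hγ ▸ (Real.rpow_pos_of_pos hk0 _).le
  have hγ1 : γ < 1 := hγ ▸ Real.rpow_lt_one_of_one_lt_of_neg hk1 (neg_lt_zero.2 hθ)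
  have hγu : γ * u = (k : ℝ) ^ (τ - θ) := by
    rw [hγ, hu, ← Real.rpow_add hk0]; congr 1; ring
  have hγk : γ * k = (k : ℝ) ^ (1 - θ) := by
    rw [hγ, sub_eq_neg_add, Real.rpow_add hk0, Real.rpow_one]
  have hlam : (m : ℝ) / n.choose k * (n / 2).choose k ≤ lam := by
    refine (card_div_choose_mul_choose_le hn (by omega) (by omega) hm).trans ?_
    rw [hlamdef]; gcongr
  have hlamn : lam ≤ n := by
    rw [hlamdef, ← mul_div_assoc, div_le_iff₀ hk0]
    calc a * (n * L) = n * (a * L) := by ring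
      _ ≤ n * k := by gcongr
  have hexp : γ ≤ Real.exp (-(2 * a * L / (1 - η) ^ 3)) := by
    rw [hγ, Real.rpow_def_of_pos hk0, ← hL, Real.exp_le_exp]
    have h1 : 0 < (1 - η) ^ 3 := pow_pos (by linarith) 3
    have h2 : 2 * a * L / (1 - η) ^ 3 ≤ θ * L := by
      rw [div_le_iff₀ h1]
      calc 2 * a * L ≤ θ * (1 - η) ^ 3 * L := by gcongr
        _ = _ := by ring
    linarith
  have hsmall' : 9 * (n : ℝ) ^ 2 / 2 ^ k ≤ η * (1 - η) := by
    refine le_trans ?_ hsmall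
    gcongr
  obtain ⟨hmN, htest⟩ := gamma_mul_choose_le hn hk2 hkn h128 hlam hlamn hη0 hη1 hsmall' hlamdef
    hL0 ha hkη hexp
  have hlog1 : Real.log (n + 1) ≤ (D + 1) * L := by
    have h1 : (n : ℝ) + 1 ≤ (k : ℝ) ^ (D + 1) := by
      have h2 : (2 : ℝ) ≤ k := by exact_mod_cast hk2
      have h3 : (1 : ℝ) ≤ n := by exact_mod_cast (by omega : 1 ≤ n)
      calc (n : ℝ) + 1 ≤ n * 2 := by linarith
        _ ≤ (k : ℝ) ^ D * k := by gcongr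
        _ = _ := (pow_succ _ _).symm
    have h2 := Real.log_le_log (by positivity) h1
    rw [Real.log_pow, ← hL] at h2
    exact_mod_cast h2
  have hlog : Real.log n ≤ (D + 1) * L :=
    (Real.log_le_log hn0 (by linarith)).trans hlog1
  have hDL : 0 ≤ ((D : ℝ) + 1) * L := by positivity
  have hru : u ≤ (⌈u⌉₊ : ℝ) := Nat.le_ceil u
  have hru' : (⌈u⌉₊ : ℝ) ≤ u + 1 := (Nat.ceil_lt_add_one hu0.le).le
  have hrk' : ⌈u⌉₊ ≤ k := Nat.ceil_le.2 hrk
  have hT64 : ⌊(n : ℝ) / u⌋₊ ≤ n / 64 := by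
    have h1 : (n : ℝ) / u ≤ n / (64 : ℕ) := by
      push_cast; gcongr
    exact (Nat.floor_le_floor h1).trans (Nat.floor_div_eq_div n 64).le
  have hT1 : (n : ℝ) / u ≤ (⌊(n : ℝ) / u⌋₊ : ℝ) + 1 := (Nat.lt_floor_add_one _).le
  have hT2 : (⌊(n : ℝ) / u⌋₊ : ℝ) + 1 ≤ 2 * (n / u) := by
    have h1 := Nat.floor_le (show 0 ≤ (n : ℝ) / u by positivity)
    have h2 : 1 ≤ (n : ℝ) / u := by rw [le_div_iff₀ hu0]; linarith
    linarith
  have hfail := card_failure_le_of_expectation hn h128 hk2 hkn hrk' hT64 hlam hγ0 hγ1 htest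
  have e1 : lam * n ^ 2 * (3 / 4) ^ (k - 2) ≤
      16 / 9 * ((k : ℝ) ^ (3 * D) * (3 / 4) ^ k) := by
    have h1 : (3 / 4 : ℝ) ^ k = (3 / 4) ^ (k - 2) * (9 / 16) := by
      obtain ⟨j, rfl⟩ : ∃ j, k = j + 2 := ⟨k - 2, by omega⟩
      rw [Nat.add_sub_cancel, pow_add]; norm_num
    calc lam * n ^ 2 * (3 / 4) ^ (k - 2) ≤ n * n ^ 2 * (3 / 4) ^ (k - 2) := by gcongr
      _ = (n : ℝ) ^ 3 * (3 / 4) ^ (k - 2) := by ring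
      _ ≤ ((k : ℝ) ^ D) ^ 3 * (3 / 4) ^ (k - 2) := by gcongr
      _ = _ := by rw [h1, ← pow_mul, mul_comm D 3]; ring
  have e2 := thin_error_le (by omega) hlamn hlog hDL hru' hrk' hbig
  have e3 := size_error_le (by omega) hu0 ha hL0 hlamdef hT1
  have e4 := long_error_le (r := ⌈u⌉₊) (v := γ * u) (by omega) hlamn hγ1.le hlog (by gcongr)
    (by rw [hγu]; linarith)
  have e5 := wide_error_le (by omega) hu0 hγ1.le rfl hDL (by positivity) hlog1 hT2
    (by rw [hγu]; exact hv)
  have e6 : 2 * Real.exp (-(γ * n / 128)) ≤ 2 * Real.exp (-((k : ℝ) ^ (1 - θ) / 128)) := by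
    rw [← hγk]
    gcongr
  rw [hγu] at e4
  refine one_sub_le_prob hmN.le _ ?_
  have hmono : ((kGraphs n k m).filter fun H =>
      ¬ FindsProperColoring scanProgram k (fun v : Fin n => parity v) H).card ≤
      ((kGraphs n k m).filter fun H => ¬ Proper H ((run H n).coloring n)).card := by
    refine Finset.card_le_card fun H hH => ?_
    obtain ⟨h1, h2⟩ := Finset.mem_filter.1 hH
    refine Finset.mem_filter.2 ⟨h1, fun h3 => h2 (findsProperColoring_scanProgram hn (fun e he => ?_) h3)⟩
    exact (Finset.mem_powersetCard.1 ((Finset.mem_powersetCard.1 h1).1 he)).2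
  refine (Nat.cast_le.2 hmono).trans (hfail.trans ?_)
  refine mul_le_mul_of_nonneg_right ?_ (Nat.cast_nonneg _)
  rw [errorBound, ← hL, ← hu]
  linarith

theorem eventually_le_rpow {s : ℝ} (hs : 0 < s) (C : ℝ) : ∀ᶠ k : ℕ in atTop, C ≤ (k : ℝ) ^ s :=
  ((tendsto_rpow_atTop hs).comp tendsto_natCast_atTop_atTop).eventually_ge_atTop C

theorem eventually_thin_condition {τ : ℝ} (hτ0 : 0 < τ) (hτ : τ < 1) (D : ℕ) :
    ∀ᶠ k : ℕ in atTop, ((k : ℝ) ^ τ + 2) * ((D + 1) * Real.log k + Real.log (8 / 7)) ≤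
      Real.log (8 / 7) * k / 2 := by
  have hc : 0 < Real.log (8 / 7) := Real.log_pos (by norm_num)
  filter_upwards [eventually_le_rpow hτ0 2, eventually_gt_atTop 0,
    (Real.tendsto_log_atTop.comp tendsto_natCast_atTop_atTop).eventually_ge_atTop
      (Real.log (8 / 7)),
    eventually_mul_log_le (sub_pos.2 hτ) (4 * (D + 2) / Real.log (8 / 7))] with k h1 h2 h3 h4
  have hk0 : (0 : ℝ) < k := by exact_mod_cast h2
  simp only [Function.comp_apply] at h3
  rw [Real.rpow_sub hk0, Real.rpow_one, div_mul_eq_mul_div,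
    div_le_div_iff₀ hc (by linarith)] at h4
  calc ((k : ℝ) ^ τ + 2) * ((D + 1) * Real.log k + Real.log (8 / 7))
      ≤ (2 * (k : ℝ) ^ τ) * ((D + 2) * Real.log k) := by gcongr <;> linarith
    _ ≤ _ := by linarith

theorem eventually_mul_sq_pow_div_le (D : ℕ) {ε : ℝ} (hε : 0 < ε) :
    ∀ᶠ k : ℕ in atTop, 9 * ((k : ℝ) ^ D) ^ 2 / 2 ^ k ≤ ε := by
  have h : Tendsto (fun k : ℕ => 9 * ((k : ℝ) ^ (D * 2) * (1 / 2 : ℝ) ^ k)) atTop (𝓝 (9 * 0)) :=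
    (tendsto_pow_const_mul_const_pow_of_abs_lt_one _ (by rw [abs_of_pos] <;> norm_num)).const_mul 9
  rw [mul_zero] at h
  filter_upwards [h.eventually_le_const hε] with k hk
  refine le_trans (le_of_eq ?_) hk
  rw [← pow_mul, div_pow, one_pow]; ring

theorem exists_eventually_le_pow {n : ℕ → ℕ}
    (hpoly : ∃ d : ℕ, (fun k => (n k : ℝ)) =O[atTop] fun k : ℕ => (k : ℝ) ^ d) :
    ∃ D : ℕ, ∀ᶠ k : ℕ in atTop, (n k : ℝ) ≤ (k : ℝ) ^ D := by
  obtain ⟨d, hd⟩ := hpoly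
  obtain ⟨C, hC⟩ := hd.bound
  refine ⟨d + 1, ?_⟩
  filter_upwards [hC, tendsto_natCast_atTop_atTop.eventually_ge_atTop C] with k h1 h2
  rw [Real.norm_of_nonneg (Nat.cast_nonneg _), Real.norm_of_nonneg (by positivity)] at h1
  refine h1.trans ?_
  rw [pow_succ, mul_comm]
  gcongr

/-- Scanning finds a proper coloring asymptotically almost surely. -/
theorem tendsto_prob_findsProperColoring {α : ℝ} (hα : α < 1 / 2) {n m : ℕ → ℕ}
    (heven : ∀ k, Even (n k))
    (hsuper : (fun k : ℕ => (k : ℝ)) =o[atTop] fun k => (n k : ℝ))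
    (hpoly : ∃ d : ℕ, (fun k => (n k : ℝ)) =O[atTop] fun k : ℕ => (k : ℝ) ^ d)
    (hm : ∀ᶠ k : ℕ in atTop,
      (m k : ℝ) ≤ 2 * α * ((n k : ℝ) * Real.log k / k) * (phi (n k) k)⁻¹ * 2 ^ (k - 1)) :
    Tendsto (fun k => prob (n k) k (m k)
      (FindsProperColoring scanProgram k (fun v : Fin (n k) => parity v))) atTop (𝓝 1) := by
  obtain ⟨D, hD⟩ := exists_eventually_le_pow hpoly
  -- The bound only involves `α` from above, so it may be replaced by a positive number below `1 /
  -- 2`.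
  obtain ⟨a, hαa, ha0, ha1⟩ : ∃ a, α ≤ a ∧ 0 < a ∧ a < 1 / 2 :=
    ⟨max α (1 / 4), le_max_left _ _, lt_max_of_lt_right (by norm_num), max_lt hα (by norm_num)⟩
  obtain ⟨θ, hθa, hθ1⟩ : ∃ θ, 2 * a < θ ∧ θ < 1 := exists_between (by linarith)
  obtain ⟨τ, hθτ, hτ1⟩ := exists_between hθ1
  have hθ0 : 0 < θ := by linarith
  have hτ0 : 0 < τ := hθ0.trans hθτ
  -- With `3 η = 1 - 2a/θ`, Bernoulli's inequality gives `(1 - η)^3 ≥ 2a/θ`.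
  obtain ⟨η, hη0, hη1, hηθ⟩ : ∃ η : ℝ, 0 < η ∧ η < 1 ∧ 2 * a ≤ θ * (1 - η) ^ 3 := by
    have h1 : 0 < 2 * a / θ := by positivity
    have h2 : 2 * a / θ < 1 := (div_lt_one hθ0).2 hθa
    refine ⟨(1 - 2 * a / θ) / 3, by linarith, by linarith, ?_⟩
    rw [← div_le_iff₀' hθ0]
    have h3 := one_add_mul_le_pow (a := -((1 - 2 * a / θ) / 3)) (by linarith) 3
    rw [← sub_eq_add_neg] at h3
    refine le_trans (le_of_eq ?_) h3
    push_cast; ring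
  have herr := tendsto_errorBound a hθτ hτ1 D
  have hlow : Tendsto (fun k => 1 - errorBound a θ τ D k) atTop (𝓝 1) := by
    simpa using herr.const_sub 1
  refine tendsto_of_tendsto_of_tendsto_of_le_of_le' hlow tendsto_const_nhds ?_
    (Eventually.of_forall fun k => prob_le_one _ _ _ _)
  have hratio : ∀ {c : ℝ}, 0 < c → ∀ᶠ k : ℕ in atTop, (k : ℝ) ≤ c * n k := fun hc => by
    filter_upwards [hsuper.bound hc] with k hk
    simpa using hk
  filter_upwards [hm, hD, hratio (half_pos hη0), hratio (by norm_num : (0 : ℝ) < 1 / 4),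
    eventually_ge_atTop 32, eventually_mul_sq_pow_div_le D (mul_pos hη0 (sub_pos.2 hη1)),
    eventually_mul_log_le one_pos a, eventually_mul_log_le (sub_pos.2 hθτ) (256 * (D + 1)),
    eventually_le_rpow hτ0 64, eventually_thin_condition hτ0 hτ1 D]
    with k h1 h2 h3 h4 h5 h6 h7 h8 h9 h10
  have h4' : 4 * k ≤ n k := by
    have : (4 : ℝ) * k ≤ n k := by linarith
    exact_mod_cast this
  have hk1 : (1 : ℝ) ≤ k := by exact_mod_cast (by omega : 1 ≤ k)
  refine one_sub_errorBound_le_prob (heven k) ha0.le hαa hθ0 hη0 hη1 hηθ (by omega) (by omega) h4'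
    (by linarith) h2 h6 (by simpa using h7) (by linarith) h9 ?_ h10 h1
  simpa using Real.rpow_le_rpow_of_exponent_le hk1 hτ1.le

end HypergraphColoring

theorem theorem2 (α : ℝ) (hα : α < 1 / 2) (n m : ℕ → ℕ)
    (heven : ∀ k, Even (n k))
    (hsuper : (fun k : ℕ => (k : ℝ)) =o[atTop] fun k => (n k : ℝ))
    (hpoly : ∃ d : ℕ, (fun k => (n k : ℝ)) =O[atTop] fun k : ℕ => (k : ℝ) ^ d)
    (hm : ∀ᶠ k : ℕ in atTop,
      (m k : ℝ) ≤ 2 * α * ((n k : ℝ) * Real.log k / k) *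
        (HypergraphColoring.phi (n k) k)⁻¹ * 2 ^ (k - 1)) :
    ∃ P : HypergraphColoring.Program, HypergraphColoring.PolyTime P ∧
      ∃ c₀ : ∀ N : ℕ, HypergraphColoring.Coloring N,
        (∀ N, Even N → HypergraphColoring.Equitable (c₀ N)) ∧
        Tendsto (fun k => HypergraphColoring.prob (n k) k (m k)
          (HypergraphColoring.FindsProperColoring P k (c₀ (n k)))) atTop (𝓝 1) := by
  exact ⟨HypergraphColoring.scanProgram, HypergraphColoring.polyTime_scanProgram,
    fun _ v => HypergraphColoring.parity v, fun _ hN => HypergraphColoring.equitable_parity hN,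
    HypergraphColoring.tendsto_prob_findsProperColoring hα heven hsuper hpoly hm⟩
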